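/- Let $f(s)=\mathbf E[s^{\xi}]$ and $g(s)=\mathbf E[s^{I}]$ be probability generating functions of non-negative integer valued random variables, and let $\mu>0$. Let $Z(t)$, $t\ge 0$, be the number of particles alive at time $t$ in the Markov branching process started from one particle: particles evolve independently, each lives an exponential time with parameter $\mu$ and at its death produces a random number of new particles with p.g.f. $f$. Put $F(t;s)=\mathbf E[s^{Z(t)}]$. Let $r:[0,\infty)\to[0,\infty)$ be locally integrable, $R(t)=\int_0^t r(u)\,du$, let $S_1<S_2<\cdots$ be the (finitely or infinitely many) jump points of a non-homogeneous Poisson process $\nu(t)$ with intensity $r$, let $I_1,I_2,\dots$ be i.i.d. with p.g.f. $g$, let $Z^{(k,j)}$ be i.i.d. copies of $Z$, all these families being independent, and let $$Y(t)=\sum_{k=1}^{\nu(t)}\sum_{j=1}^{I_k}Z^{(k,j)}(t-S_k),\qquad t\ge 0 .$$ Assume that for some $\theta>0$, $\alpha,\gamma\in(0,1]$ and functions $L_R,L,l$ slowly varying at infinity $$r(t)=t^{-\theta}L_R(t)\ (t>0),\qquad f(s)=s+(1-s)^{\gamma+1}L\!\left(\tfrac1{1-s}\right),\qquad g(s)=1-(1-s)^{\alpha}\,l\!\left(\tfrac1{1-s}\right)\quad(0\le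 s<1).$$ Define $q(t;s)=1-g(F(t;s))$, $q(t)=q(t;0)$, $Q(t)=\int_0^t q(u)\,du$, and, when the integrals converge, $Q=\int_0^\infty q(u)\,du$ and $\Delta(s)=\int_0^\infty q(u;s)\,du$. Let $W:[0,\infty)\to[1,\infty)$ be the inverse of the function $V(x)=\int_0^{1-1/x}\frac{du}{f(u)-u}$, $x\ge 1$. (i) If $\theta=1$, $R(t)\to\infty$ as $t\to\infty$, and $\alpha/\gamma>1$, then for every $s\in[0,1]$ the integrals $Q$ and $\Delta(s)$ converge and $$\mathbf E\big[s^{Y(t)}\mid Y(t)>0\big]\to 1-\frac{\Delta(s)}{Q},\qquad t\to\infty .$$ (ii) If $\theta>1$, $\alpha/\gamma=1$, and $Q(t)\to\infty$ as $t\to\infty$, then for every $x\ge 0$ $$\mathbf P\Big\{\frac{Y(t)}{W(\mu t)}\le x\;\Big|\;Y(t)>0\Big\}\to D(\alpha,\gamma;x),\qquad t\to\infty,$$ where $D(\alpha,\gamma;\cdot)$ is the distribution function of a probability law on $[0,\infty)$ with Laplace transform $$\int_0^\infty e^{-\lambda x}\,dD(\alpha,\gamma;x)=1-\frac{\lambda^{\alpha}}{(1+\lambda^{\gamma})^{\alpha/\gamma}},\qquad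 \lambda>0 .$$ -/

import Mathlib

open MeasureTheory ProbabilityTheory Filter Topology Set
open scoped NNReal ENNReal

namespace MBPNPI

noncomputable section

/-- `L` is slowly varying at infinity: measurable and positive on some half-line `[X, ∞)`, with
`L (c x) / L x → 1` as `x → ∞` for every `c > 0`. -/
def IsSlowlyVarying (L : ℝ → ℝ) : Prop :=
  (∃ X : ℝ, Measurable ((Ici X).domRestrict L) ∧ ∀ x, X ≤ x → 0 < L x) ∧
    ∀ c : ℝ, 0 < c → Tendsto (fun x => L (c * x) / L x) atTop (𝓝 1)

/-- The probability generating function of a probability law on `ℕ`. -/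
def pgf (p : PMF ℕ) (s : ℝ) : ℝ := ∑' n : ℕ, (p n).toReal * s ^ n

/-! ### The Markov branching process

A possible particle is labelled by a finite list of natural numbers: `[]` is the ancestor, and the
label `i :: w` is the particle `w` in the family founded by the `i`-th child of the ancestor
(children are numbered `0, 1, 2, …`). -/

/-- The data of a family tree: to each label a lifetime and a number of children. -/
abbrev Tree : Type := List ℕ → ℝ × ℕ

/-- The tree of descendants of the `i`-th child of the ancestor. -/
def subtree (x : Tree) (i : ℕ) : Tree := fun w => x (i :: w)

/-- The particle with the given label is really born at some time: every ancestor in its line has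
enough children. -/
def IsBorn : List ℕ → Tree → Prop
  | [], _ => True
  | i :: w, x => i < (x []).2 ∧ IsBorn w (subtree x i)

/-- The birth time of a particle: the sum of the lifetimes of its strict ancestors. -/
def birthTime : List ℕ → Tree → ℝ
  | [], _ => 0
  | i :: w, x => (x []).1 + birthTime w (subtree x i)

/-- The set of particles alive at time `t`. -/
def aliveAt (x : Tree) (t : ℝ) : Set (List ℕ) :=
  {v | IsBorn v x ∧ birthTime v x ≤ t ∧ t < birthTime v x + (x v).1}

/-- `Z(t)`, the number of particles alive at time `t`, started from one particle at time `0`. -/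
def population (x : Tree) (t : ℝ) : ℕ := (aliveAt x t).ncard

instance expMeasure_isProbabilityMeasure (mu : ℝ) [h : Fact (0 < mu)] :
    IsProbabilityMeasure (expMeasure mu) :=
  isProbabilityMeasure_expMeasure h.out

/-- The law of the family tree of a Markov branching process: all lifetimes are exponential with
rate `mu`, all numbers of children have law `p`, and all of them are independent. -/
def treeLaw (mu : ℝ) [Fact (0 < mu)] (p : PMF ℕ) : Measure Tree :=
  Measure.infinitePi (fun _ : List ℕ => (expMeasure mu).prod p.toMeasure)

/-- `F(t; s) = E[s ^ Z(t) | Z(0) = 1]`. -/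
def branchingPgf (mu : ℝ) [Fact (0 < mu)] (p : PMF ℕ) (t s : ℝ) : ℝ :=
  ∫ x, s ^ population x t ∂(treeLaw mu p)

/-- `q(t; s) = 1 - g(F(t; s))`, with `g` the generating function of the immigrant law `im`. -/
def q (mu : ℝ) [Fact (0 < mu)] (p im : PMF ℕ) (t s : ℝ) : ℝ :=
  1 - pgf im (branchingPgf mu p t s)

/-- `Δ(s) = ∫_0^∞ q(u; s) du`; in particular `Δ(0) = Q`. -/
def Delta (mu : ℝ) [Fact (0 < mu)] (p im : PMF ℕ) (s : ℝ) : ℝ :=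
  ∫ u in Ioi (0 : ℝ), q mu p im u s

/-- `V(x) = U(1 - 1/x)`, where `U(s) = ∫_0^s du / (f(u) - u)` and `f` is the offspring generating
function. -/
def V (p : PMF ℕ) (x : ℝ) : ℝ := ∫ u in (0 : ℝ)..(1 - 1 / x), 1 / (pgf p u - u)

/-- `W`, the inverse function of `V : [1, ∞) → [0, ∞)`. -/
def W (p : PMF ℕ) : ℝ → ℝ := Function.invFunOn (V p) (Ici 1)

/-! ### The immigration -/

/-- The number `ν(t)` of points in `[0, t]`. -/
def countUpTo {Ω : Type*} (S : ℕ → Ω → ℝ≥0∞) (t : ℝ) (ω : Ω) : ℕ :=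
  {k | S k ω ≤ ENNReal.ofReal t}.ncard

/-- `0 < S 0 < S 1 < …` are the jump points of a Poisson process on `[0, ∞)` with intensity `r`.
The value `∞` means that there are no further jumps: when the integral of `r` over `[0, ∞)` is
finite, there are almost surely only finitely many of them. -/
structure IsPoissonJumpPoints {Ω : Type*} [MeasurableSpace Ω] (P : Measure Ω) (r : ℝ → ℝ)
    (S : ℕ → Ω → ℝ≥0∞) : Prop where
  measurable : ∀ k, Measurable (S k)
  pos : ∀ᵐ ω ∂P, 0 < S 0 ω
  increasing : ∀ᵐ ω ∂P, ∀ k, S k ω ≤ S (k + 1) ω ∧ (S k ω ≠ ∞ → S k ω < S (k + 1) ω)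
  locallyFinite : ∀ᵐ ω ∂P, ∀ t : ℝ, {k | S k ω ≤ ENNReal.ofReal t}.Finite
  poisson : ∀ a b : ℝ, 0 ≤ a → a ≤ b →
    P.map (fun ω => countUpTo S b ω - countUpTo S a ω) =
      poissonMeasure (∫ u in a..b, r u).toNNReal
  indepIncrements : HasIndepIncrements (fun (t : ℝ≥0) ω => countUpTo S (t : ℝ) ω) P

/-- The random ingredients of a Markov branching process with non-homogeneous Poisson immigration:
the immigration times `S k`, the group sizes `I k`, and the family tree `X k j` of the `j`-th
immigrant of the `k`-th group (all numbered from `0`). The `I k` are i.i.d. with law `im`, the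
`X k j` are i.i.d. family trees, and the three families are independent of each other. -/
structure IsImmigrationModel {Ω : Type*} [MeasurableSpace Ω] (P : Measure Ω) (r : ℝ → ℝ)
    (mu : ℝ) [Fact (0 < mu)] (p im : PMF ℕ)
    (S : ℕ → Ω → ℝ≥0∞) (I : ℕ → Ω → ℕ) (X : ℕ → ℕ → Ω → Tree) : Prop where
  jumpPoints : IsPoissonJumpPoints P r S
  measurable_size : ∀ k, Measurable (I k)
  law_size : ∀ k, P.map (I k) = im.toMeasure
  indep_size : iIndepFun I P
  measurable_tree : ∀ k j, Measurable (X k j)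
  law_tree : ∀ k j, P.map (X k j) = treeLaw mu p
  indep_tree : iIndepFun (fun kj : ℕ × ℕ => X kj.1 kj.2) P
  indep_size_tree : IndepFun (fun ω k => I k ω) (fun ω (kj : ℕ × ℕ) => X kj.1 kj.2 ω) P
  indep_jumpPoints : IndepFun (fun ω k => S k ω)
    (fun ω => ((fun k => I k ω), fun kj : ℕ × ℕ => X kj.1 kj.2 ω)) P

/-- The process with immigration:
`Y(t)` is the sum over `k < ν(t)` and `j < I k` of `Z^{(k,j)}(t - S k)`. -/
def Y {Ω : Type*} (S : ℕ → Ω → ℝ≥0∞) (I : ℕ → Ω → ℕ) (X : ℕ → ℕ → Ω → Tree)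
    (t : ℝ) (ω : Ω) : ℕ :=
  ∑ k ∈ Finset.range (countUpTo S t ω), ∑ j ∈ Finset.range (I k ω),
    population (X k j ω) (t - (S k ω).toReal)

/-- `D` is the probability law on `[0, ∞)` with Laplace transform
`1 - lam ^ α / (1 + lam ^ γ) ^ (α / γ)`. -/
structure IsLimitLaw (α γ : ℝ) (D : Measure ℝ) : Prop where
  isProbabilityMeasure : IsProbabilityMeasure D
  nonneg : D (Iio 0) = 0
  laplace : ∀ lam : ℝ, 0 < lam →
    ∫ x, Real.exp (-lam * x) ∂D = 1 - lam ^ α / (1 + lam ^ γ) ^ (α / γ)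

end

end MBPNPI

namespace MBPNPI

/-! Everything rests on the formula E[s^Y(t)] = exp(-J(t;s)) with J(t;s) = ∫_0^t r(v) q(t-v;s) dv
(`IsImmigrationModel.integral_pow_Y`): averaging over trees and group sizes leaves a product over
the points of a Poisson process, whose mean is an exponential. Since s^Y is 1 on {Y = 0},
conditioning gives E[s^Y | Y > 0] = 1 - (1 - e^{-J(t;s)}) / (1 - e^{-J(t;0)}). In both regimes the
exponents tend to 0, so only the limit of J(t;s) / J(t;0) matters
(`IsImmigrationModel.tendsto_integral_cond_pow`).

Conditioning on the death of the ancestor gives the backward equation F' = μ (f(F) - F). Separating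
variables, V(1/(1-F(t;s))) = μt + V(1/(1-s)) (`V_branchingPgf`), hence q(u;s) = H(μu + V(1/(1-s)))
with H(y) = 1 - g(1 - 1/W(y)), called `qAux`. Karamata's theorem makes V regularly varying with
index γ, so W has index 1/γ and H has index -α/γ.

In case (i) q is integrable with index below -1, while r has index -1 and a divergent integral. The
convolution is governed by immigrants arriving shortly before t, so J(t;s) ~ r(t) Δ(s), and the
ratio tends to Δ(s)/Q. In case (ii) the roles are exchanged: r is integrable and J(t;0) ~ q(t) ∫ r.
For s = exp(-λ/W(μt)) the shift V(1/(1-s)) is asymptotic to λ^{-γ} μt, so the ratio tends to (1 +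
λ^{-γ})^{-1} and the conditional Laplace transform to 1/(1 + λ^γ).

The continuity theorem is proved on [0,1] for the variable exp(-Y/W), where weak compactness is
available and moments determine the law; this also produces the limit law. Convergence of the
distribution function at every x ≥ 0 needs a law without atoms, which follows from
self-decomposability (`measure_singleton_eq_zero`). -/

/-! ### Probability generating functions -/

lemma hasSum_toReal (p : PMF ℕ) : HasSum (fun n => (p n).toReal) 1 := by
  have h : ∑' n, p n ≠ ∞ := by rw [p.tsum_coe]; simp
  have h1 := (ENNReal.summable_toReal h).hasSum
  rwa [← ENNReal.tsum_toReal_eq (fun n => p.apply_ne_top n), p.tsum_coe, ENNReal.toReal_one] at h1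

lemma pgf_term_nonneg (p : PMF ℕ) {s : ℝ} (hs : 0 ≤ s) (n : ℕ) : 0 ≤ (p n).toReal * s ^ n := by
  positivity

lemma pgf_term_le (p : PMF ℕ) {s : ℝ} (hs : s ∈ Icc (0 : ℝ) 1) (n : ℕ) :
    (p n).toReal * s ^ n ≤ (p n).toReal :=
  mul_le_of_le_one_right ENNReal.toReal_nonneg (pow_le_one₀ hs.1 hs.2)

lemma summable_pgf (p : PMF ℕ) {s : ℝ} (hs : s ∈ Icc (0 : ℝ) 1) :
    Summable fun n => (p n).toReal * s ^ n :=
  (hasSum_toReal p).summable.of_nonneg_of_le (pgf_term_nonneg p hs.1) (pgf_term_le p hs)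

lemma pgf_one (p : PMF ℕ) : pgf p 1 = 1 := by
  simp [pgf, (hasSum_toReal p).tsum_eq]

lemma pgf_mono (p : PMF ℕ) : MonotoneOn (pgf p) (Icc 0 1) := fun _ hs _ ht hst =>
  (summable_pgf p hs).tsum_le_tsum
    (fun n => mul_le_mul_of_nonneg_left (pow_le_pow_left₀ hs.1 hst n) ENNReal.toReal_nonneg)
    (summable_pgf p ht)

lemma pgf_mem_Icc (p : PMF ℕ) {s : ℝ} (hs : s ∈ Icc (0 : ℝ) 1) : pgf p s ∈ Icc (0 : ℝ) 1 :=
  ⟨tsum_nonneg (pgf_term_nonneg p hs.1),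
    (pgf_mono p hs (right_mem_Icc.2 zero_le_one) hs.2).trans_eq (pgf_one p)⟩

lemma continuousOn_pgf (p : PMF ℕ) : ContinuousOn (pgf p) (Icc 0 1) := by
  refine continuousOn_tsum (u := fun n => (p n).toReal) (fun n => by fun_prop)
    (hasSum_toReal p).summable fun n s hs => ?_
  rw [Real.norm_of_nonneg (pgf_term_nonneg p hs.1 n)]
  exact pgf_term_le p hs n

lemma convexOn_pgf (p : PMF ℕ) : ConvexOn ℝ (Icc 0 1) (pgf p) := by
  refine ⟨convex_Icc 0 1, fun x hx y hy a b ha hb hab => ?_⟩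
  have hz := convex_Icc (0 : ℝ) 1 hx hy ha hb hab
  have e := ((summable_pgf p hx).mul_left a).tsum_add ((summable_pgf p hy).mul_left b)
  simp only [smul_eq_mul] at hz ⊢
  unfold pgf
  rw [← tsum_mul_left, ← tsum_mul_left, ← e]
  refine (summable_pgf p hz).tsum_le_tsum (fun n => ?_)
    (((summable_pgf p hx).mul_left a).add ((summable_pgf p hy).mul_left b))
  have := (convexOn_pow (𝕜 := ℝ) n).2 (mem_Ici.2 hx.1) (mem_Ici.2 hy.1) ha hb hab
  simp only [smul_eq_mul] at this
  nlinarith [mul_le_mul_of_nonneg_left this (ENNReal.toReal_nonneg (a := p n))]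

lemma integrable_pow_pmf (p : PMF ℕ) {s : ℝ} (hs : s ∈ Icc (0 : ℝ) 1) :
    Integrable (fun n => s ^ n) p.toMeasure := by
  refine Integrable.of_bound (C := 1) (measurable_of_countable _).aestronglyMeasurable
    (ae_of_all _ fun n => ?_)
  rw [Real.norm_of_nonneg (pow_nonneg hs.1 n)]
  exact pow_le_one₀ hs.1 hs.2

lemma integral_pow_pmf (p : PMF ℕ) {s : ℝ} (hs : s ∈ Icc (0 : ℝ) 1) :
    ∫ n, s ^ n ∂p.toMeasure = pgf p s := by
  rw [PMF.integral_eq_tsum p _ (integrable_pow_pmf p hs)]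
  simp [pgf]

/-- A generating function that exceeds the identity near `1` exceeds it on `[0, 1)`. -/
lemma lt_pgf (p : PMF ℕ) {s₀ : ℝ} (h0 : ∀ s ∈ Ico s₀ 1, s < pgf p s) (hs₀ : s₀ < 1) {s : ℝ}
    (hs : s ∈ Ico (0 : ℝ) 1) : s < pgf p s := by
  by_contra! hle
  -- A point strictly between s and 1 where the hypothesis applies; convexity along the chord from s
  -- to 1 would force f(t) ≤ t there.
  set t := max s₀ ((s + 1) / 2) with ht
  have h1 : s < t := lt_of_lt_of_le (by linarith [hs.2]) (le_max_right _ _)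
  have h2 : t < 1 := max_lt hs₀ (by linarith [hs.2])
  have h3 := h0 t ⟨le_max_left _ _, h2⟩
  have hd : 0 < 1 - s := by linarith
  have ha : 0 ≤ (1 - t) / (1 - s) := by apply div_nonneg <;> linarith
  have hb : 0 ≤ (t - s) / (1 - s) := by apply div_nonneg <;> linarith
  have := (convexOn_pgf p).2 ⟨hs.1, hs.2.le⟩ (right_mem_Icc.2 zero_le_one) ha hb
    (by field_simp; ring)
  simp only [smul_eq_mul, pgf_one] at this
  have e : (1 - t) / (1 - s) * s + (t - s) / (1 - s) * 1 = t := by field_simp; ring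
  rw [e] at this
  have : (1 - t) / (1 - s) * pgf p s ≤ (1 - t) / (1 - s) * s :=
    mul_le_mul_of_nonneg_left hle ha
  linarith

/-! ### Measurability of random index sets -/

/-- The set of indices selected by measurable sets, as a function of the point. -/
lemma measurableSet_setOf_eq {α ι : Type*} [MeasurableSpace α] [Countable ι] {A : ι → Set α}
    (hA : ∀ i, MeasurableSet (A i)) (F : Set ι) : MeasurableSet {a | {i | a ∈ A i} = F} := by
  have : {a | {i | a ∈ A i} = F} = ⋂ i, {a | a ∈ A i ↔ i ∈ F} := by
    ext a; simp [Set.ext_iff]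
  rw [this]
  refine MeasurableSet.iInter fun i => ?_
  by_cases h : i ∈ F
  · simpa [h] using hA i
  · simp only [h, iff_false]
    exact (hA i).compl

/-- A countable type has only countably many finite subsets, so the event is a countable union over
the possible values. -/
lemma measurableSet_setOf_finite {α ι : Type*} [MeasurableSpace α] [Countable ι] {A : ι → Set α}
    (hA : ∀ i, MeasurableSet (A i)) : MeasurableSet {a | {i | a ∈ A i}.Finite} := by
  have : {a | {i | a ∈ A i}.Finite} = ⋃ F : Finset ι, {a | {i | a ∈ A i} = F} := by
    ext a
    simp only [mem_ofPred_eq, mem_iUnion]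
    exact ⟨fun h => ⟨h.toFinset, by simp⟩, fun ⟨F, h⟩ => h ▸ F.finite_toSet⟩
  rw [this]
  exact MeasurableSet.iUnion fun F => measurableSet_setOf_eq hA _

lemma measurable_ncard {α ι : Type*} [MeasurableSpace α] [Countable ι] {A : ι → Set α}
    (hA : ∀ i, MeasurableSet (A i)) : Measurable fun a => {i | a ∈ A i}.ncard := by
  have key : ∀ n, MeasurableSet {a | {i | a ∈ A i}.Finite ∧ {i | a ∈ A i}.ncard = n} := by
    intro n
    have : {a | {i | a ∈ A i}.Finite ∧ {i | a ∈ A i}.ncard = n} =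
        ⋃ F : {F : Finset ι // F.card = n}, {a | {i | a ∈ A i} = F.1} := by
      ext a
      simp only [mem_ofPred_eq, mem_iUnion]
      constructor
      · rintro ⟨h, rfl⟩
        exact ⟨⟨h.toFinset, (ncard_eq_toFinset_card _ h).symm⟩, by simp⟩
      · rintro ⟨⟨F, hF⟩, h⟩
        rw [h]
        exact ⟨F.finite_toSet, by simpa using hF⟩
    rw [this]
    exact MeasurableSet.iUnion fun F => measurableSet_setOf_eq hA _
  refine measurable_to_countable' fun n => ?_
  have hfin := measurableSet_setOf_finite hA
  -- `ncard` is 0 at infinite sets, so the fibre over 0 also contains the event of infinitely many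
  -- indices.
  by_cases hn : n = 0
  · subst hn
    convert (key 0).union hfin.compl using 1
    ext a
    by_cases h : {i | a ∈ A i}.Finite
    · simp only [mem_preimage, mem_singleton_iff, mem_union, mem_ofPred_eq, mem_compl_iff, h,
        true_and, not_true_eq_false, or_false]
    · simp only [mem_preimage, mem_singleton_iff, mem_union, mem_ofPred_eq, mem_compl_iff, h,
        not_false_eq_true, or_true, iff_true]
      exact Set.Infinite.ncard h
  · convert key n using 1
    ext a
    simp only [mem_preimage, mem_singleton_iff, mem_ofPred_eq, iff_and_self]
    rintro rfl
    exact finite_of_ncard_ne_zero hn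

/-! ### The family tree -/

lemma nil_mem_aliveAt {x : Tree} {t : ℝ} : [] ∈ aliveAt x t ↔ 0 ≤ t ∧ t < (x []).1 := by
  simp [aliveAt, IsBorn, birthTime]

lemma cons_mem_aliveAt {x : Tree} {t : ℝ} {i : ℕ} {w : List ℕ} :
    i :: w ∈ aliveAt x t ↔ i < (x []).2 ∧ w ∈ aliveAt (subtree x i) (t - (x []).1) := by
  simp only [aliveAt, mem_ofPred_eq, IsBorn, birthTime, subtree]
  constructor
  · rintro ⟨⟨h1, h2⟩, h3, h4⟩; exact ⟨h1, h2, by linarith, by linarith⟩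
  · rintro ⟨h1, h2, h3, h4⟩; exact ⟨⟨h1, h2⟩, by linarith, by linarith⟩

lemma birthTime_nonneg (v : List ℕ) {x : Tree} (hx : ∀ w, 0 ≤ (x w).1) : 0 ≤ birthTime v x := by
  induction v generalizing x with
  | nil => exact le_rfl
  | cons i w ih => exact add_nonneg (hx []) (ih fun w => hx (i :: w))

lemma aliveAt_of_neg {x : Tree} (hx : ∀ w, 0 ≤ (x w).1) {t : ℝ} (ht : t < 0) :
    aliveAt x t = ∅ := by
  ext v
  simp only [aliveAt, mem_ofPred_eq, mem_empty_iff_false, iff_false]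
  rintro ⟨-, h, -⟩
  linarith [birthTime_nonneg v hx]

lemma aliveAt_of_lt {x : Tree} (hx : ∀ w, 0 ≤ (x w).1) {t : ℝ} (h0 : 0 ≤ t)
    (ht : t < (x []).1) : aliveAt x t = {[]} := by
  ext v
  cases v with
  | nil => simp [nil_mem_aliveAt, h0, ht]
  | cons i w =>
    rw [cons_mem_aliveAt, aliveAt_of_neg (x := subtree x i) (fun w => hx (i :: w)) (by linarith)]
    simp

/-- After the death of the ancestor the living particles are sorted by the first entry of their
label, that is, by the child from which they descend, with the clock restarted at the death. -/
lemma aliveAt_of_le {x : Tree} {t : ℝ} (ht : (x []).1 ≤ t) :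
    aliveAt x t = ⋃ i ∈ Finset.range (x []).2,
      List.cons i '' aliveAt (subtree x i) (t - (x []).1) := by
  ext v
  cases v with
  | nil => simp [nil_mem_aliveAt, ht]
  | cons i w => simp [cons_mem_aliveAt, and_comm]

open Classical in
/-- `s` to the power of the cardinality, with value `0` at infinite sets. -/
noncomputable def cardPow (s : ℝ) (A : Set (List ℕ)) : ℝ := if A.Finite then s ^ A.ncard else 0

/-- The value 0 at infinite sets makes multiplicativity unconditional; a power of `ncard` alone
would fail when one of the sets is infinite. -/
lemma cardPow_union (s : ℝ) {A B : Set (List ℕ)} (h : Disjoint A B) :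
    cardPow s (A ∪ B) = cardPow s A * cardPow s B := by
  unfold cardPow
  by_cases hA : A.Finite
  · by_cases hB : B.Finite
    · simp [hA, hB, finite_union, pow_add, ncard_union_eq h hA hB]
    · simp [hB, finite_union]
  · simp [hA, finite_union]

lemma cardPow_image (s : ℝ) (i : ℕ) (A : Set (List ℕ)) :
    cardPow s (List.cons i '' A) = cardPow s A := by
  have hi : Function.Injective (List.cons i) := List.cons_injective
  unfold cardPow
  rw [finite_image_iff hi.injOn, ncard_image_of_injective _ hi]

lemma cardPow_biUnion (s : ℝ) (B : ℕ → Set (List ℕ)) (n : ℕ) :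
    cardPow s (⋃ i ∈ Finset.range n, List.cons i '' B i) =
      ∏ i ∈ Finset.range n, cardPow s (B i) := by
  induction n with
  | zero => simp [cardPow]
  | succ n ih =>
    rw [Finset.range_add_one, Finset.set_biUnion_insert, union_comm, cardPow_union, ih,
      cardPow_image, Finset.prod_insert (by simp), mul_comm]
    rw [Set.disjoint_left]
    intro v hv hv'
    simp only [mem_iUnion, mem_image, Finset.mem_range] at hv hv'
    obtain ⟨i, hi, w, -, rfl⟩ := hv
    obtain ⟨w', -, h⟩ := hv'
    simp only [List.cons.injEq] at h
    omega

lemma cardPow_mem_Icc {s : ℝ} (hs : s ∈ Icc (0 : ℝ) 1) (A : Set (List ℕ)) :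
    cardPow s A ∈ Icc (0 : ℝ) 1 := by
  unfold cardPow
  split_ifs
  · exact ⟨pow_nonneg hs.1 _, pow_le_one₀ hs.1 hs.2⟩
  · simp

lemma cardPow_aliveAt_of_lt (s : ℝ) {x : Tree} (hx : ∀ w, 0 ≤ (x w).1) {t : ℝ} (h0 : 0 ≤ t)
    (ht : t < (x []).1) : cardPow s (aliveAt x t) = s := by
  rw [aliveAt_of_lt hx h0 ht]; simp [cardPow]

lemma cardPow_aliveAt_of_le (s : ℝ) {x : Tree} {t : ℝ} (ht : (x []).1 ≤ t) :
    cardPow s (aliveAt x t) =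
      ∏ i ∈ Finset.range (x []).2, cardPow s (aliveAt (subtree x i) (t - (x []).1)) := by
  rw [aliveAt_of_le ht, cardPow_biUnion]

lemma measurable_subtree (i : ℕ) : Measurable fun x : Tree => subtree x i := by
  unfold subtree; fun_prop

lemma measurable_birthTime (v : List ℕ) : Measurable (birthTime v) := by
  induction v with
  | nil => exact measurable_const
  | cons i w ih =>
    exact ((measurable_pi_apply _).fst).add (ih.comp (measurable_subtree i))

lemma measurableSet_isBorn (v : List ℕ) : MeasurableSet {x | IsBorn v x} := by
  induction v with
  | nil => exact MeasurableSet.univ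
  | cons i w ih =>
    have h : Measurable fun x : Tree => (x []).2 := by fun_prop
    exact (measurableSet_lt measurable_const h).inter (measurable_subtree i ih)

lemma measurableSet_mem_aliveAt (v : List ℕ) :
    MeasurableSet {a : Tree × ℝ | v ∈ aliveAt a.1 a.2} := by
  have h1 : Measurable fun a : Tree × ℝ => birthTime v a.1 :=
    (measurable_birthTime v).comp measurable_fst
  have h2 : Measurable fun a : Tree × ℝ => (a.1 v).1 := by fun_prop
  exact (measurable_fst (measurableSet_isBorn v)).inter
    ((measurableSet_le h1 measurable_snd).inter (measurableSet_lt measurable_snd (h1.add h2)))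

lemma measurable_population : Measurable fun a : Tree × ℝ => population a.1 a.2 :=
  measurable_ncard measurableSet_mem_aliveAt

lemma measurable_cardPow (s : ℝ) :
    Measurable fun a : Tree × ℝ => cardPow s (aliveAt a.1 a.2) :=
  Measurable.ite (measurableSet_setOf_finite measurableSet_mem_aliveAt)
    ((measurable_of_countable (fun n : ℕ => s ^ n)).comp measurable_population) measurable_const

/-! ### The law of the family tree -/

lemma measurable_pi_pi {α ι κ β : Type*} [MeasurableSpace α] [MeasurableSpace β]
    {f : α → ι → κ → β} (hf : ∀ i j, Measurable fun a => f a i j) : Measurable f :=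
  measurable_pi_iff.2 fun i => measurable_pi_iff.2 (hf i)

section law

variable (mu : ℝ) [Fact (0 < mu)] (p : PMF ℕ)

instance treeLaw_isProbabilityMeasure : IsProbabilityMeasure (treeLaw mu p) := by
  unfold treeLaw; infer_instance

/-- The branching property. Labels other than the root are the pairs (child, label inside the family
of that child), so a product measure over labels factors into the root and i.i.d. copies of itself.
-/
lemma map_treeLaw :
    (treeLaw mu p).map (fun x => (x [], fun i => subtree x i)) =
      ((expMeasure mu).prod p.toMeasure).prod (Measure.infinitePi fun _ : ℕ => treeLaw mu p) := by
  set m := (expMeasure mu).prod p.toMeasure with hm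
  have hindep : iIndepFun (fun (v : List ℕ) (x : Tree) => x v) (treeLaw mu p) :=
    iIndepFun_infinitePi (P := fun _ : List ℕ => m) (X := fun _ ω => ω) (by fun_prop)
  have h2 : (treeLaw mu p).map (fun x (j : ℕ × List ℕ) => x (j.1 :: j.2)) =
      Measure.infinitePi (fun _ : ℕ × List ℕ => m) :=
    Measure.map_infinitePi_infinitePi_of_inj (P := fun _ : List ℕ => m)
      (f := fun j : ℕ × List ℕ => j.1 :: j.2) (by rintro ⟨a, b⟩ ⟨c, d⟩ h; simpa using h)
  have h3 : (treeLaw mu p).map (fun x i => subtree x i) =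
      Measure.infinitePi fun _ : ℕ => treeLaw mu p := by
    unfold treeLaw
    -- Currying the product over pairs (i, w) gives a product over i of tree laws.
    rw [← hm, ← Measure.infinitePi_map_curry (fun (_ : ℕ) (_ : List ℕ) => m), ← h2,
      Measure.map_map (by fun_prop) (by fun_prop)]
    rfl
  have h1 : (treeLaw mu p).map (fun x => x []) = m :=
    Measure.infinitePi_map_eval (fun _ : List ℕ => m) []
  have hind : IndepFun (fun x : Tree => x []) (fun x i => subtree x i) (treeLaw mu p) := by
    have := indep_iSup_of_disjoint (m := fun v : List ℕ =>
      MeasurableSpace.comap (fun x : Tree => x v) inferInstance) (μ := treeLaw mu p)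
      (fun v => (measurable_pi_apply v).comap_le) hindep (S := {[]}) (T := {[]}ᶜ)
      disjoint_compl_right
    rw [IndepFun_iff_Indep]
    refine indep_of_indep_of_le_left (indep_of_indep_of_le_right this ?_) ?_
    -- The family of subtrees only reads coordinates different from the root.
    · have : Measurable[⨆ v ∈ ({[]}ᶜ : Set (List ℕ)), MeasurableSpace.comap
          (fun x : Tree => x v) inferInstance] (fun x : Tree => fun i => subtree x i) := by
        refine @measurable_pi_pi _ _ _ _ (_) _ _ fun i w => ?_
        exact Measurable.of_comap_le (le_iSup₂_of_le (f := fun v _ => MeasurableSpace.comap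
          (fun x : Tree => x v) inferInstance) (i :: w) (by simp) le_rfl)
      exact this.comap_le
    · simp
  rw [(indepFun_iff_map_prod_eq_prod_map_map (measurable_pi_apply _).aemeasurable
    (measurable_pi_lambda _ measurable_subtree).aemeasurable).1 hind, h1, h3]

lemma ae_lifetime_nonneg : ∀ᵐ x ∂treeLaw mu p, ∀ w, 0 ≤ (x w).1 := by
  rw [ae_all_iff]
  intro w
  have h : ∀ᵐ u ∂expMeasure mu, 0 ≤ u := by
    have : expMeasure mu = volume.withDensity (exponentialPDF mu) := rfl
    rw [this, ae_iff, show {a : ℝ | ¬ 0 ≤ a} = Iio 0 by ext; simp,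
      withDensity_apply _ measurableSet_Iio]
    exact lintegral_exponentialPDF_of_nonpos (x := (0 : ℝ)) (r := mu) le_rfl
  have h1 : ∀ᵐ u ∂((expMeasure mu).prod p.toMeasure), 0 ≤ u.1 :=
    Measure.quasiMeasurePreserving_fst.ae h
  have e := Measure.infinitePi_map_eval (fun _ : List ℕ => (expMeasure mu).prod p.toMeasure) w
  rw [← e] at h1
  exact ae_of_ae_map (measurable_pi_apply w).aemeasurable h1

lemma integral_expMeasure (φ : ℝ → ℝ) :
    ∫ u, φ u ∂expMeasure mu = ∫ u in Ioi 0, mu * Real.exp (-(mu * u)) * φ u := by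
  have hmu : 0 < mu := Fact.out
  have : expMeasure mu = volume.withDensity (exponentialPDF mu) := rfl
  have h := integral_withDensity_eq_integral_toReal_smul (μ := volume) (f := exponentialPDF mu)
    (by exact (measurable_exponentialPDFReal mu).ennreal_ofReal)
    (ae_of_all _ fun _ => ENNReal.ofReal_lt_top) φ
  rw [this, h, ← integral_Ici_eq_integral_Ioi, ← integral_indicator measurableSet_Ici]
  congr 1
  ext u
  by_cases hu : 0 ≤ u
  · rw [indicator_of_mem (mem_Ici.2 hu), exponentialPDF_of_nonneg hu,
      ENNReal.toReal_ofReal (by positivity), smul_eq_mul]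
  · rw [indicator_of_notMem (by simpa using hu), exponentialPDF_of_neg (not_le.1 hu)]
    simp

end law

lemma measurable_natParam {α β : Type*} [MeasurableSpace α] [MeasurableSpace β] {c : α → ℕ}
    (hc : Measurable c) {g : ℕ → α → β} (hg : ∀ n, Measurable (g n)) :
    Measurable fun a => g (c a) a := by
  have : Measurable fun q : ℕ × α => g q.1 q.2 := measurable_from_prod_countable_right hg
  exact this.comp (hc.prodMk measurable_id)

/-! ### The renewal equation of the branching process -/

section renewal

variable (mu : ℝ) [Fact (0 < mu)] (p : PMF ℕ)

/-- The generating function of the number of living particles, restricted to the event that this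
number is finite. -/
noncomputable def finPgf (s t : ℝ) : ℝ := ∫ x, cardPow s (aliveAt x t) ∂treeLaw mu p

variable {s : ℝ} (hs : s ∈ Icc (0 : ℝ) 1)

lemma measurable_finPgf (s : ℝ) : Measurable (finPgf mu p s) := by
  have h : StronglyMeasurable fun a : ℝ × Tree => cardPow s (aliveAt a.2 a.1) :=
    ((measurable_cardPow s).comp measurable_swap).stronglyMeasurable
  exact (h.integral_prod_right (ν := treeLaw mu p)).measurable

include hs in
lemma integrable_cardPow (t : ℝ) :
    Integrable (fun x => cardPow s (aliveAt x t)) (treeLaw mu p) := by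
  refine Integrable.of_bound (C := 1) ?_ (ae_of_all _ fun x => ?_)
  · exact ((measurable_cardPow s).comp (measurable_id.prodMk measurable_const)).aestronglyMeasurable
  · rw [Real.norm_of_nonneg (cardPow_mem_Icc hs _).1]
    exact (cardPow_mem_Icc hs _).2

include hs in
lemma finPgf_mem_Icc (t : ℝ) : finPgf mu p s t ∈ Icc (0 : ℝ) 1 := by
  refine ⟨integral_nonneg fun x => (cardPow_mem_Icc hs _).1, ?_⟩
  calc finPgf mu p s t ≤ ∫ _, (1 : ℝ) ∂treeLaw mu p :=
        integral_mono (integrable_cardPow mu p hs t) (integrable_const _)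
          fun x => (cardPow_mem_Icc hs _).2
    _ = 1 := by simp

lemma integral_prod_cardPow (n : ℕ) (t : ℝ) :
    ∫ y : ℕ → Tree, ∏ i ∈ Finset.range n, cardPow s (aliveAt (y i) t)
      ∂(Measure.infinitePi fun _ : ℕ => treeLaw mu p) = finPgf mu p s t ^ n := by
  have hm : Measurable fun x : Tree => cardPow s (aliveAt x t) :=
    (measurable_cardPow s).comp (measurable_id.prodMk measurable_const)
  have hi : iIndepFun (fun (i : ℕ) (y : ℕ → Tree) => y i)
      (Measure.infinitePi fun _ : ℕ => treeLaw mu p) :=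
    iIndepFun_infinitePi (P := fun _ : ℕ => treeLaw mu p) (X := fun _ ω => ω) (by fun_prop)
  have hi' := (hi.precomp (g := fun i : Fin n => (i : ℕ)) Fin.val_injective).integral_fun_prod_comp
    (f := fun _ x => cardPow s (aliveAt x t)) (fun i => (measurable_pi_apply _).aemeasurable)
    (fun i => hm.aestronglyMeasurable)
  have e : ∀ i : ℕ, ∫ y : ℕ → Tree, cardPow s (aliveAt (y i) t)
      ∂(Measure.infinitePi fun _ : ℕ => treeLaw mu p) = finPgf mu p s t := by
    intro i
    have := Measure.infinitePi_map_eval (fun _ : ℕ => treeLaw mu p) i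
    exact (integral_map (f := fun x => cardPow s (aliveAt x t))
      (measurable_pi_apply i).aemeasurable hm.aestronglyMeasurable).symm.trans
      (by rw [this])
  have h2 : ∀ y : ℕ → Tree, ∏ i ∈ Finset.range n, cardPow s (aliveAt (y i) t) =
      ∏ i : Fin n, cardPow s (aliveAt (y i) t) := fun y =>
    (Fin.prod_univ_eq_prod_range (fun i => cardPow s (aliveAt (y i) t)) n).symm
  simp_rw [h2]
  rw [hi']
  simp [e]

include hs in
-- Condition on the lifetime u of the ancestor: for u > t the ancestor is the only particle and
-- contributes s, otherwise the children start independent processes with remaining time t - u.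
-- Working with `cardPow` lets this hold before explosion is excluded.
lemma finPgf_eq_expMeasure {t : ℝ} (ht : 0 ≤ t) : finPgf mu p s t =
    ∫ u, (if t < u then s else pgf p (finPgf mu p s (t - u))) ∂expMeasure mu := by
  classical
  set Φ : (ℝ × ℕ) × (ℕ → Tree) → ℝ := fun a => if t < a.1.1 then s else
    ∏ i ∈ Finset.range a.1.2, cardPow s (aliveAt (a.2 i) (t - a.1.1)) with hΦ
  have hmΦ : Measurable Φ := by
    refine Measurable.ite (measurableSet_lt measurable_const (by fun_prop)) measurable_const ?_
    refine measurable_natParam (g := fun n (a : (ℝ × ℕ) × (ℕ → Tree)) =>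
      ∏ i ∈ Finset.range n, cardPow s (aliveAt (a.2 i) (t - a.1.1))) (by fun_prop) fun n => ?_
    refine Finset.measurable_prod _ fun i _ => ?_
    exact (measurable_cardPow s).comp
      (f := fun a : (ℝ × ℕ) × (ℕ → Tree) => (a.2 i, t - a.1.1)) (by fun_prop)
  have hbΦ : ∀ a, Φ a ∈ Icc (0 : ℝ) 1 := by
    intro a
    simp only [hΦ]
    split_ifs
    · exact hs
    · exact ⟨Finset.prod_nonneg fun i _ => (cardPow_mem_Icc hs _).1,
        Finset.prod_le_one (fun i _ => (cardPow_mem_Icc hs _).1)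
          fun i _ => (cardPow_mem_Icc hs _).2⟩
  have h1 : finPgf mu p s t = ∫ x : Tree, Φ (x [], fun i => subtree x i) ∂treeLaw mu p := by
    refine integral_congr_ae ?_
    filter_upwards [ae_lifetime_nonneg mu p] with x hx
    simp only [hΦ]
    split_ifs with h
    · exact cardPow_aliveAt_of_lt s hx ht h
    · exact cardPow_aliveAt_of_le s (not_lt.1 h)
  have hΦi : ∀ (ν : Measure ((ℝ × ℕ) × (ℕ → Tree))) [IsProbabilityMeasure ν], Integrable Φ ν :=
    fun ν _ => Integrable.of_bound (C := 1) hmΦ.aestronglyMeasurable (ae_of_all _ fun a => by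
      rw [Real.norm_of_nonneg (hbΦ a).1]; exact (hbΦ a).2)
  have hmeas : Measurable fun x : Tree => (x [], fun i => subtree x i) :=
    (measurable_pi_apply _).prodMk (measurable_pi_lambda _ measurable_subtree)
  rw [h1, ← integral_map (φ := fun x : Tree => (x [], fun i => subtree x i)) hmeas.aemeasurable
    hmΦ.aestronglyMeasurable, map_treeLaw, integral_prod _ (hΦi _), integral_prod]
  · refine integral_congr_ae (ae_of_all _ fun u => ?_)
    simp only [hΦ]
    split_ifs with h
    · simp
    · simp_rw [integral_prod_cardPow mu p]
      exact integral_pow_pmf p (finPgf_mem_Icc mu p hs _)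
  · exact (hΦi _).integral_prod_left

include hs in
lemma finPgf_eq {t : ℝ} (ht : 0 ≤ t) : finPgf mu p s t = s * Real.exp (-(mu * t)) +
    ∫ u in (0 : ℝ)..t, mu * Real.exp (-(mu * u)) * pgf p (finPgf mu p s (t - u)) := by
  have hmu : 0 < mu := Fact.out
  have hmeas : Measurable fun u => pgf p (finPgf mu p s (t - u)) := by
    have h1 : Measurable fun u => finPgf mu p s (t - u) :=
      (measurable_finPgf mu p s).comp (by fun_prop)
    have h2 : Measurable (projIcc (0 : ℝ) 1 zero_le_one) := continuous_projIcc.measurable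
    have h3 : Measurable fun z : Icc (0 : ℝ) 1 => pgf p z :=
      (continuousOn_iff_continuous_domRestrict.1 (continuousOn_pgf p)).measurable
    convert h3.comp (h2.comp h1) using 2 with u
    simp [projIcc_of_mem zero_le_one (finPgf_mem_Icc mu p hs (t - u))]
  have hexp : IntegrableOn (fun u => mu * Real.exp (-(mu * u))) (Ioi 0) := by
    have := (integrableOn_exp_mul_Ioi (a := -mu) (by linarith) 0).const_mul mu
    simpa [neg_mul, IntegrableOn] using this
  have hint : IntegrableOn (fun u => mu * Real.exp (-(mu * u)) *
      (if t < u then s else pgf p (finPgf mu p s (t - u)))) (Ioi 0) := by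
    refine Integrable.mul_bdd (c := 1) hexp ?_ (ae_of_all _ fun u => ?_)
    · exact (Measurable.ite (measurableSet_lt measurable_const measurable_id) measurable_const
        hmeas).aestronglyMeasurable
    · have : (if t < u then s else pgf p (finPgf mu p s (t - u))) ∈ Icc (0 : ℝ) 1 := by
        split_ifs
        · exact hs
        · exact pgf_mem_Icc p (finPgf_mem_Icc mu p hs _)
      rw [Real.norm_of_nonneg this.1]
      exact this.2
  rw [finPgf_eq_expMeasure mu p hs ht, integral_expMeasure, ← Ioc_union_Ioi_eq_Ioi ht,
    setIntegral_union (Ioc_disjoint_Ioi le_rfl) measurableSet_Ioi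
      (hint.mono_set Ioc_subset_Ioi_self) (hint.mono_set (Ioi_subset_Ioi ht)), add_comm,
    intervalIntegral.integral_of_le ht]
  congr 1
  · rw [setIntegral_congr_fun (g := fun u => s * mu * Real.exp (-mu * u)) measurableSet_Ioi]
    · rw [integral_const_mul, integral_exp_mul_Ioi (by linarith)]
      field_simp
    · intro u hu
      simp only [if_pos (mem_Ioi.1 hu)]
      ring_nf
  · refine setIntegral_congr_fun measurableSet_Ioc fun u hu => ?_
    simp only [if_neg (not_lt.2 hu.2)]

end renewal

/-! ### Absence of explosion and the backward equation -/

section ode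

variable (mu : ℝ) [Fact (0 < mu)] (p : PMF ℕ)

lemma measurable_pgf_finPgf {s : ℝ} (hs : s ∈ Icc (0 : ℝ) 1) :
    Measurable fun u => pgf p (finPgf mu p s u) := by
  have h2 : Measurable (projIcc (0 : ℝ) 1 zero_le_one) := continuous_projIcc.measurable
  have h3 : Measurable fun z : Icc (0 : ℝ) 1 => pgf p z :=
    (continuousOn_iff_continuous_domRestrict.1 (continuousOn_pgf p)).measurable
  convert h3.comp (h2.comp (measurable_finPgf mu p s)) using 2 with u
  simp [projIcc_of_mem zero_le_one (finPgf_mem_Icc mu p hs u)]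

lemma hasDerivAt_exp_neg_mul (mu t : ℝ) :
    HasDerivAt (fun t => Real.exp (-(mu * t))) (-(mu * Real.exp (-(mu * t)))) t := by
  have h : HasDerivAt (fun t => -(mu * t)) (-mu) t := by
    simpa using ((hasDerivAt_id t).const_mul mu).fun_neg
  exact h.exp.congr_deriv (by ring)

omit [Fact (0 < mu)] in
lemma exp_mul_integral (t : ℝ) :
    ∫ u in (0 : ℝ)..t, mu * Real.exp (-(mu * u)) = 1 - Real.exp (-(mu * t)) := by
  have h : ∀ x ∈ uIcc 0 t, HasDerivAt (fun u => -Real.exp (-(mu * u)))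
      (mu * Real.exp (-(mu * x))) x := by
    intro x _
    simpa using (hasDerivAt_exp_neg_mul mu x).fun_neg
  rw [intervalIntegral.integral_eq_sub_of_hasDerivAt h (by
    apply Continuous.intervalIntegrable; fun_prop)]
  simp; ring

/-- A branching process whose offspring mean is at most `1` does not explode. -/
lemma finPgf_one (hp : ∀ s ∈ Icc (0 : ℝ) 1, s ≤ pgf p s) {t : ℝ} (ht : 0 ≤ t) :
    finPgf mu p 1 t = 1 := by
  have hmu : 0 < mu := Fact.out
  have h1 : (1 : ℝ) ∈ Icc (0 : ℝ) 1 := by simp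
  -- The probability that the ancestor dies before t. Since f(x) ≥ x, each use of the renewal
  -- equation multiplies the bound on the probability of an infinite population by ρ < 1.
  set ρ := 1 - Real.exp (-(mu * t)) with hρ
  have hρ0 : 0 ≤ ρ := by
    have : Real.exp (-(mu * t)) ≤ 1 := Real.exp_le_one_iff.2 (by nlinarith)
    linarith
  have hρ1 : ρ < 1 := by linarith [Real.exp_pos (-(mu * t))]
  have key : ∀ n : ℕ, ∀ v ∈ Icc 0 t, 1 - ρ ^ n ≤ finPgf mu p 1 v := by
    intro n
    induction n with
    | zero => intro v _; simpa using (finPgf_mem_Icc mu p h1 v).1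
    | succ n ih =>
      intro v hv
      have hle : ∫ u in (0 : ℝ)..v, mu * Real.exp (-(mu * u)) * (1 - ρ ^ n) ≤
          ∫ u in (0 : ℝ)..v, mu * Real.exp (-(mu * u)) * pgf p (finPgf mu p 1 (v - u)) := by
        refine intervalIntegral.integral_mono_on hv.1 ?_ ?_ fun u hu => ?_
        · apply Continuous.intervalIntegrable; fun_prop
        · rw [intervalIntegrable_iff_integrableOn_Ioc_of_le hv.1]
          refine Integrable.mul_bdd (c := 1) ?_ ?_ (ae_of_all _ fun u => ?_)
          · rw [← IntegrableOn, ← intervalIntegrable_iff_integrableOn_Ioc_of_le hv.1]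
            apply Continuous.intervalIntegrable; fun_prop
          · exact ((measurable_pgf_finPgf mu p h1).comp
              (measurable_const.sub measurable_id)).aestronglyMeasurable
          · have := pgf_mem_Icc p (finPgf_mem_Icc mu p h1 (v - u))
            rw [Real.norm_of_nonneg this.1]
            exact this.2
        · refine mul_le_mul_of_nonneg_left ?_ (by positivity)
          exact (ih (v - u) ⟨by linarith [hu.2], by linarith [hu.1, hv.2]⟩).trans
            (hp _ (finPgf_mem_Icc mu p h1 _))
      rw [intervalIntegral.integral_mul_const, exp_mul_integral] at hle
      rw [finPgf_eq mu p h1 hv.1]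
      have hev : Real.exp (-(mu * t)) ≤ Real.exp (-(mu * v)) :=
        Real.exp_le_exp.2 (by nlinarith [hv.2])
      have h3 : (1 - Real.exp (-(mu * v))) * ρ ^ n ≤ ρ * ρ ^ n :=
        mul_le_mul_of_nonneg_right (by linarith) (by positivity)
      rw [pow_succ']
      linarith
  refine le_antisymm (finPgf_mem_Icc mu p h1 t).2 ?_
  have hlim : Tendsto (fun n : ℕ => 1 - ρ ^ n) atTop (𝓝 (1 - 0)) :=
    (tendsto_pow_atTop_nhds_zero_of_lt_one hρ0 hρ1).const_sub 1
  rw [sub_zero] at hlim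
  exact le_of_tendsto' hlim fun n => key n t ⟨ht, le_rfl⟩

/-- At s = 1 the function `cardPow` is the indicator of a finite population, whose mean is 1. This
is what identifies `finPgf` with `branchingPgf`. -/
lemma ae_aliveAt_finite (hp : ∀ s ∈ Icc (0 : ℝ) 1, s ≤ pgf p s) {t : ℝ} (ht : 0 ≤ t) :
    ∀ᵐ x ∂treeLaw mu p, (aliveAt x t).Finite := by
  have h1 : (1 : ℝ) ∈ Icc (0 : ℝ) 1 := by simp
  have h0 : ∫ x, (1 - cardPow 1 (aliveAt x t)) ∂treeLaw mu p = 0 := by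
    rw [integral_sub (integrable_const _) (integrable_cardPow mu p h1 t)]
    have := finPgf_one mu p hp ht
    rw [finPgf] at this
    simp [this]
  have h2 := (integral_eq_zero_iff_of_nonneg
    (fun x => sub_nonneg.2 (cardPow_mem_Icc h1 (aliveAt x t)).2)
    ((integrable_const _).sub (integrable_cardPow mu p h1 t))).1 h0
  filter_upwards [h2] with x hx
  by_contra hinf
  simp [cardPow, hinf] at hx

lemma branchingPgf_eq_finPgf (hp : ∀ s ∈ Icc (0 : ℝ) 1, s ≤ pgf p s) {t : ℝ} (ht : 0 ≤ t)
    (s : ℝ) : branchingPgf mu p t s = finPgf mu p s t := by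
  refine integral_congr_ae ?_
  filter_upwards [ae_aliveAt_finite mu p hp ht] with x hx
  simp [cardPow, hx, population]

/-- The generating function of the branching process solves the backward Kolmogorov equation. -/
lemma exists_hasDerivAt_branchingPgf (hp : ∀ s ∈ Icc (0 : ℝ) 1, s ≤ pgf p s) {s : ℝ}
    (hs : s ∈ Icc (0 : ℝ) 1) : ∃ G : ℝ → ℝ, G 0 = s ∧
      (∀ t, 0 ≤ t → branchingPgf mu p t s = G t) ∧
      ∀ t, 0 ≤ t → HasDerivAt G (mu * (pgf p (G t) - G t)) t := by
  have hmu : 0 < mu := Fact.out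
  set F := finPgf mu p s with hF
  set k : ℝ → ℝ := fun v => mu * Real.exp (mu * v) * pgf p (F v) with hk
  have hki : ∀ a b, IntervalIntegrable k volume a b := by
    intro a b
    have h1 : IntervalIntegrable (fun v => mu * Real.exp (mu * v)) volume a b := by
      apply Continuous.intervalIntegrable; fun_prop
    have : ∀ a b : ℝ, IntegrableOn (fun v => mu * Real.exp (mu * v)) (Ioc a b) volume →
        IntegrableOn k (Ioc a b) volume := by
      intro a b h
      refine Integrable.mul_bdd (c := 1) h (measurable_pgf_finPgf mu p hs).aestronglyMeasurable
        (ae_of_all _ fun u => ?_)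
      have := pgf_mem_Icc p (finPgf_mem_Icc mu p hs u)
      rw [Real.norm_of_nonneg this.1]
      exact this.2
    exact ⟨this _ _ h1.1, this _ _ h1.2⟩
  -- The substitution v = t - u moves the dependence on t into an exponential prefactor, so that F
  -- becomes continuous, and then differentiable, by bootstrapping.
  have hFk : ∀ t, 0 ≤ t → F t = Real.exp (-(mu * t)) * (s + ∫ v in (0 : ℝ)..t, k v) := by
    intro t ht
    rw [hF, finPgf_eq mu p hs ht, mul_add, mul_comm s]
    congr 1
    rw [← intervalIntegral.integral_const_mul]
    have := intervalIntegral.integral_comp_sub_left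
      (fun u => Real.exp (-(mu * t)) * k u) (a := 0) (b := t) t
    rw [sub_zero, sub_self] at this
    rw [← this]
    refine intervalIntegral.integral_congr fun u _ => ?_
    simp only [hk]
    rw [← mul_assoc, mul_left_comm, ← Real.exp_add]
    congr 3
    ring
  have hFc : ContinuousOn F (Ici 0) := by
    have hc : Continuous fun t => Real.exp (-(mu * t)) * (s + ∫ v in (0 : ℝ)..t, k v) := by
      have := intervalIntegral.continuous_primitive hki 0
      fun_prop
    exact hc.continuousOn.congr fun t ht => hFk t ht
  -- Freezing F to the left of 0 makes the integrand continuous on the whole line, so the derivative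
  -- of G is two-sided even at t = 0.
  set k' : ℝ → ℝ := fun v => mu * Real.exp (mu * v) * pgf p (F (max v 0)) with hk'
  have hk'c : Continuous k' := by
    have h1 : Continuous fun v => F (max v 0) :=
      hFc.comp_continuous (by fun_prop) fun v => mem_Ici.2 (le_max_right _ _)
    have h2 : Continuous fun v => pgf p (F (max v 0)) :=
      (continuousOn_pgf p).comp_continuous h1 fun v => finPgf_mem_Icc mu p hs _
    fun_prop
  set G : ℝ → ℝ := fun t => Real.exp (-(mu * t)) * (s + ∫ v in (0 : ℝ)..t, k' v) with hG
  have hGF : ∀ t, 0 ≤ t → F t = G t := by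
    intro t ht
    rw [hFk t ht, hG]
    congr 2
    refine intervalIntegral.integral_congr fun u hu => ?_
    rw [uIcc_of_le ht] at hu
    simp only [hk, hk', max_eq_left hu.1]
  refine ⟨G, by simp [hG], fun t ht => (branchingPgf_eq_finPgf mu p hp ht s).trans (hGF t ht),
    fun t ht => ?_⟩
  have h1 : HasDerivAt (fun t => ∫ v in (0 : ℝ)..t, k' v) (k' t) t :=
    intervalIntegral.integral_hasDerivAt_right (hk'c.intervalIntegrable _ _)
      (hk'c.stronglyMeasurableAtFilter _ _) hk'c.continuousAt
  have h2 : HasDerivAt (fun t => Real.exp (-(mu * t))) (-(mu * Real.exp (-(mu * t)))) t :=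
    hasDerivAt_exp_neg_mul mu t
  have h3 := h2.mul (h1.const_add s)
  refine h3.congr_deriv ?_
  simp only [hk', max_eq_left ht, hGF t ht]
  have e : Real.exp (-(mu * t)) * (mu * Real.exp (mu * t) * pgf p (G t)) = mu * pgf p (G t) := by
    rw [mul_assoc, mul_left_comm, ← mul_assoc (Real.exp _), ← Real.exp_add]
    simp
  rw [e]
  simp only [hG]
  ring

lemma branchingPgf_mem_Icc (t : ℝ) {s : ℝ} (hs : s ∈ Icc (0 : ℝ) 1) :
    branchingPgf mu p t s ∈ Icc (0 : ℝ) 1 := by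
  have hb : ∀ n : ℕ, s ^ n ∈ Icc (0 : ℝ) 1 := fun n => ⟨pow_nonneg hs.1 _, pow_le_one₀ hs.1 hs.2⟩
  refine ⟨integral_nonneg fun x => (hb _).1, ?_⟩
  calc branchingPgf mu p t s ≤ ∫ _, (1 : ℝ) ∂treeLaw mu p :=
        integral_mono_of_nonneg (ae_of_all _ fun x => (hb _).1) (integrable_const _)
          (ae_of_all _ fun x => (hb _).2)
    _ = 1 := by simp

/-- With probability exp(-μt) > 0 the ancestor is still alive and contributes s < 1. -/
lemma branchingPgf_lt_one (hp : ∀ s ∈ Icc (0 : ℝ) 1, s ≤ pgf p s) {t s : ℝ} (ht : 0 ≤ t)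
    (hs : s ∈ Ico (0 : ℝ) 1) : branchingPgf mu p t s < 1 := by
  have hs' : s ∈ Icc (0 : ℝ) 1 := ⟨hs.1, hs.2.le⟩
  rw [branchingPgf_eq_finPgf mu p hp ht, finPgf_eq mu p hs' ht]
  have hmu : 0 < mu := Fact.out
  have h : ∫ u in (0 : ℝ)..t, mu * Real.exp (-(mu * u)) * pgf p (finPgf mu p s (t - u)) ≤
      ∫ u in (0 : ℝ)..t, mu * Real.exp (-(mu * u)) := by
    have hb := fun u => pgf_mem_Icc p (finPgf_mem_Icc mu p hs' (t - u))
    rw [intervalIntegral.integral_of_le ht, intervalIntegral.integral_of_le ht]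
    refine integral_mono_of_nonneg (ae_of_all _ fun u => mul_nonneg (by positivity) (hb u).1) ?_
      (ae_of_all _ fun u => mul_le_of_le_one_right (by positivity) (hb u).2)
    rw [← IntegrableOn, ← intervalIntegrable_iff_integrableOn_Ioc_of_le ht]
    apply Continuous.intervalIntegrable; fun_prop
  rw [exp_mul_integral] at h
  nlinarith [hs.2, Real.exp_pos (-(mu * t))]

end ode

/-! ### The functions V and W, and the solution of the backward equation -/

section inverse

variable {p : PMF ℕ}

lemma le_pgf_of_lt (hp : ∀ s ∈ Ico (0 : ℝ) 1, s < pgf p s) {s : ℝ} (hs : s ∈ Icc (0 : ℝ) 1) :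
    s ≤ pgf p s := by
  rcases hs.2.lt_or_eq with h | rfl
  · exact (hp s ⟨hs.1, h⟩).le
  · exact (pgf_one p).ge

/-- The derivative of `V`, extended by a constant to the left of `1`. -/
noncomputable def kern (p : PMF ℕ) (y : ℝ) : ℝ :=
  1 / ((max y 1) ^ 2 * (pgf p (1 - 1 / max y 1) - (1 - 1 / max y 1)))

lemma one_sub_inv_mem {y : ℝ} (hy : 1 ≤ y) : 1 - 1 / y ∈ Ico (0 : ℝ) 1 := by
  have h0 : 0 < y := by linarith
  have h1 : 1 / y ≤ 1 := by rw [div_le_one h0]; exact hy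
  have h2 : 0 < 1 / y := by positivity
  constructor <;> linarith

lemma kern_of_le {y : ℝ} (hy : 1 ≤ y) :
    kern p y = 1 / (y ^ 2 * (pgf p (1 - 1 / y) - (1 - 1 / y))) := by
  simp [kern, max_eq_left hy]

lemma kern_pos (hp : ∀ s ∈ Ico (0 : ℝ) 1, s < pgf p s) (y : ℝ) : 0 < kern p y := by
  have h1 : 1 ≤ max y 1 := le_max_right _ _
  have := hp _ (one_sub_inv_mem h1)
  have : 0 < max y 1 := by linarith
  unfold kern
  apply one_div_pos.2
  apply mul_pos (by positivity)
  linarith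

lemma continuous_kern (hp : ∀ s ∈ Ico (0 : ℝ) 1, s < pgf p s) : Continuous (kern p) := by
  have h0 : ∀ y : ℝ, (max y 1) ≠ 0 := fun y => by
    have : 1 ≤ max y 1 := le_max_right _ _
    linarith
  have h1 : Continuous fun y : ℝ => 1 - 1 / max y 1 := by
    refine continuous_const.sub (continuous_const.div (by fun_prop) h0)
  have h2 : Continuous fun y : ℝ => pgf p (1 - 1 / max y 1) :=
    (continuousOn_pgf p).comp_continuous h1 fun y =>
      Ico_subset_Icc_self (one_sub_inv_mem (le_max_right _ _))
  refine continuous_const.div (by fun_prop) fun y => ?_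
  have := hp _ (one_sub_inv_mem (le_max_right y 1))
  exact mul_ne_zero (pow_ne_zero _ (h0 y)) (by linarith)

/-- Substitution u = 1 - 1/y; in this form V is an integral with a positive continuous integrand,
ready for Karamata's theorem. -/
lemma V_eq (hp : ∀ s ∈ Ico (0 : ℝ) 1, s < pgf p s) {x : ℝ} (hx : 1 ≤ x) :
    V p x = ∫ y in (1 : ℝ)..x, kern p y := by
  have hI : ∀ y ∈ uIcc 1 x, 1 ≤ y := fun y hy => by rw [uIcc_of_le hx] at hy; exact hy.1
  have := intervalIntegral.integral_comp_mul_deriv' (a := 1) (b := x) (f := fun y => 1 - 1 / y)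
    (f' := fun y => 1 / y ^ 2) (g := fun u => 1 / (pgf p u - u)) ?_ ?_ ?_
  · simp only [div_one, sub_self] at this
    rw [V, ← this]
    refine intervalIntegral.integral_congr fun y hy => ?_
    simp only [Function.comp, kern_of_le (hI y hy)]
    rw [one_div_mul_one_div, mul_comm]
  · intro y hy
    have hy0 : y ≠ 0 := by linarith [hI y hy]
    have := ((hasDerivAt_inv hy0).const_sub 1)
    simpa [one_div] using this
  · refine ContinuousOn.div continuousOn_const (by fun_prop) fun y hy => ?_
    have := hI y hy
    positivity
  · have hsub : (fun y : ℝ => 1 - 1 / y) '' uIcc 1 x ⊆ Ico 0 1 := by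
      rintro _ ⟨y, hy, rfl⟩
      exact one_sub_inv_mem (hI y hy)
    refine ContinuousOn.mono ?_ hsub
    refine continuousOn_const.div
      (((continuousOn_pgf p).mono Ico_subset_Icc_self).sub continuousOn_id) fun s hs => ?_
    have := hp s hs
    exact sub_ne_zero.2 this.ne'

lemma hasDerivAt_integral_kern (hp : ∀ s ∈ Ico (0 : ℝ) 1, s < pgf p s) (x : ℝ) :
    HasDerivAt (fun x => ∫ y in (1 : ℝ)..x, kern p y) (kern p x) x :=
  intervalIntegral.integral_hasDerivAt_right ((continuous_kern hp).intervalIntegrable _ _)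
    ((continuous_kern hp).stronglyMeasurableAtFilter _ _) (continuous_kern hp).continuousAt

lemma strictMono_integral_kern (hp : ∀ s ∈ Ico (0 : ℝ) 1, s < pgf p s) :
    StrictMono fun x => ∫ y in (1 : ℝ)..x, kern p y :=
  strictMono_of_deriv_pos fun x => by
    rw [(hasDerivAt_integral_kern hp x).deriv]
    exact kern_pos hp x

lemma V_one : V p 1 = 0 := by simp [V]

lemma strictMonoOn_V (hp : ∀ s ∈ Ico (0 : ℝ) 1, s < pgf p s) : StrictMonoOn (V p) (Ici 1) :=
  fun x hx y hy hxy => by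
    rw [V_eq hp hx, V_eq hp hy]
    exact strictMono_integral_kern hp hxy

lemma continuousOn_V (hp : ∀ s ∈ Ico (0 : ℝ) 1, s < pgf p s) : ContinuousOn (V p) (Ici 1) := by
  have h : Continuous fun x => ∫ y in (1 : ℝ)..x, kern p y :=
    continuous_iff_continuousAt.2 fun x => (hasDerivAt_integral_kern hp x).continuousAt
  exact h.continuousOn.congr fun x hx => V_eq hp hx

/-- Convexity and f(1) = 1 give f(u) - u ≤ f(0) (1 - u), so the integrand is at least 1/(f(0) y) and
V grows at least like a logarithm. -/
lemma tendsto_V (hp : ∀ s ∈ Ico (0 : ℝ) 1, s < pgf p s) : Tendsto (V p) atTop atTop := by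
  have hf0 : 0 < pgf p 0 := hp 0 (by simp)
  have hlim : Tendsto (fun x => (1 / pgf p 0) * Real.log x) atTop atTop :=
    Real.tendsto_log_atTop.const_mul_atTop (by positivity)
  refine tendsto_atTop_mono' _ ?_ hlim
  filter_upwards [eventually_ge_atTop 1] with x hx
  rw [V_eq hp hx, ← div_one x, ← integral_one_div_of_pos one_pos (by linarith), div_one,
    ← intervalIntegral.integral_const_mul]
  refine intervalIntegral.integral_mono_on hx ?_ ((continuous_kern hp).intervalIntegrable _ _) ?_
  · apply ContinuousOn.intervalIntegrable
    rw [uIcc_of_le hx]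
    refine continuousOn_const.mul (continuousOn_const.div continuousOn_id fun y hy => ?_)
    have := hy.1
    exact ne_of_gt (by linarith)
  · intro y hy
    have hy0 : 0 < y := by linarith [hy.1]
    rw [kern_of_le hy.1, one_div_mul_one_div]
    have h1 := hp _ (one_sub_inv_mem hy.1)
    have h2 := (convexOn_pgf p).2 (x := 1) (y := 0) (by simp) (by simp)
      (one_sub_inv_mem hy.1).1 (by positivity : 0 ≤ 1 / y) (by ring)
    simp only [smul_eq_mul, mul_one, mul_zero, add_zero, pgf_one] at h2
    apply one_div_le_one_div_of_le
    · apply mul_pos (by positivity); linarith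
    · calc y ^ 2 * (pgf p (1 - 1 / y) - (1 - 1 / y)) ≤ y ^ 2 * (1 / y * pgf p 0) := by
            apply mul_le_mul_of_nonneg_left _ (by positivity); linarith
        _ = pgf p 0 * y := by field_simp

lemma bijOn_V (hp : ∀ s ∈ Ico (0 : ℝ) 1, s < pgf p s) : BijOn (V p) (Ici 1) (Ici 0) := by
  refine ⟨fun x hx => ?_, (strictMonoOn_V hp).injOn, fun y hy => ?_⟩
  · have := (strictMonoOn_V hp).monotoneOn (mem_Ici.2 le_rfl) hx hx
    rwa [V_one] at this
  · obtain ⟨x, hx, hx1⟩ := (((tendsto_V hp).eventually_ge_atTop y).and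
      (eventually_ge_atTop 1)).exists
    have := intermediate_value_Icc hx1 ((continuousOn_V hp).mono Icc_subset_Ici_self)
    rw [V_one] at this
    obtain ⟨z, hz, rfl⟩ := this ⟨hy, hx⟩
    exact ⟨z, hz.1, rfl⟩

lemma one_le_W (hp : ∀ s ∈ Ico (0 : ℝ) 1, s < pgf p s) {y : ℝ} (hy : 0 ≤ y) : 1 ≤ W p y :=
  Function.invFunOn_mem ((bijOn_V hp).surjOn hy)

lemma V_W (hp : ∀ s ∈ Ico (0 : ℝ) 1, s < pgf p s) {y : ℝ} (hy : 0 ≤ y) : V p (W p y) = y :=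
  Function.invFunOn_eq ((bijOn_V hp).surjOn hy)

lemma W_V (hp : ∀ s ∈ Ico (0 : ℝ) 1, s < pgf p s) {x : ℝ} (hx : 1 ≤ x) : W p (V p x) = x :=
  (bijOn_V hp).injOn.leftInvOn_invFunOn hx

lemma V_nonneg (hp : ∀ s ∈ Ico (0 : ℝ) 1, s < pgf p s) {x : ℝ} (hx : 1 ≤ x) : 0 ≤ V p x :=
  (bijOn_V hp).mapsTo hx

lemma W_lt_iff (hp : ∀ s ∈ Ico (0 : ℝ) 1, s < pgf p s) {x y : ℝ} (hx : 1 ≤ x) (hy : 0 ≤ y) :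
    W p y < x ↔ y < V p x := by
  rw [← (strictMonoOn_V hp).lt_iff_lt (one_le_W hp hy) hx, V_W hp hy]

lemma strictMonoOn_W (hp : ∀ s ∈ Ico (0 : ℝ) 1, s < pgf p s) :
    StrictMonoOn (W p) (Ici 0) := fun x hx y hy hxy => by
  rwa [W_lt_iff hp (one_le_W hp hy) hx, V_W hp hy]

lemma tendsto_W (hp : ∀ s ∈ Ico (0 : ℝ) 1, s < pgf p s) : Tendsto (W p) atTop atTop := by
  refine tendsto_atTop.2 fun b => ?_
  filter_upwards [eventually_ge_atTop (V p (max b 1)), eventually_ge_atTop 0] with y hy hy0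
  have := (not_congr (W_lt_iff hp (le_max_right b 1) hy0)).2 (not_lt.2 hy)
  exact (le_max_left b 1).trans (not_lt.1 this)

variable (mu : ℝ) [Fact (0 < mu)]

/-- Separation of variables: the derivative of V(1/(1-F)) along the backward equation is F'/(f(F) -
F) = μ, so its difference with μt is constant. -/
lemma V_branchingPgf (hp : ∀ s ∈ Ico (0 : ℝ) 1, s < pgf p s) {s t : ℝ} (hs : s ∈ Ico (0 : ℝ) 1)
    (ht : 0 ≤ t) :
    V p (1 / (1 - branchingPgf mu p t s)) = mu * t + V p (1 / (1 - s)) := by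
  have hp' := fun s hs => le_pgf_of_lt hp (s := s) hs
  have hs' : s ∈ Icc (0 : ℝ) 1 := ⟨hs.1, hs.2.le⟩
  obtain ⟨G, hG0, hGF, hG⟩ := exists_hasDerivAt_branchingPgf mu p hp' hs'
  have hG1 : ∀ t, 0 ≤ t → G t ∈ Ico (0 : ℝ) 1 := fun t ht => by
    rw [← hGF t ht]
    exact ⟨(branchingPgf_mem_Icc mu p t hs').1, branchingPgf_lt_one mu p hp' ht hs⟩
  have hx1 : ∀ t, 0 ≤ t → 1 ≤ 1 / (1 - G t) := fun t ht => by
    have := hG1 t ht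
    rw [le_div_iff₀ (by linarith [this.2])]
    linarith [this.1]
  have hd : ∀ t, 0 ≤ t → HasDerivAt
      (fun t => (∫ y in (1 : ℝ)..(1 / (1 - G t)), kern p y) - mu * t) 0 t := by
    intro t ht
    have hne : 1 - G t ≠ 0 := by linarith [(hG1 t ht).2]
    have h1 := ((hG t ht).const_sub 1).fun_inv hne
    have h2 : HasDerivAt (fun t => 1 / (1 - G t)) (mu * (pgf p (G t) - G t) / (1 - G t) ^ 2) t := by
      refine HasDerivAt.congr_deriv (f := fun t => 1 / (1 - G t)) ?_ ?_
        (f' := -(-(mu * (pgf p (G t) - G t))) / (1 - G t) ^ 2)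
      · simpa only [one_div] using h1
      · ring
    have h3 := ((hasDerivAt_integral_kern hp (1 / (1 - G t))).comp t h2).sub
      ((hasDerivAt_id t).const_mul mu)
    refine h3.congr_deriv ?_
    rw [kern_of_le (hx1 t ht)]
    have e : 1 - 1 / (1 / (1 - G t)) = G t := by rw [one_div_one_div]; ring
    rw [e]
    have := hp _ (hG1 t ht)
    have h4 : pgf p (G t) - G t ≠ 0 := by linarith
    field_simp
    ring
  have hc := constant_of_has_deriv_right_zero (a := 0) (b := t)
    (fun u hu => (hd u hu.1).continuousAt.continuousWithinAt)
    (fun u hu => (hd u hu.1).hasDerivWithinAt) t ⟨ht, le_rfl⟩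
  rw [hGF t ht, V_eq hp (hx1 t ht), V_eq hp (by simpa [hG0] using hx1 0 le_rfl)]
  simp only [hG0, mul_zero, sub_zero] at hc
  linarith

lemma branchingPgf_eq (hp : ∀ s ∈ Ico (0 : ℝ) 1, s < pgf p s) {s t : ℝ} (hs : s ∈ Ico (0 : ℝ) 1)
    (ht : 0 ≤ t) :
    branchingPgf mu p t s = 1 - 1 / W p (mu * t + V p (1 / (1 - s))) := by
  have hp' := fun s hs => le_pgf_of_lt hp (s := s) hs
  have hs' : s ∈ Icc (0 : ℝ) 1 := ⟨hs.1, hs.2.le⟩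
  have h1 := branchingPgf_lt_one mu p hp' ht hs
  have h0 := (branchingPgf_mem_Icc mu p t hs').1
  rw [← V_branchingPgf mu hp hs ht, W_V hp, one_div_one_div]
  · ring
  · rw [le_div_iff₀ (by linarith)]; linarith

lemma one_le_one_div_one_sub {s : ℝ} (hs : s ∈ Ico (0 : ℝ) 1) : 1 ≤ 1 / (1 - s) := by
  rw [le_div_iff₀ (by linarith [hs.2])]; linarith [hs.1]

lemma continuousOn_branchingPgf (hp : ∀ s ∈ Icc (0 : ℝ) 1, s ≤ pgf p s) {s : ℝ}
    (hs : s ∈ Icc (0 : ℝ) 1) : ContinuousOn (fun t => branchingPgf mu p t s) (Ici 0) := by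
  obtain ⟨G, -, hGF, hG⟩ := exists_hasDerivAt_branchingPgf mu p hp hs
  exact ContinuousOn.congr (fun t ht => (hG t ht).continuousAt.continuousWithinAt)
    fun t ht => hGF t ht

lemma branchingPgf_one (t : ℝ) : branchingPgf mu p t 1 = 1 := by
  simp [branchingPgf]

lemma monotoneOn_branchingPgf (hp : ∀ s ∈ Ico (0 : ℝ) 1, s < pgf p s) {s : ℝ}
    (hs : s ∈ Icc (0 : ℝ) 1) : MonotoneOn (fun t => branchingPgf mu p t s) (Ici 0) := by
  intro t ht u hu htu
  rcases hs.2.lt_or_eq with h | rfl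
  · have hs' : s ∈ Ico (0 : ℝ) 1 := ⟨hs.1, h⟩
    have hmu : 0 < mu := Fact.out
    have hV := V_nonneg hp (one_le_one_div_one_sub hs')
    simp only [branchingPgf_eq mu hp hs' ht, branchingPgf_eq mu hp hs' hu]
    have h1 : 0 ≤ mu * t + V p (1 / (1 - s)) := add_nonneg (mul_nonneg hmu.le ht) hV
    have h2 : mu * t + V p (1 / (1 - s)) ≤ mu * u + V p (1 / (1 - s)) := by gcongr
    have h3 := (strictMonoOn_W hp).monotoneOn (mem_Ici.2 h1) (mem_Ici.2 (h1.trans h2)) h2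
    have h4 := one_div_le_one_div_of_le (by linarith [one_le_W hp h1]) h3
    linarith
  · simp [branchingPgf_one]

end inverse

/-! ### Functionals of a Poisson process -/

lemma integral_pow_poissonMeasure (Λ : ℝ≥0) (c : ℝ) :
    ∫ n, c ^ n ∂poissonMeasure Λ = Real.exp (-((1 - c) * Λ)) := by
  rw [integral_poissonMeasure]
  have h : HasSum (fun n : ℕ => (c * Λ) ^ n / (n.factorial : ℝ)) (Real.exp (c * Λ)) := by
    rw [Real.exp_eq_exp_ℝ]; exact NormedSpace.expSeries_div_hasSum_exp _
  have h2 := (h.mul_left (Real.exp (-Λ))).tsum_eq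
  rw [← Real.exp_add] at h2
  rw [show -((1 - c) * (Λ : ℝ)) = -Λ + c * Λ by ring, ← h2]
  refine tsum_congr fun n => ?_
  rw [smul_eq_mul, mul_pow]
  ring

section poisson

variable {Ω : Type*} [MeasurableSpace Ω] {P : Measure Ω} [IsProbabilityMeasure P]
  {r : ℝ → ℝ} {S : ℕ → Ω → ℝ≥0∞}

lemma measurable_countUpTo' (t : ℝ) :
    Measurable fun σ : ℕ → ℝ≥0∞ => {k | σ k ≤ ENNReal.ofReal t}.ncard :=
  measurable_ncard (A := fun k => {σ : ℕ → ℝ≥0∞ | σ k ≤ ENNReal.ofReal t}) fun k =>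
    measurableSet_le (measurable_pi_apply k) measurable_const

lemma measurable_countUpTo (hS : ∀ k, Measurable (S k)) (t : ℝ) : Measurable (countUpTo S t) :=
  (measurable_countUpTo' t).comp (measurable_pi_lambda (fun ω k => S k ω) hS)

/-- The deterministic properties of a locally finite increasing sequence of points. -/
structure IsJumpSequence (σ : ℕ → ℝ≥0∞) : Prop where
  pos : 0 < σ 0
  mono : Monotone σ
  finite : ∀ t : ℝ, {k | σ k ≤ ENNReal.ofReal t}.Finite

omit [IsProbabilityMeasure P] in
lemma IsPoissonJumpPoints.ae_isJumpSequence (hS : IsPoissonJumpPoints P r S) :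
    ∀ᵐ ω ∂P, IsJumpSequence fun k => S k ω := by
  filter_upwards [hS.pos, hS.increasing, hS.locallyFinite] with ω h1 h2 h3
  exact ⟨h1, monotone_nat_of_le_succ fun k => (h2 k).1, h3⟩

/-- By monotonicity and local finiteness the indices of the points up to t form a finite initial
segment of ℕ, so comparing an index with the count is the same as comparing the point with t. -/
lemma IsJumpSequence.le_iff {σ : ℕ → ℝ≥0∞} (h : IsJumpSequence σ) (t : ℝ) (k : ℕ) :
    k < {k | σ k ≤ ENNReal.ofReal t}.ncard ↔ σ k ≤ ENNReal.ofReal t := by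
  set A := {k | σ k ≤ ENNReal.ofReal t} with hA
  have hlow : ∀ m ∈ A, ∀ j ≤ m, j ∈ A := fun m hm j hj => (h.mono hj).trans hm
  constructor
  · intro hk
    by_contra hnot
    have : A ⊆ Iio k := fun m hm => by
      by_contra hmk
      exact hnot (hlow m hm k (not_lt.1 hmk))
    have := ncard_le_ncard this (finite_Iio k)
    rw [show (Iio k).ncard = k by rw [← Nat.card_coe_set_eq]; simp] at this
    omega
  · intro hk
    have : Iic k ⊆ A := fun m hm => hlow k hk m hm
    have := ncard_le_ncard this (h.finite t)
    rw [show (Iic k).ncard = k + 1 by rw [← Nat.card_coe_set_eq]; simp] at this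
    omega

lemma prod_range_mono_partition {f : ℕ → ℝ} {c : ℕ → ℕ} (h0 : c 0 = 0) (hc : Monotone c) (n : ℕ) :
    ∏ k ∈ Finset.range (c n), f k =
      ∏ i ∈ Finset.range n, ∏ k ∈ Finset.Ico (c i) (c (i + 1)), f k := by
  induction n with
  | zero => simp [h0]
  | succ n ih =>
    rw [Finset.prod_range_succ, ← ih, Finset.prod_range_mul_prod_Ico _ (hc n.le_succ)]

/-- Bounds for the product of a monotone function over the points of a jump sequence. -/
lemma IsJumpSequence.prod_mem_Icc {σ : ℕ → ℝ≥0∞} (h : IsJumpSequence σ) {φ : ℝ → ℝ} {t : ℝ}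
    (hφm : MonotoneOn φ (Ici 0)) (hφ : ∀ u, φ u ∈ Icc (0 : ℝ) 1) {a : ℕ → ℝ} (ha : Monotone a)
    (ha0 : a 0 = 0) {n : ℕ} (han : a n = t) :
    ∏ k ∈ Finset.range {k | σ k ≤ ENNReal.ofReal t}.ncard, φ (t - (σ k).toReal) ∈
      Icc (∏ i ∈ Finset.range n, φ (t - a (i + 1)) ^
          ({k | σ k ≤ ENNReal.ofReal (a (i + 1))}.ncard - {k | σ k ≤ ENNReal.ofReal (a i)}.ncard))
        (∏ i ∈ Finset.range n, φ (t - a i) ^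
          ({k | σ k ≤ ENNReal.ofReal (a (i + 1))}.ncard -
            {k | σ k ≤ ENNReal.ofReal (a i)}.ncard)) := by
  set c : ℕ → ℕ := fun i => {k | σ k ≤ ENNReal.ofReal (a i)}.ncard with hc
  have hcm : Monotone c := fun i j hij => ncard_le_ncard
    (fun k hk => le_trans hk (ENNReal.ofReal_le_ofReal (ha hij))) (h.finite _)
  -- No point lies at time 0, because the first one is positive.
  have hc0 : c 0 = 0 := by
    by_contra hne
    have := (h.le_iff (a 0) 0).1 (Nat.pos_of_ne_zero hne)
    rw [ha0, ENNReal.ofReal_zero] at this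
    exact absurd h.pos (not_lt.2 this)
  have ha_nonneg : ∀ i, 0 ≤ a i := fun i => ha0 ▸ ha (Nat.zero_le i)
  have hcn : {k | σ k ≤ ENNReal.ofReal t}.ncard = c n := by rw [hc, ← han]
  -- Indices between consecutive counts are those of the points in (a i, a (i + 1)], where
  -- monotonicity bounds φ by its values at the end points.
  have hk : ∀ i ∈ Finset.range n, ∀ k ∈ Finset.Ico (c i) (c (i + 1)),
      φ (t - (σ k).toReal) ∈ Icc (φ (t - a (i + 1))) (φ (t - a i)) := by
    intro i hi k hk
    rw [Finset.mem_Ico] at hk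
    have h1 : σ k ≤ ENNReal.ofReal (a (i + 1)) := (h.le_iff _ k).1 hk.2
    have h2 : ¬ σ k ≤ ENNReal.ofReal (a i) := fun h' => not_lt.2 hk.1 ((h.le_iff _ k).2 h')
    have htop : σ k ≠ ∞ := ne_top_of_le_ne_top ENNReal.ofReal_ne_top h1
    have h1' : (σ k).toReal ≤ a (i + 1) := ENNReal.toReal_le_of_le_ofReal (ha_nonneg _) h1
    have h2' : a i ≤ (σ k).toReal :=
      (ENNReal.ofReal_le_iff_le_toReal htop).1 (not_le.1 h2).le
    have h3 : a (i + 1) ≤ t := han ▸ ha (Finset.mem_range.1 hi)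
    exact ⟨hφm (by simp [h3]) (mem_Ici.2 (by linarith)) (by linarith),
      hφm (mem_Ici.2 (by linarith)) (mem_Ici.2 (by linarith [ha i.le_succ])) (by linarith)⟩
  rw [hcn, prod_range_mono_partition hc0 hcm]
  refine ⟨Finset.prod_le_prod (fun i _ => pow_nonneg (hφ _).1 _) fun i hi => ?_,
    Finset.prod_le_prod (fun i _ => Finset.prod_nonneg fun k _ => (hφ _).1) fun i hi => ?_⟩
  · rw [← Nat.card_Ico, ← Finset.prod_const]
    exact Finset.prod_le_prod (fun k _ => (hφ _).1) fun k hk' => (hk i hi k hk').1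
  · rw [← Nat.card_Ico, ← Finset.prod_const]
    exact Finset.prod_le_prod (fun k _ => (hφ _).1) fun k hk' => (hk i hi k hk').2

omit [IsProbabilityMeasure P] in
lemma integral_prod_pow_increments (hS : IsPoissonJumpPoints P r S)
    (hr0 : ∀ x y, 0 ≤ x → x ≤ y → 0 ≤ ∫ u in x..y, r u) {a : ℕ → ℝ} (ha : Monotone a)
    (ha0 : 0 ≤ a 0) (c : ℕ → ℝ) (n : ℕ) :
    ∫ ω, ∏ i ∈ Finset.range n, c i ^ (countUpTo S (a (i + 1)) ω - countUpTo S (a i) ω) ∂P =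
      Real.exp (-∑ i ∈ Finset.range n, (1 - c i) * ∫ u in a i..a (i + 1), r u) := by
  have ha_nonneg : ∀ i, 0 ≤ a i := fun i => ha0.trans (ha (Nat.zero_le i))
  have hind := (hS.indepIncrements.nat (t := fun i => (a i).toNNReal)
    fun i j hij => Real.toNNReal_le_toNNReal (ha hij)).precomp
    (g := fun i : Fin n => (i : ℕ)) Fin.val_injective
  simp only [Real.coe_toNNReal _ (ha_nonneg _)] at hind
  have hm : ∀ i : ℕ, Measurable fun ω =>
      countUpTo S (a (i + 1)) ω - countUpTo S (a i) ω := fun i =>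
    (measurable_of_countable (fun q : ℕ × ℕ => q.1 - q.2)).comp
      ((measurable_countUpTo hS.measurable _).prodMk (measurable_countUpTo hS.measurable _))
  have h1 := hind.integral_fun_prod_comp (f := fun (i : Fin n) (m : ℕ) => c i ^ m)
    (fun i => (hm i).aemeasurable) fun i => (measurable_of_countable _).aestronglyMeasurable
  have h2 : ∀ i, ∫ ω, c i ^ (countUpTo S (a (i + 1)) ω - countUpTo S (a i) ω) ∂P =
      Real.exp (-((1 - c i) * ∫ u in a i..a (i + 1), r u)) := by
    intro i
    have := integral_pow_poissonMeasure (∫ u in a i..a (i + 1), r u).toNNReal (c i)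
    rw [← hS.poisson _ _ (ha_nonneg i) (ha i.le_succ), integral_map (hm i).aemeasurable
      (measurable_of_countable _).aestronglyMeasurable,
      Real.coe_toNNReal _ (hr0 _ _ (ha_nonneg i) (ha i.le_succ))] at this
    exact this
  calc _ = ∫ ω, ∏ i : Fin n, c i ^ (countUpTo S (a (i + 1)) ω - countUpTo S (a i) ω) ∂P := by
        refine integral_congr_ae (ae_of_all _ fun ω => ?_)
        exact (Fin.prod_univ_eq_prod_range
          (fun i => c i ^ (countUpTo S (a (i + 1)) ω - countUpTo S (a i) ω)) n).symm
    _ = _ := by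
        rw [h1, ← Finset.sum_neg_distrib, Real.exp_sum, ← Fin.prod_univ_eq_prod_range]
        exact Finset.prod_congr rfl fun i _ => h2 i

/-- For a step function this is independence of the increments and the generating function of the
Poisson law. A monotone φ is bracketed by step functions on a fine partition, and uniform continuity
on [0, t] makes the lower and upper sums Lo and Up differ by at most ε R; both sides lie between
exp(-Up) and exp(-Lo). -/
lemma integral_prod_jumps (hS : IsPoissonJumpPoints P r S) (hr : ∀ t : ℝ, 0 < t → 0 ≤ r t)
    (hri : ∀ t : ℝ, 0 ≤ t → IntervalIntegrable r volume 0 t) {φ : ℝ → ℝ} (hφmeas : Measurable φ)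
    (hφm : MonotoneOn φ (Ici 0)) (hφc : ContinuousOn φ (Ici 0)) (hφ : ∀ u, φ u ∈ Icc (0 : ℝ) 1)
    {t : ℝ} (ht : 0 ≤ t) :
    ∫ ω, ∏ k ∈ Finset.range (countUpTo S t ω), φ (t - (S k ω).toReal) ∂P =
      Real.exp (-∫ v in (0 : ℝ)..t, r v * (1 - φ (t - v))) := by
  have hri' : ∀ x y, 0 ≤ x → 0 ≤ y → IntervalIntegrable r volume x y := fun x y hx hy =>
    (hri x hx).symm.trans (hri y hy)
  have hr0 : ∀ x y, 0 ≤ x → x ≤ y → 0 ≤ ∫ u in x..y, r u := by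
    intro x y hx hxy
    rw [intervalIntegral.integral_of_le hxy]
    exact setIntegral_nonneg measurableSet_Ioc fun u hu => hr u (hx.trans_lt hu.1)
  have hJint : ∀ x y, 0 ≤ x → x ≤ y →
      IntervalIntegrable (fun v => r v * (1 - φ (t - v))) volume x y := by
    intro x y hx hxy
    rw [intervalIntegrable_iff_integrableOn_Ioc_of_le hxy]
    refine Integrable.mul_bdd (c := 1)
      ((intervalIntegrable_iff_integrableOn_Ioc_of_le hxy).1 (hri' x y hx (hx.trans hxy))) ?_
      (ae_of_all _ fun v => ?_)
    · exact (measurable_const.sub (hφmeas.comp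
        (measurable_const.sub measurable_id))).aestronglyMeasurable
    · have := hφ (t - v)
      rw [Real.norm_of_nonneg (by linarith [this.2])]
      linarith [this.1]
  set J := ∫ v in (0 : ℝ)..t, r v * (1 - φ (t - v)) with hJ
  set E := ∫ ω, ∏ k ∈ Finset.range (countUpTo S t ω), φ (t - (S k ω).toReal) ∂P with hE
  set R := ∫ v in (0 : ℝ)..t, r v with hR
  have hR0 : 0 ≤ R := hr0 0 t le_rfl ht
  have hprodmeas : Measurable fun ω =>
      ∏ k ∈ Finset.range (countUpTo S t ω), φ (t - (S k ω).toReal) :=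
    measurable_natParam (g := fun n ω => ∏ k ∈ Finset.range n, φ (t - (S k ω).toReal))
      (measurable_countUpTo hS.measurable t) fun n => Finset.measurable_prod _ fun k _ =>
        hφmeas.comp (measurable_const.sub (hS.measurable k).ennreal_toReal)
  have key : ∀ ε > 0, |E - Real.exp (-J)| ≤ ε * R := by
    intro ε hε
    have huc : UniformContinuousOn φ (Icc 0 t) :=
      isCompact_Icc.uniformContinuousOn_of_continuous (hφc.mono Icc_subset_Ici_self)
    obtain ⟨δ, hδ, hδ'⟩ := Metric.uniformContinuousOn_iff.1 huc ε hε
    -- The mesh t/n is smaller than the modulus of continuity δ.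
    obtain ⟨n, hn⟩ := exists_nat_gt (t / δ)
    have hn0 : (0 : ℝ) < n := lt_of_le_of_lt (by positivity) hn
    set a : ℕ → ℝ := fun i => t * i / n with ha
    have ham : Monotone a := fun i j hij => by
      simp only [ha]; gcongr
    have ha0 : a 0 = 0 := by simp [ha]
    have han : a n = t := by simp only [ha]; field_simp
    have ha_nonneg : ∀ i, 0 ≤ a i := fun i => ha0 ▸ ham (Nat.zero_le i)
    have hstep : ∀ i, a (i + 1) - a i < δ := fun i => by
      have : a (i + 1) - a i = t / n := by simp only [ha]; push_cast; ring
      rw [this, div_lt_iff₀ hn0]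
      rw [div_lt_iff₀ hδ] at hn
      linarith
    have hal : ∀ i ∈ Finset.range n, a (i + 1) ≤ t := fun i hi =>
      han ▸ ham (Finset.mem_range.1 hi)
    set ρ : ℕ → ℝ := fun i => ∫ u in a i..a (i + 1), r u with hρ
    have hρ0 : ∀ i, 0 ≤ ρ i := fun i => hr0 _ _ (ha_nonneg i) (ham i.le_succ)
    have hρsum : ∑ i ∈ Finset.range n, ρ i = R := by
      have := intervalIntegral.sum_integral_adjacent_intervals (f := r) (μ := volume) (a := a)
        (n := n) fun k _ => hri' _ _ (ha_nonneg _) (ha_nonneg _)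
      rw [ha0, han] at this
      exact this
    have hJsum : ∑ i ∈ Finset.range n, ∫ v in a i..a (i + 1), r v * (1 - φ (t - v)) = J := by
      have := intervalIntegral.sum_integral_adjacent_intervals (μ := volume) (a := a)
        (f := fun v => r v * (1 - φ (t - v))) (n := n) fun k _ =>
          hJint _ _ (ha_nonneg _) (ham k.le_succ)
      rw [ha0, han] at this
      exact this
    set Lo := ∑ i ∈ Finset.range n, (1 - φ (t - a i)) * ρ i with hLo
    set Up := ∑ i ∈ Finset.range n, (1 - φ (t - a (i + 1))) * ρ i with hUp
    have hJb : J ∈ Icc Lo Up := by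
      have hb : ∀ i ∈ Finset.range n, ∀ v ∈ Ioc (a i) (a (i + 1)),
          1 - φ (t - v) ∈ Icc (1 - φ (t - a i)) (1 - φ (t - a (i + 1))) := by
        intro i hi v hv
        have h3 := hal i hi
        have h4 := hφm (a := t - a (i + 1)) (b := t - v) (by simp [h3])
          (mem_Ici.2 (by linarith [hv.2])) (by linarith [hv.2])
        have h5 := hφm (a := t - v) (b := t - a i) (mem_Ici.2 (by linarith [hv.2]))
          (mem_Ici.2 (by linarith [hv.2, hv.1])) (by linarith [hv.1])
        constructor <;> linarith
      rw [← hJsum, hLo, hUp]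
      refine ⟨Finset.sum_le_sum fun i hi => ?_, Finset.sum_le_sum fun i hi => ?_⟩
      all_goals
        simp only [hρ]
        rw [mul_comm, ← intervalIntegral.integral_mul_const,
          intervalIntegral.integral_of_le (ham i.le_succ),
          intervalIntegral.integral_of_le (ham i.le_succ)]
        have hi1 := (intervalIntegrable_iff_integrableOn_Ioc_of_le (ham i.le_succ)).1
          (hri' _ _ (ha_nonneg i) (ha_nonneg (i + 1)))
        have hi2 := (intervalIntegrable_iff_integrableOn_Ioc_of_le (ham i.le_succ)).1
          (hJint _ _ (ha_nonneg i) (ham i.le_succ))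
      · exact setIntegral_mono_on (hi1.mul_const _) hi2 measurableSet_Ioc fun v hv =>
          mul_le_mul_of_nonneg_left (hb i hi v hv).1 (hr v ((ha_nonneg i).trans_lt hv.1))
      · exact setIntegral_mono_on hi2 (hi1.mul_const _) measurableSet_Ioc fun v hv =>
          mul_le_mul_of_nonneg_left (hb i hi v hv).2 (hr v ((ha_nonneg i).trans_lt hv.1))
    have hIb : ∀ c : ℕ → ℝ, (∀ i, c i ∈ Icc (0 : ℝ) 1) → Integrable (fun ω =>
        ∏ i ∈ Finset.range n, c i ^ (countUpTo S (a (i + 1)) ω - countUpTo S (a i) ω)) P := by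
      intro c hc
      refine Integrable.of_bound (C := 1) ?_ (ae_of_all _ fun ω => ?_)
      · refine (Finset.measurable_prod _ fun i _ => ?_).aestronglyMeasurable
        exact (measurable_of_countable (fun q : ℕ × ℕ => c i ^ (q.1 - q.2))).comp
          ((measurable_countUpTo hS.measurable _).prodMk (measurable_countUpTo hS.measurable _))
      · rw [Real.norm_of_nonneg (Finset.prod_nonneg fun i _ => pow_nonneg (hc i).1 _)]
        exact Finset.prod_le_one (fun i _ => pow_nonneg (hc i).1 _)
          fun i _ => pow_le_one₀ (hc i).1 (hc i).2
    have hIE : Integrable (fun ω =>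
        ∏ k ∈ Finset.range (countUpTo S t ω), φ (t - (S k ω).toReal)) P := by
      refine Integrable.of_bound (C := 1) hprodmeas.aestronglyMeasurable (ae_of_all _ fun ω => ?_)
      rw [Real.norm_of_nonneg (Finset.prod_nonneg fun i _ => (hφ _).1)]
      exact Finset.prod_le_one (fun i _ => (hφ _).1) fun i _ => (hφ _).2
    have hEb : E ∈ Icc (Real.exp (-Up)) (Real.exp (-Lo)) := by
      rw [hUp, hLo, ← integral_prod_pow_increments hS hr0 ham ha0.ge,
        ← integral_prod_pow_increments hS hr0 ham ha0.ge]
      refine ⟨integral_mono_ae (hIb _ fun i => hφ _) hIE ?_,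
        integral_mono_ae hIE (hIb _ fun i => hφ _) ?_⟩
      · filter_upwards [hS.ae_isJumpSequence] with ω hω
        exact (hω.prod_mem_Icc hφm hφ ham ha0 han).1
      · filter_upwards [hS.ae_isJumpSequence] with ω hω
        exact (hω.prod_mem_Icc hφm hφ ham ha0 han).2
    have hUL : Up - Lo ≤ ε * R := by
      rw [hUp, hLo, ← Finset.sum_sub_distrib, ← hρsum, Finset.mul_sum]
      refine Finset.sum_le_sum fun i hi => ?_
      rw [← sub_mul]
      refine mul_le_mul_of_nonneg_right ?_ (hρ0 i)
      have h3 := hal i hi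
      have h4 := ham i.le_succ
      have := hδ' (t - a i) ⟨by linarith, by linarith [ha_nonneg i]⟩ (t - a (i + 1))
        ⟨by linarith, by linarith [ha_nonneg (i + 1)]⟩ (by
          rw [Real.dist_eq, abs_lt]; constructor <;> linarith [hstep i])
      rw [Real.dist_eq, abs_lt] at this
      linarith [this.2]
    have hLo0 : 0 ≤ Lo := Finset.sum_nonneg fun i _ =>
      mul_nonneg (by linarith [(hφ (t - a i)).2]) (hρ0 i)
    -- The exponential is 1-Lipschitz on the negative half-line.
    have hexp : Real.exp (-Lo) - Real.exp (-Up) ≤ Up - Lo := by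
      have h1 : Real.exp (-Up) = Real.exp (-Lo) * Real.exp (-(Up - Lo)) := by
        rw [← Real.exp_add]; ring_nf
      have h2 := Real.add_one_le_exp (-(Up - Lo))
      have h3 : Real.exp (-Lo) ≤ 1 := Real.exp_le_one_iff.2 (by linarith)
      have h4 := Real.exp_pos (-Lo)
      have h5 : 0 ≤ Up - Lo := by linarith [hJb.1, hJb.2]
      rw [h1]
      nlinarith
    have h6 := Real.exp_le_exp.2 (neg_le_neg hJb.1)
    have h7 := Real.exp_le_exp.2 (neg_le_neg hJb.2)
    rw [abs_le]
    constructor <;> linarith [hEb.1, hEb.2]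
  have h0 : |E - Real.exp (-J)| ≤ 0 := by
    have hlim : Tendsto (fun ε : ℝ => ε * R) (𝓝[>] 0) (𝓝 (0 * R)) :=
      tendsto_nhdsWithin_of_tendsto_nhds ((continuous_id.mul continuous_const).tendsto 0)
    rw [zero_mul] at hlim
    exact ge_of_tendsto hlim (eventually_nhdsWithin_of_forall fun ε hε => key ε hε)
  linarith [abs_nonpos_iff.1 h0]

end poisson

/-! ### The generating function of the process with immigration -/

section immigration

variable {Ω : Type*} [MeasurableSpace Ω] {P : Measure Ω} [IsProbabilityMeasure P]

/-- Freezing: under independence one variable may be held fixed while the other is averaged, by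
Fubini for the product law. -/
lemma integral_eq_integral_integral_of_indepFun {α β : Type*} [MeasurableSpace α]
    [MeasurableSpace β] {U : Ω → α} {V : Ω → β} (hU : Measurable U) (hV : Measurable V)
    (h : IndepFun U V P) {Ψ : α × β → ℝ} (hΨ : Measurable Ψ) (hb : ∀ a, Ψ a ∈ Icc (0 : ℝ) 1) :
    ∫ ω, Ψ (U ω, V ω) ∂P = ∫ ω, ∫ ω', Ψ (U ω, V ω') ∂P ∂P := by
  have := Measure.isProbabilityMeasure_map (μ := P) hU.aemeasurable
  have := Measure.isProbabilityMeasure_map (μ := P) hV.aemeasurable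
  rw [← integral_map (φ := fun ω => (U ω, V ω)) (hU.prodMk hV).aemeasurable
    hΨ.aestronglyMeasurable,
    (indepFun_iff_map_prod_eq_prod_map_map hU.aemeasurable hV.aemeasurable).1 h, integral_prod,
    integral_map (f := fun x => ∫ y, Ψ (x, y) ∂Measure.map V P) hU.aemeasurable]
  · refine integral_congr_ae (ae_of_all _ fun ω => ?_)
    exact integral_map (f := fun y => Ψ (U ω, y)) hV.aemeasurable
      (hΨ.comp measurable_prodMk_left).aestronglyMeasurable
  · exact (hΨ.stronglyMeasurable.integral_prod_right' (ν := Measure.map V P)).aestronglyMeasurable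
  · exact Integrable.of_bound (C := 1) hΨ.aestronglyMeasurable (ae_of_all _ fun a => by
      rw [Real.norm_of_nonneg (hb a).1]; exact (hb a).2)

variable {r : ℝ → ℝ} {mu : ℝ} [Fact (0 < mu)] {p im : PMF ℕ} {S : ℕ → Ω → ℝ≥0∞}
  {I : ℕ → Ω → ℕ} {X : ℕ → ℕ → Ω → Tree}

lemma measurable_branchingPgf (s : ℝ) : Measurable fun t => branchingPgf mu p t s := by
  have h : Measurable fun a : ℝ × Tree => s ^ population a.2 a.1 :=
    (measurable_of_countable (fun n : ℕ => s ^ n)).comp (measurable_population.comp measurable_swap)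
  exact (h.stronglyMeasurable.integral_prod_right (ν := treeLaw mu p)).measurable

omit [IsProbabilityMeasure P] in
lemma IsImmigrationModel.integral_prod_tree (h : IsImmigrationModel P r mu p im S I X) (s : ℝ)
    (n : ℕ) (i : ℕ → ℕ) (u : ℕ → ℝ) :
    ∫ ω, ∏ k ∈ Finset.range n, ∏ j ∈ Finset.range (i k), s ^ population (X k j ω) (u k) ∂P =
      ∏ k ∈ Finset.range n, branchingPgf mu p (u k) s ^ i k := by
  have hm : ∀ t, Measurable fun x : Tree => s ^ population x t := fun t =>
    (measurable_of_countable (fun n : ℕ => s ^ n)).comp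
      (measurable_population.comp (measurable_id.prodMk measurable_const))
  set T : Finset (Σ _ : ℕ, ℕ) := (Finset.range n).sigma fun k => Finset.range (i k) with hT
  have hinj : Function.Injective fun q : T => (q.1.1, q.1.2) := by
    rintro ⟨⟨a, b⟩, _⟩ ⟨⟨c, d⟩, _⟩ hq
    simp only [Prod.mk.injEq] at hq
    simp [hq.1, hq.2]
  have h1 := (h.indep_tree.precomp hinj).integral_fun_prod_comp
    (f := fun (q : T) x => s ^ population x (u q.1.1))
    (fun q => (h.measurable_tree _ _).aemeasurable) fun q => (hm _).aestronglyMeasurable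
  have h2 : ∀ k j t, ∫ ω, s ^ population (X k j ω) t ∂P = branchingPgf mu p t s := by
    intro k j t
    rw [branchingPgf, ← h.law_tree k j, integral_map (h.measurable_tree k j).aemeasurable
      (hm t).aestronglyMeasurable]
  simp only [h2] at h1
  rw [Finset.prod_coe_sort T fun q => branchingPgf mu p (u q.1) s, hT, Finset.prod_sigma] at h1
  simp only [Finset.prod_const, Finset.card_range] at h1
  rw [← h1]
  refine integral_congr_ae (ae_of_all _ fun ω => ?_)
  simp only
  rw [Finset.prod_coe_sort T fun q => s ^ population (X q.1 q.2 ω) (u q.1), hT, Finset.prod_sigma]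

lemma prod_pow_mem_Icc {s : ℝ} (hs : s ∈ Icc (0 : ℝ) 1) (n : ℕ) (i : ℕ → ℕ) (m : ℕ → ℕ → ℕ) :
    ∏ k ∈ Finset.range n, ∏ j ∈ Finset.range (i k), s ^ m k j ∈ Icc (0 : ℝ) 1 :=
  ⟨Finset.prod_nonneg fun _ _ => Finset.prod_nonneg fun _ _ => pow_nonneg hs.1 _,
    Finset.prod_le_one (fun _ _ => Finset.prod_nonneg fun _ _ => pow_nonneg hs.1 _) fun _ _ =>
      Finset.prod_le_one (fun _ _ => pow_nonneg hs.1 _) fun _ _ => pow_le_one₀ hs.1 hs.2⟩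

lemma IsImmigrationModel.integral_prod_group (h : IsImmigrationModel P r mu p im S I X) {s : ℝ}
    (hs : s ∈ Icc (0 : ℝ) 1) (n : ℕ) (u : ℕ → ℝ) :
    ∫ ω, ∏ k ∈ Finset.range n, ∏ j ∈ Finset.range (I k ω), s ^ population (X k j ω) (u k) ∂P =
      ∏ k ∈ Finset.range n, pgf im (branchingPgf mu p (u k) s) := by
  have hm : ∀ t, Measurable fun x : Tree => s ^ population x t := fun t =>
    (measurable_of_countable (fun n : ℕ => s ^ n)).comp
      (measurable_population.comp (measurable_id.prodMk measurable_const))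
  set Ψ : (ℕ → ℕ) × (ℕ × ℕ → Tree) → ℝ := fun a => ∏ k ∈ Finset.range n,
    ∏ j ∈ Finset.range (a.1 k), s ^ population (a.2 (k, j)) (u k) with hΨ
  have hΨm : Measurable Ψ := by
    refine Finset.measurable_prod _ fun k _ => ?_
    refine measurable_natParam (c := fun a : (ℕ → ℕ) × (ℕ × ℕ → Tree) => a.1 k)
      (g := fun m a => ∏ j ∈ Finset.range m, s ^ population (a.2 (k, j)) (u k))
      (by fun_prop) fun m => Finset.measurable_prod _ fun j _ => ?_
    exact (hm (u k)).comp (f := fun a : (ℕ → ℕ) × (ℕ × ℕ → Tree) => a.2 (k, j)) (by fun_prop)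
  have h1 := integral_eq_integral_integral_of_indepFun (P := P)
    (measurable_pi_lambda (fun ω k => I k ω) h.measurable_size)
    (measurable_pi_lambda (fun ω (kj : ℕ × ℕ) => X kj.1 kj.2 ω)
      fun kj => h.measurable_tree kj.1 kj.2) h.indep_size_tree hΨm
    fun a => prod_pow_mem_Icc hs _ _ _
  simp only [hΨ] at h1
  rw [h1]
  simp only [h.integral_prod_tree s n _ u]
  have h2 := (h.indep_size.precomp (g := fun k : Fin n => (k : ℕ))
    Fin.val_injective).integral_fun_prod_comp
    (f := fun (k : Fin n) (m : ℕ) => branchingPgf mu p (u k) s ^ m)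
    (fun k => (h.measurable_size k).aemeasurable)
    fun k => (measurable_of_countable _).aestronglyMeasurable
  have h3 : ∀ k, ∫ ω, branchingPgf mu p (u k) s ^ I k ω ∂P =
      pgf im (branchingPgf mu p (u k) s) := by
    intro k
    rw [← integral_pow_pmf im (branchingPgf_mem_Icc mu p _ hs), ← h.law_size k,
      integral_map (h.measurable_size k).aemeasurable
        (measurable_of_countable _).aestronglyMeasurable]
  simp only [h3] at h2
  rw [Fin.prod_univ_eq_prod_range (fun k => pgf im (branchingPgf mu p (u k) s))] at h2
  rw [← h2]
  refine integral_congr_ae (ae_of_all _ fun ω => ?_)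
  exact (Fin.prod_univ_eq_prod_range
    (fun k => branchingPgf mu p (u k) s ^ I k ω) n).symm

omit [MeasurableSpace Ω] in
lemma pow_Y (s t : ℝ) (ω : Ω) : s ^ Y S I X t ω = ∏ k ∈ Finset.range (countUpTo S t ω),
    ∏ j ∈ Finset.range (I k ω), s ^ population (X k j ω) (t - (S k ω).toReal) := by
  simp only [Y, Finset.prod_pow_eq_pow_sum]

omit [IsProbabilityMeasure P] in
lemma IsImmigrationModel.measurable_Y (h : IsImmigrationModel P r mu p im S I X) (t : ℝ) :
    Measurable (Y S I X t) := by
  refine measurable_natParam (g := fun n ω => ∑ k ∈ Finset.range n, ∑ j ∈ Finset.range (I k ω),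
    population (X k j ω) (t - (S k ω).toReal)) (measurable_countUpTo h.jumpPoints.measurable t)
    fun n => Finset.measurable_sum _ fun k _ => ?_
  refine measurable_natParam (g := fun n ω => ∑ j ∈ Finset.range n,
    population (X k j ω) (t - (S k ω).toReal)) (h.measurable_size k)
    fun n => Finset.measurable_sum _ fun j _ => ?_
  exact measurable_population.comp ((h.measurable_tree k j).prodMk
    (measurable_const.sub (h.jumpPoints.measurable k).ennreal_toReal))

/-- The jump times are frozen first. For fixed times the groups are averaged in
`integral_prod_group`, where the group sizes are frozen in turn and the trees integrated out. -/
lemma IsImmigrationModel.integral_pow_Y_eq_prod (h : IsImmigrationModel P r mu p im S I X) {s : ℝ}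
    (hs : s ∈ Icc (0 : ℝ) 1) (t : ℝ) :
    ∫ ω, s ^ Y S I X t ω ∂P = ∫ ω, ∏ k ∈ Finset.range (countUpTo S t ω),
      pgf im (branchingPgf mu p (t - (S k ω).toReal) s) ∂P := by
  set Ψ : (ℕ → ℝ≥0∞) × ((ℕ → ℕ) × (ℕ × ℕ → Tree)) → ℝ := fun a =>
    ∏ k ∈ Finset.range {k | a.1 k ≤ ENNReal.ofReal t}.ncard,
      ∏ j ∈ Finset.range (a.2.1 k), s ^ population (a.2.2 (k, j)) (t - (a.1 k).toReal) with hΨ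
  have hΨm : Measurable Ψ := by
    refine measurable_natParam
      (c := fun a : (ℕ → ℝ≥0∞) × ((ℕ → ℕ) × (ℕ × ℕ → Tree)) =>
        {k | a.1 k ≤ ENNReal.ofReal t}.ncard)
      (g := fun n a => ∏ k ∈ Finset.range n,
        ∏ j ∈ Finset.range (a.2.1 k), s ^ population (a.2.2 (k, j)) (t - (a.1 k).toReal))
      ((measurable_countUpTo' t).comp measurable_fst)
      fun n => Finset.measurable_prod _ fun k _ => ?_
    refine measurable_natParam
      (c := fun a : (ℕ → ℝ≥0∞) × ((ℕ → ℕ) × (ℕ × ℕ → Tree)) => a.2.1 k)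
      (g := fun m a => ∏ j ∈ Finset.range m, s ^ population (a.2.2 (k, j)) (t - (a.1 k).toReal))
      (by fun_prop) fun m => Finset.measurable_prod _ fun j _ => ?_
    exact (measurable_of_countable (fun n : ℕ => s ^ n)).comp (measurable_population.comp
      (f := fun a : (ℕ → ℝ≥0∞) × ((ℕ → ℕ) × (ℕ × ℕ → Tree)) =>
        (a.2.2 (k, j), t - (a.1 k).toReal)) (by fun_prop))
  have h1 := integral_eq_integral_integral_of_indepFun (P := P)
    (measurable_pi_lambda (fun ω k => S k ω) h.jumpPoints.measurable)
    ((measurable_pi_lambda (fun ω k => I k ω) h.measurable_size).prodMk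
      (measurable_pi_lambda (fun ω (kj : ℕ × ℕ) => X kj.1 kj.2 ω)
        fun kj => h.measurable_tree kj.1 kj.2)) h.indep_jumpPoints hΨm
    fun a => prod_pow_mem_Icc hs _ _ _
  simp only [hΨ] at h1
  simp only [pow_Y]
  refine h1.trans (integral_congr_ae (ae_of_all _ fun ω => ?_))
  exact h.integral_prod_group hs _ fun k => t - (S k ω).toReal

lemma one_sub_q_mem {s : ℝ} (hs : s ∈ Icc (0 : ℝ) 1) (u : ℝ) :
    1 - q mu p im u s ∈ Icc (0 : ℝ) 1 := by
  simpa [q] using pgf_mem_Icc im (branchingPgf_mem_Icc mu p u hs)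

lemma measurable_q {s : ℝ} (hs : s ∈ Icc (0 : ℝ) 1) : Measurable fun u => q mu p im u s := by
  have h2 : Measurable (projIcc (0 : ℝ) 1 zero_le_one) := continuous_projIcc.measurable
  have h3 : Measurable fun z : Icc (0 : ℝ) 1 => pgf im z :=
    (continuousOn_iff_continuous_domRestrict.1 (continuousOn_pgf im)).measurable
  refine measurable_const.sub ?_
  convert h3.comp (h2.comp (measurable_branchingPgf (mu := mu) (p := p) s)) using 2 with u
  simp [projIcc_of_mem zero_le_one (branchingPgf_mem_Icc mu p u hs)]

/-- The Laplace functional applies to φ(u) = g(F(u;s)) = 1 - q(u;s), which is monotone because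
F(·;s) is. -/
lemma IsImmigrationModel.integral_pow_Y (h : IsImmigrationModel P r mu p im S I X)
    (hr : ∀ t : ℝ, 0 < t → 0 ≤ r t) (hri : ∀ t : ℝ, 0 ≤ t → IntervalIntegrable r volume 0 t)
    (hp : ∀ s ∈ Ico (0 : ℝ) 1, s < pgf p s) {s : ℝ} (hs : s ∈ Icc (0 : ℝ) 1) {t : ℝ}
    (ht : 0 ≤ t) :
    ∫ ω, s ^ Y S I X t ω ∂P = Real.exp (-∫ v in (0 : ℝ)..t, r v * q mu p im (t - v) s) := by
  have hp' := fun s hs => le_pgf_of_lt hp (s := s) hs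
  rw [h.integral_pow_Y_eq_prod hs]
  refine integral_prod_jumps h.jumpPoints hr hri (φ := fun u => pgf im (branchingPgf mu p u s))
    ?_ ?_ ?_ (fun u => pgf_mem_Icc im (branchingPgf_mem_Icc mu p u hs)) ht
  · simpa [q] using (measurable_q (mu := mu) (p := p) (im := im) hs).const_sub 1
  · intro u hu v hv huv
    exact pgf_mono im (branchingPgf_mem_Icc mu p u hs) (branchingPgf_mem_Icc mu p v hs)
      (monotoneOn_branchingPgf mu hp hs hu hv huv)
  · exact (continuousOn_pgf im).comp (continuousOn_branchingPgf mu hp' hs)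
      fun u _ => branchingPgf_mem_Icc mu p u hs

end immigration

/-! ### Regular variation -/

/-- `b` is eventually positive and regularly varying at infinity with index `-ρ`, with locally
uniform convergence. -/
structure RegVar (b : ℝ → ℝ) (ρ : ℝ) : Prop where
  pos : ∀ᶠ x in atTop, 0 < b x
  lim : ∀ k : ℝ, 0 < k →
    Tendsto (fun z : ℝ × ℝ => b (z.1 * z.2) / b z.2) (𝓝 k ×ˢ atTop) (𝓝 (k ^ (-ρ)))

namespace RegVar

variable {b : ℝ → ℝ} {ρ : ℝ}

/-- The working form of regular variation: arguments need only be asymptotically proportional. Local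
uniformity in the definition is there for this. -/
lemma tendsto_ratio (h : RegVar b ρ) {ι : Type*} {f : Filter ι} {x y : ι → ℝ} {k : ℝ} (hk : 0 < k)
    (hy : Tendsto y f atTop) (hxy : Tendsto (fun i => x i / y i) f (𝓝 k)) :
    Tendsto (fun i => b (x i) / b (y i)) f (𝓝 (k ^ (-ρ))) := by
  refine ((h.lim k hk).comp (hxy.prodMk hy)).congr' ?_
  filter_upwards [hy.eventually_gt_atTop 0] with i hi
  simp only [Function.comp]
  rw [div_mul_cancel₀ _ hi.ne']

lemma tendsto_mul (h : RegVar b ρ) {c : ℝ} (hc : 0 < c) :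
    Tendsto (fun x => b (c * x) / b x) atTop (𝓝 (c ^ (-ρ))) := by
  refine h.tendsto_ratio hc tendsto_id ?_
  refine tendsto_const_nhds.congr' ?_
  filter_upwards [eventually_gt_atTop 0] with x hx
  exact (mul_div_cancel_right₀ c hx.ne').symm

/-- It suffices to have uniformity near `1`. -/
lemma of_one (hpos : ∀ᶠ x in atTop, 0 < b x)
    (h1 : Tendsto (fun z : ℝ × ℝ => b (z.1 * z.2) / b z.2) (𝓝 1 ×ˢ atTop) (𝓝 1))
    (hc : ∀ c : ℝ, 0 < c → Tendsto (fun x => b (c * x) / b x) atTop (𝓝 (c ^ (-ρ)))) :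
    RegVar b ρ := by
  refine ⟨hpos, fun k hk => ?_⟩
  have e1 : Tendsto (fun z : ℝ × ℝ => (z.1 / k, k * z.2)) (𝓝 k ×ˢ atTop) (𝓝 1 ×ˢ atTop) := by
    refine Tendsto.prodMk ?_ (tendsto_snd.const_mul_atTop hk)
    have : Tendsto (fun x : ℝ => x / k) (𝓝 k) (𝓝 (k / k)) := tendsto_id.div_const k
    rw [div_self hk.ne'] at this
    exact this.comp tendsto_fst
  have h2 := (h1.comp e1).mul ((hc k hk).comp tendsto_snd)
  rw [one_mul] at h2
  refine h2.congr' ?_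
  have h3 : ∀ᶠ z : ℝ × ℝ in 𝓝 k ×ˢ atTop, 0 < b (k * z.2) :=
    ((tendsto_id.const_mul_atTop hk).eventually hpos).prod_inr _
  filter_upwards [h3] with z hz
  have e : z.1 / k * (k * z.2) = z.1 * z.2 := by field_simp
  simp only [Function.comp, e]
  rw [div_mul_div_cancel₀ hz.ne']

/-- For z near 1 monotonicity squeezes b(zx)/b(x) between the ratios at two fixed factors c > 1 > a,
whose limits are both close to 1. -/
lemma of_antitone {x₀ : ℝ} (hanti : AntitoneOn b (Ici x₀)) (hpos : ∀ᶠ x in atTop, 0 < b x)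
    (hc : ∀ c : ℝ, 0 < c → Tendsto (fun x => b (c * x) / b x) atTop (𝓝 (c ^ (-ρ)))) :
    RegVar b ρ := by
  refine of_one hpos ?_ hc
  have hcont : ContinuousAt (fun x : ℝ => x ^ (-ρ)) 1 :=
    Real.continuousAt_rpow_const _ _ (Or.inl one_ne_zero)
  rw [tendsto_order]
  have hab : ∀ s ∈ 𝓝 (1 : ℝ), ∃ a c : ℝ, 0 < a ∧ a < 1 ∧ 1 < c ∧ a ∈ s ∧ c ∈ s := by
    intro s hs
    obtain ⟨l, u, ⟨hl, hu⟩, hsub⟩ := mem_nhds_iff_exists_Ioo_subset.1 hs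
    refine ⟨max ((l + 1) / 2) (1 / 2), (u + 1) / 2, ?_, ?_, ?_, hsub ⟨?_, ?_⟩, hsub ⟨?_, ?_⟩⟩
    · exact lt_of_lt_of_le (by norm_num) (le_max_right _ _)
    · exact max_lt (by linarith) (by norm_num)
    · linarith
    · exact lt_of_lt_of_le (by linarith) (le_max_left _ _)
    · exact max_lt (by linarith) (by linarith)
    · linarith
    · linarith
  have hev : ∀ a c : ℝ, 0 < a → a < 1 → 1 < c → ∀ᶠ z : ℝ × ℝ in 𝓝 1 ×ˢ atTop,
      b (c * z.2) ≤ b (z.1 * z.2) ∧ b (z.1 * z.2) ≤ b (a * z.2) ∧ 0 < b z.2 := by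
    intro a c ha0 ha hc1
    have e1 : ∀ᶠ z : ℝ × ℝ in 𝓝 1 ×ˢ atTop, z.1 ∈ Ioo a c :=
      (Ioo_mem_nhds ha hc1 : Ioo a c ∈ 𝓝 (1 : ℝ)) |> fun h => Eventually.prod_inl h _
    have e2 : ∀ᶠ z : ℝ × ℝ in 𝓝 (1 : ℝ) ×ˢ atTop, x₀ ≤ a * z.2 ∧ 0 < z.2 ∧ 0 < b z.2 :=
      (((tendsto_id.const_mul_atTop ha0).eventually_ge_atTop x₀).and
        ((eventually_gt_atTop 0).and hpos)).prod_inr _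
    filter_upwards [e1, e2] with z hz1 hz2
    have h1 : a * z.2 ≤ z.1 * z.2 := mul_le_mul_of_nonneg_right hz1.1.le hz2.2.1.le
    have h2 : z.1 * z.2 ≤ c * z.2 := mul_le_mul_of_nonneg_right hz1.2.le hz2.2.1.le
    exact ⟨hanti (mem_Ici.2 (hz2.1.trans h1)) (mem_Ici.2 (hz2.1.trans (h1.trans h2))) h2,
      hanti (mem_Ici.2 hz2.1) (mem_Ici.2 (hz2.1.trans h1)) h1, hz2.2.2⟩
  have hone : (1 : ℝ) ^ (-ρ) = 1 := Real.one_rpow _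
  constructor
  · intro y hy
    have hs := hcont.eventually (lt_mem_nhds (by simpa [hone] using hy) : ∀ᶠ x in 𝓝 _, y < x)
    obtain ⟨a, c, ha0, ha, hc1, -, hcs⟩ := hab _ hs
    have := ((hc c (by linarith)).eventually (lt_mem_nhds hcs)).prod_inr (𝓝 (1 : ℝ))
    filter_upwards [this, hev a c ha0 ha hc1] with z hz1 hz2
    exact hz1.trans_le (div_le_div_of_nonneg_right hz2.1 hz2.2.2.le)
  · intro y hy
    have hs := hcont.eventually (gt_mem_nhds (by simpa [hone] using hy) : ∀ᶠ x in 𝓝 _, x < y)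
    obtain ⟨a, c, ha0, ha, hc1, has, -⟩ := hab _ hs
    have := ((hc a ha0).eventually (gt_mem_nhds has)).prod_inr (𝓝 (1 : ℝ))
    filter_upwards [this, hev a c ha0 ha hc1] with z hz1 hz2
    exact (div_le_div_of_nonneg_right hz2.2.1 hz2.2.2.le).trans_lt hz1

/-- Values at comparable arguments are comparable. -/
lemma exists_bound (h : RegVar b ρ) : ∃ C : ℝ, 0 < C ∧ ∀ᶠ t in atTop, ∀ u ∈ Icc (t / 2) t,
    0 < b u ∧ b u ≤ C * b t ∧ b t ≤ C * b u := by
  -- For k in [1/2, 1] the power k^(-ρ) lies between 2^(-|ρ|) and 2^|ρ|; the added 1 makes the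
  -- inequalities strict.
  set C : ℝ := 2 ^ |ρ| + 1 with hC
  have hC1 : 1 ≤ (2 : ℝ) ^ |ρ| := Real.one_le_rpow (by norm_num) (abs_nonneg _)
  have hC0 : 0 < C := by linarith
  refine ⟨C, hC0, ?_⟩
  have hloc : ∀ k ∈ Icc (1 / 2 : ℝ) 1, ∀ᶠ z : ℝ × ℝ in 𝓝 k ×ˢ atTop,
      b (z.1 * z.2) / b z.2 ∈ Ioo C⁻¹ C := by
    intro k hk
    refine (h.lim k (by linarith [hk.1])).eventually (Ioo_mem_nhds ?_ ?_)
    · have h1 : (2 : ℝ) ^ (-|ρ|) ≤ k ^ (-ρ) := by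
        rcases le_total 0 ρ with h0 | h0
        · rw [abs_of_nonneg h0]
          exact (Real.rpow_le_one_of_one_le_of_nonpos (by norm_num) (by linarith)).trans
            (Real.one_le_rpow_of_pos_of_le_one_of_nonpos (by linarith [hk.1]) hk.2 (by linarith))
        · rw [abs_of_nonpos h0, neg_neg, show (2 : ℝ) ^ ρ = (1 / 2) ^ (-ρ) by
            rw [one_div, Real.inv_rpow (by norm_num), Real.rpow_neg (by norm_num), inv_inv]]
          exact Real.rpow_le_rpow (by norm_num) hk.1 (by linarith)
      refine lt_of_lt_of_le ?_ h1
      rw [Real.rpow_neg (by norm_num)]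
      exact inv_strictAnti₀ (by linarith) (by linarith)
    · have h1 : k ^ (-ρ) ≤ (2 : ℝ) ^ |ρ| := by
        rcases le_total 0 ρ with h0 | h0
        · rw [abs_of_nonneg h0, show (2 : ℝ) ^ ρ = (1 / 2) ^ (-ρ) by
            rw [one_div, Real.inv_rpow (by norm_num), Real.rpow_neg (by norm_num), inv_inv]]
          exact Real.rpow_le_rpow_of_nonpos (by norm_num) hk.1 (by linarith)
        · exact (Real.rpow_le_one (by linarith [hk.1]) hk.2 (by linarith)).trans hC1
      linarith
  -- Compactness of [1/2, 1] turns the local bounds into one valid for all k at once.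
  have hK : ∀ᶠ z : ℝ × ℝ in 𝓝ˢ (Icc (1 / 2 : ℝ) 1) ×ˢ atTop,
      b (z.1 * z.2) / b z.2 ∈ Ioo C⁻¹ C := by
    rw [isCompact_Icc.nhdsSet_prod_eq_biSup]
    simpa only [eventually_iSup] using hloc
  obtain ⟨pa, hpa, pb, hpb, hP⟩ := eventually_prod_iff.1 hK
  filter_upwards [hpb, h.pos, eventually_gt_atTop 0] with t ht hbt ht0 u hu
  have := hP (hpa.self_of_nhdsSet (u / t)
    ⟨by rw [le_div_iff₀ ht0]; linarith [hu.1], by rw [div_le_one ht0]; exact hu.2⟩) ht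
  simp only [div_mul_cancel₀ _ ht0.ne'] at this
  have hu0 : 0 < b u := by
    have := (inv_pos.2 hC0).trans this.1
    rwa [div_pos_iff_of_pos_right hbt] at this
  refine ⟨hu0, ((div_lt_iff₀ hbt).1 this.2).le, ?_⟩
  have := (lt_div_iff₀ hbt).1 this.1
  rw [inv_mul_lt_iff₀ hC0] at this
  exact this.le

lemma mul (h : RegVar b ρ) {c : ℝ → ℝ} {σ : ℝ} (h' : RegVar c σ) :
    RegVar (fun x => b x * c x) (ρ + σ) := by
  refine ⟨by filter_upwards [h.pos, h'.pos] with x h1 h2 using mul_pos h1 h2, fun k hk => ?_⟩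
  have := (h.lim k hk).mul (h'.lim k hk)
  rw [← Real.rpow_add hk] at this
  refine (this.congr fun z => ?_).trans (by rw [neg_add])
  rw [div_mul_div_comm]

lemma rpow_neg (ρ : ℝ) : RegVar (fun x => x ^ (-ρ)) ρ := by
  refine ⟨by filter_upwards [eventually_gt_atTop 0] with x hx using Real.rpow_pos_of_pos hx _,
    fun k hk => ?_⟩
  have h1 : Tendsto (fun z : ℝ × ℝ => z.1 ^ (-ρ)) (𝓝 k ×ˢ atTop) (𝓝 (k ^ (-ρ))) :=
    ((Real.continuousAt_rpow_const k (-ρ) (Or.inl hk.ne')).tendsto).comp tendsto_fst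
  refine h1.congr' ?_
  have e1 : ∀ᶠ z : ℝ × ℝ in 𝓝 k ×ˢ atTop, 0 < z.1 :=
    Eventually.prod_inl (lt_mem_nhds hk) _
  have e2 : ∀ᶠ z : ℝ × ℝ in 𝓝 k ×ˢ atTop, 0 < z.2 :=
    Eventually.prod_inr (eventually_gt_atTop 0) _
  filter_upwards [e1, e2] with z h1 h2
  rw [Real.mul_rpow h1.le h2.le, mul_div_cancel_right₀ _ (Real.rpow_pos_of_pos h2 _).ne']

lemma congr (h : RegVar b ρ) {c : ℝ → ℝ} {x₀ : ℝ} (hc : ∀ x, x₀ < x → c x = b x) : RegVar c ρ := by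
  refine ⟨by filter_upwards [h.pos, eventually_gt_atTop x₀] with x h1 h2; rwa [hc x h2],
    fun k hk => (h.lim k hk).congr' ?_⟩
  have e1 : Tendsto (fun z : ℝ × ℝ => z.1 * z.2) (𝓝 k ×ˢ atTop) atTop :=
    tendsto_fst.pos_mul_atTop hk tendsto_snd
  filter_upwards [e1.eventually_gt_atTop x₀, tendsto_snd.eventually_gt_atTop x₀] with z h1 h2
  rw [hc _ h1, hc _ h2]

end RegVar

/-! ### The uniform convergence theorem -/

/-- The measure-theoretic argument. If uniformity fails along x_n and u_n with |u_n| < 1, consider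
the shifts v in [0, 4] along which h changes by less than ε/2 from x_n, respectively from x_n + u_n.
Both sets have measure above 3 for large n, so after translating the second by u_n they share a
point, and the triangle inequality contradicts the choice of u_n. -/
lemma uniform_of_additive_slow {h : ℝ → ℝ} (hm : Measurable h)
    (hu : ∀ u, Tendsto (fun x => h (x + u) - h x) atTop (𝓝 0)) :
    Tendsto (fun z : ℝ × ℝ => h (z.2 + z.1) - h z.2) (𝓝 0 ×ˢ atTop) (𝓝 0) := by
  rw [Metric.tendsto_nhds]
  intro ε hε
  by_contra hcon
  have hex : ∀ n : ℕ, ∃ z : ℝ × ℝ, z.1 ∈ Ioo (-1 : ℝ) 1 ∧ (n : ℝ) ≤ z.2 ∧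
      ε ≤ |h (z.2 + z.1) - h z.2| := by
    intro n
    by_contra! hno
    refine hcon ?_
    have e1 : ∀ᶠ z : ℝ × ℝ in 𝓝 0 ×ˢ atTop, z.1 ∈ Ioo (-1 : ℝ) 1 :=
      Eventually.prod_inl (Ioo_mem_nhds (by norm_num) (by norm_num)) _
    have e2 : ∀ᶠ z : ℝ × ℝ in 𝓝 (0 : ℝ) ×ˢ atTop, (n : ℝ) ≤ z.2 :=
      Eventually.prod_inr (eventually_ge_atTop _) _
    filter_upwards [e1, e2] with z h1 h2
    simpa [Real.dist_eq] using hno z h1 h2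
  choose z hz1 hz2 hz3 using hex
  have hx : Tendsto (fun n => (z n).2) atTop atTop :=
    tendsto_atTop_mono hz2 tendsto_natCast_atTop_atTop
  have hxu : Tendsto (fun n => (z n).2 + (z n).1) atTop atTop :=
    tendsto_atTop_add_right_of_le _ (-1) hx fun n => (hz1 n).1.le
  -- The good sets increase to [0, 4], so their measures tend to 4.
  have key : ∀ y : ℕ → ℝ, Tendsto y atTop atTop → ∀ᶠ n in atTop,
      3 < volume {v ∈ Icc (0 : ℝ) 4 | ∀ m, n ≤ m → |h (y m + v) - h (y m)| < ε / 2} := by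
    intro y hy
    set A : ℕ → Set ℝ := fun n =>
      {v ∈ Icc (0 : ℝ) 4 | ∀ m, n ≤ m → |h (y m + v) - h (y m)| < ε / 2} with hA
    have hmono : Monotone A := fun n n' hn v hv => ⟨hv.1, fun m hm => hv.2 m (hn.trans hm)⟩
    have hU : ⋃ n, A n = Icc 0 4 := by
      refine Subset.antisymm (iUnion_subset fun n v hv => hv.1) fun v hv => ?_
      have := ((hu v).comp hy).eventually (Metric.ball_mem_nhds 0 (half_pos hε))
      obtain ⟨n, hn⟩ := eventually_atTop.1 this
      exact mem_iUnion.2 ⟨n, hv, fun m hm => by simpa using hn m hm⟩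
    have := tendsto_measure_iUnion_atTop (μ := volume) hmono
    rw [hU, Real.volume_Icc] at this
    refine this.eventually (lt_mem_nhds ?_)
    norm_num
  obtain ⟨n, hn1, hn2⟩ := ((key _ hx).and (key _ hxu)).exists
  set A := {v ∈ Icc (0 : ℝ) 4 | ∀ m, n ≤ m → |h ((z m).2 + v) - h ((z m).2)| < ε / 2} with hA
  set B := {v ∈ Icc (0 : ℝ) 4 | ∀ m, n ≤ m →
    |h ((z m).2 + (z m).1 + v) - h ((z m).2 + (z m).1)| < ε / 2} with hB
  have hAm : MeasurableSet A := by
    refine measurableSet_Icc.inter ?_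
    have : {v | ∀ m, n ≤ m → |h ((z m).2 + v) - h ((z m).2)| < ε / 2} =
        ⋂ m, ⋂ _ : n ≤ m, {v | |h ((z m).2 + v) - h ((z m).2)| < ε / 2} := by
      ext v; simp
    change MeasurableSet {v | ∀ m, n ≤ m → |h ((z m).2 + v) - h ((z m).2)| < ε / 2}
    rw [this]
    refine MeasurableSet.iInter fun m => MeasurableSet.iInter fun _ => ?_
    exact measurableSet_lt (by fun_prop) measurable_const
  set B' := (fun v => (z n).1 + v) '' B with hB'
  have hB'v : volume B' = volume B := by
    rw [hB', image_add_left]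
    exact measure_preimage_add _ _ _
  have hsubA : A ⊆ Icc (-1) 5 := fun v hv => ⟨by linarith [hv.1.1], by linarith [hv.1.2]⟩
  have hsubB : B' ⊆ Icc (-1) 5 := by
    rintro _ ⟨v, hv, rfl⟩
    exact ⟨by linarith [hv.1.1, (hz1 n).1], by linarith [hv.1.2, (hz1 n).2]⟩
  -- Two sets of measure above 3 do not fit disjointly into [-1, 5], of length 6.
  have hne : ¬ Disjoint A B' := by
    intro hd
    have h1 := measure_union' (μ := volume) hd hAm
    have h2 := measure_mono (μ := volume) (union_subset hsubA hsubB)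
    rw [h1, hB'v, Real.volume_Icc] at h2
    have h3 : (3 : ℝ≥0∞) + 3 < volume A + volume B := ENNReal.add_lt_add hn1 hn2
    have h4 := h3.trans_le h2
    norm_num at h4
  obtain ⟨y, hyA, v, hvB, hvy⟩ := Set.not_disjoint_iff.1 hne
  have h1 := hyA.2 n le_rfl
  have h2 := hvB.2 n le_rfl
  rw [show (z n).2 + (z n).1 + v = (z n).2 + y by rw [← hvy]; ring] at h2
  have h3 := hz3 n
  have h4 := abs_sub_le (h ((z n).2 + (z n).1)) (h ((z n).2 + y)) (h (z n).2)
  rw [abs_sub_comm (h ((z n).2 + (z n).1)) (h ((z n).2 + y))] at h4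
  linarith

/-- Passing to log L(e^x) makes slow variation additive; the measurability in the definition of slow
variation is used here. -/
lemma IsSlowlyVarying.regVar {L : ℝ → ℝ} (hL : IsSlowlyVarying L) : RegVar L 0 := by
  obtain ⟨⟨X, hXm, hXp⟩, hlim⟩ := hL
  have hpos : ∀ᶠ x in atTop, 0 < L x := by
    filter_upwards [eventually_ge_atTop X] with x hx using hXp x hx
  refine RegVar.of_one hpos ?_ (by simpa using hlim)
  classical
  -- L is only known to be measurable on [X, ∞), so it is replaced by the constant 1 to the left.
  set g : ℝ → ℝ := fun y => if h : y ∈ Ici X then (Ici X).domRestrict L ⟨y, h⟩ else 1 with hg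
  have hgm : Measurable g := Measurable.dite hXm measurable_const measurableSet_Ici
  have hgL : ∀ y, X ≤ y → g y = L y := fun y hy => by simp [hg, hy]
  set h : ℝ → ℝ := fun x => Real.log (g (Real.exp x)) with hh
  have hhm : Measurable h := Real.measurable_log.comp (hgm.comp Real.measurable_exp)
  have hhu : ∀ u, Tendsto (fun x => h (x + u) - h x) atTop (𝓝 0) := by
    intro u
    have h1 := (hlim (Real.exp u) (Real.exp_pos u)).comp Real.tendsto_exp_atTop
    have h2 := (Real.continuousAt_log one_ne_zero).tendsto.comp h1
    rw [Real.log_one] at h2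
    refine h2.congr' ?_
    have hx1 := Real.tendsto_exp_atTop.eventually_ge_atTop X
    have hx2 := (Real.tendsto_exp_atTop.const_mul_atTop (Real.exp_pos u)).eventually_ge_atTop X
    filter_upwards [hx1, hx2] with x h3 h4
    simp only [Function.comp, hh]
    rw [add_comm, Real.exp_add, hgL _ h3, hgL _ h4,
      Real.log_div (hXp _ h4).ne' (hXp _ h3).ne']
  have h1 := uniform_of_additive_slow hhm hhu
  have e : Tendsto (fun z : ℝ × ℝ => (Real.log z.1, Real.log z.2)) (𝓝 1 ×ˢ atTop)
      (𝓝 0 ×ˢ atTop) := by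
    refine Tendsto.prodMk ?_ (Real.tendsto_log_atTop.comp tendsto_snd)
    have := (Real.continuousAt_log one_ne_zero).tendsto
    rw [Real.log_one] at this
    exact this.comp tendsto_fst
  have h2 := (Real.continuous_exp.tendsto 0).comp (h1.comp e)
  rw [Real.exp_zero] at h2
  refine h2.congr' ?_
  have e1 : ∀ᶠ z : ℝ × ℝ in 𝓝 1 ×ˢ atTop, 0 < z.1 := Eventually.prod_inl (lt_mem_nhds one_pos) _
  have e2 : ∀ᶠ z : ℝ × ℝ in 𝓝 (1 : ℝ) ×ˢ atTop, 0 < z.2 :=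
    Eventually.prod_inr (eventually_gt_atTop 0) _
  have e3 : ∀ᶠ z : ℝ × ℝ in 𝓝 (1 : ℝ) ×ˢ atTop, X ≤ z.1 * z.2 :=
    (tendsto_fst.pos_mul_atTop one_pos tendsto_snd).eventually_ge_atTop X
  have e4 : ∀ᶠ z : ℝ × ℝ in 𝓝 (1 : ℝ) ×ˢ atTop, X ≤ z.2 := tendsto_snd.eventually_ge_atTop X
  filter_upwards [e1, e2, e3, e4] with z h1 h2 h3 h4
  simp only [Function.comp, hh]
  rw [Real.exp_add, Real.exp_log h1, Real.exp_log h2, mul_comm z.2, hgL _ h3, hgL _ h4, Real.exp_sub,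
    Real.exp_log (hXp _ h3), Real.exp_log (hXp _ h4)]

/-! ### Asymptotics of integrals -/

/-- A function that contracts under doubling of the argument tends to `0`. -/
lemma tendsto_zero_of_doubling {φ : ℝ → ℝ} (hpos : ∀ᶠ t in atTop, 0 < φ t)
    (hb : ∀ᶠ T in atTop, ∃ C, ∀ t ∈ Icc T (2 * T), φ t ≤ C) {lam : ℝ}
    (h : Tendsto (fun t => φ (2 * t) / φ t) atTop (𝓝 lam)) (hlam : lam < 1) :
    Tendsto φ atTop (𝓝 0) := by
  obtain ⟨κ, hκ, hκ1⟩ := exists_between (max_lt hlam one_pos)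
  have hκ0 : 0 < κ := (le_max_right _ _).trans_lt hκ
  have hr := h.eventually (gt_mem_nhds ((le_max_left _ _).trans_lt hκ))
  obtain ⟨T₀, hT₀⟩ := eventually_atTop.1 (hpos.and hr)
  obtain ⟨T, hTb, hT1, hT⟩ := (hb.and ((eventually_ge_atTop T₀).and (eventually_gt_atTop 0))).exists
  obtain ⟨C, hC⟩ := hTb
  have hdouble : ∀ t, T ≤ t → φ (2 * t) ≤ κ * φ t := fun t ht => by
    have := hT₀ t (hT1.trans ht)
    exact ((div_lt_iff₀ this.1).1 this.2).le
  have hp : ∀ t, T ≤ t → 0 < φ t := fun t ht => (hT₀ t (hT1.trans ht)).1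
  have hC0 : 0 < C := (hp T le_rfl).trans_le (hC T ⟨le_rfl, by linarith⟩)
  -- The bound on the block [T, 2T] spreads to [T, ∞) by halving; repeating the contraction N times
  -- then gives the factor κ^N.
  have h0 : ∀ n : ℕ, ∀ t, T ≤ t → t ≤ 2 ^ n * (2 * T) → φ t ≤ C := by
    intro n
    induction n with
    | zero => intro t h1 h2; exact hC t ⟨h1, by simpa using h2⟩
    | succ n ih =>
      intro t h1 h2
      rcases le_total t (2 * T) with h3 | h3
      · exact hC t ⟨h1, h3⟩
      · have h4 := ih (t / 2) (by linarith) (by rw [pow_succ] at h2; linarith)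
        have h5 := hdouble (t / 2) (by linarith)
        rw [mul_div_cancel₀ _ two_ne_zero] at h5
        have h6 := hp (t / 2) (by linarith)
        nlinarith
  have hbd : ∀ t, T ≤ t → φ t ≤ C := fun t ht => by
    obtain ⟨n, hn⟩ := pow_unbounded_of_one_lt (t / (2 * T)) (one_lt_two (α := ℝ))
    exact h0 n t ht ((div_lt_iff₀ (by linarith)).1 hn).le
  have hN : ∀ N : ℕ, ∀ t, 2 ^ N * T ≤ t → φ t ≤ κ ^ N * C := by
    intro N
    induction N with
    | zero => intro t ht; simpa using hbd t (by simpa using ht)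
    | succ N ih =>
      intro t ht
      rw [pow_succ] at ht
      have h4 := ih (t / 2) (by linarith)
      have h7 : T ≤ t / 2 := by
        have : (1 : ℝ) ≤ 2 ^ N := one_le_pow₀ (by norm_num)
        nlinarith
      have h5 := hdouble (t / 2) h7
      rw [mul_div_cancel₀ _ two_ne_zero] at h5
      rw [pow_succ']
      nlinarith
  have hlim : Tendsto (fun N : ℕ => κ ^ N * C) atTop (𝓝 0) := by
    simpa using (tendsto_pow_atTop_nhds_zero_of_lt_one hκ0.le hκ1).mul_const C
  rw [Metric.tendsto_nhds]
  intro ε hε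
  obtain ⟨N, hNε⟩ := (hlim.eventually (gt_mem_nhds hε)).exists
  filter_upwards [eventually_ge_atTop (2 ^ N * T), hpos] with t ht ht0
  rw [Real.dist_eq, sub_zero, abs_of_pos ht0]
  exact (hN N t ht).trans_lt hNε

namespace RegVar

variable {a b : ℝ → ℝ} {ρ : ℝ}

lemma eventually_bdd (h : RegVar b ρ) :
    ∀ᶠ T in atTop, ∃ c C, 0 < c ∧ ∀ t ∈ Icc T (2 * T), c ≤ b t ∧ b t ≤ C := by
  obtain ⟨C, hC, hev⟩ := h.exists_bound
  have h2 := (tendsto_id.const_mul_atTop (two_pos (α := ℝ))).eventually hev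
  filter_upwards [h2, eventually_gt_atTop 0] with T hT hT0
  simp only [id] at hT
  refine ⟨b (2 * T) / C, C * b (2 * T), ?_, fun t ht => ?_⟩
  · exact div_pos (hT (2 * T) ⟨by linarith, le_rfl⟩).1 hC
  · have := hT t ⟨by linarith [ht.1], ht.2⟩
    exact ⟨by rw [div_le_iff₀ hC]; linarith [this.2.2], this.2.1⟩

lemma tendsto_zero (h : RegVar b ρ) (hρ : 0 < ρ) : Tendsto b atTop (𝓝 0) := by
  refine tendsto_zero_of_doubling h.pos ?_ (h.tendsto_mul two_pos)
    (Real.rpow_lt_one_of_one_lt_of_neg (by norm_num) (by linarith))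
  filter_upwards [h.eventually_bdd] with T ⟨c, C, _, hC⟩
  exact ⟨C, fun t ht => (hC t ht).2⟩

/-- Choose κ strictly between 1 and ρ: the product a(x) x^κ has negative index, so it tends to 0 and
a is eventually below x^(-κ). -/
lemma integrableOn (h : RegVar a ρ) (hρ : 1 < ρ)
    (hint : ∀ t, 0 ≤ t → IntervalIntegrable a volume 0 t) : IntegrableOn a (Ioi 0) := by
  set κ := (1 + ρ) / 2 with hκ
  have h1 : Tendsto (fun x => a x * x ^ (-(-κ))) atTop (𝓝 0) :=
    (h.mul (RegVar.rpow_neg (-κ))).tendsto_zero (by linarith)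
  obtain ⟨T, hT⟩ := eventually_atTop.1 ((h1.eventually (gt_mem_nhds one_pos)).and
    (h.pos.and (eventually_gt_atTop 0)))
  have hT0 : 0 < T := (hT T le_rfl).2.2
  rw [← Ioc_union_Ioi_eq_Ioi hT0.le]
  refine ((intervalIntegrable_iff_integrableOn_Ioc_of_le hT0.le).1 (hint T hT0.le)).union ?_
  have hi := integrableOn_Ioi_rpow_of_lt (a := -κ) (by linarith) hT0
  refine Integrable.mono' hi ?_ ?_
  · have hcov : Ioi T ⊆ ⋃ n : ℕ, Ioc 0 (n : ℝ) := fun x hx => by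
      obtain ⟨n, hn⟩ := exists_nat_ge x
      exact mem_iUnion.2 ⟨n, hT0.trans hx, hn⟩
    refine AEStronglyMeasurable.mono_set hcov ?_
    rw [aestronglyMeasurable_iUnion_iff]
    intro n
    exact ((intervalIntegrable_iff_integrableOn_Ioc_of_le n.cast_nonneg).1
      (hint n n.cast_nonneg)).aestronglyMeasurable
  · refine (ae_restrict_iff' measurableSet_Ioi).2 (ae_of_all _ fun x hx => ?_)
    have := hT x (le_of_lt hx)
    rw [Real.norm_of_nonneg this.2.1.le]
    have h2 := this.1
    rw [neg_neg] at h2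
    rw [Real.rpow_neg this.2.2.le, ← one_div, le_div_iff₀ (Real.rpow_pos_of_pos this.2.2 _)]
    exact h2.le

end RegVar

/-- Karamata's theorem for diverging integrals, in the form of regular variation. -/
lemma tendsto_integral_ratio {b : ℝ → ℝ} {x₀ σ c : ℝ} (hc : 0 < c)
    (hint : ∀ x, x₀ ≤ x → IntervalIntegrable b volume x₀ x) (hpos : ∀ᶠ x in atTop, 0 < b x)
    (hb : Tendsto (fun x => b (c * x) / b x) atTop (𝓝 (c ^ (-σ))))
    (hB : Tendsto (fun x => ∫ u in x₀..x, b u) atTop atTop) :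
    Tendsto (fun x => (∫ u in x₀..(c * x), b u) / ∫ u in x₀..x, b u) atTop
      (𝓝 (c ^ (1 - σ))) := by
  have hint' : ∀ x y, x₀ ≤ x → x₀ ≤ y → IntervalIntegrable b volume x y := fun x y hx hy =>
    (hint x hx).symm.trans (hint y hy)
  set B : ℝ → ℝ := fun x => ∫ u in x₀..x, b u with hBdef
  rw [Metric.tendsto_nhds]
  intro η hη
  set ε := η / (4 * c) with hε
  have hε0 : 0 < ε := by positivity
  have hev : ∀ᶠ x in atTop, |b (c * x) - c ^ (-σ) * b x| ≤ ε * b x := by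
    filter_upwards [hb.eventually (Metric.ball_mem_nhds _ hε0), hpos] with x hx hx0
    rw [Real.dist_eq] at hx
    have : b (c * x) - c ^ (-σ) * b x = (b (c * x) / b x - c ^ (-σ)) * b x := by field_simp
    rw [this, abs_mul, abs_of_pos hx0]
    exact mul_le_mul_of_nonneg_right hx.le hx0.le
  obtain ⟨T₁, hT₁⟩ := eventually_atTop.1 hev
  obtain ⟨T, hT1, hTx, hcT⟩ := ((eventually_ge_atTop T₁).and ((eventually_ge_atTop x₀).and
    ((tendsto_id.const_mul_atTop hc).eventually_ge_atTop x₀))).exists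
  simp only [id] at hcT
  -- The contribution of the part below T, where the pointwise comparison is not available; it is
  -- absorbed because B tends to infinity.
  set K := |B (c * T) - c ^ (1 - σ) * B T| + c * ε * |B T| with hK
  have hmain : ∀ x, T ≤ x → |B (c * x) - c ^ (1 - σ) * B x| ≤ c * ε * B x + K := by
    intro x hx
    have hcx : c * T ≤ c * x := by gcongr
    have e1 : B (c * x) = B (c * T) + c * ∫ u in T..x, b (c * u) := by
      have := intervalIntegral.integral_comp_mul_left (a := T) (b := x) b hc.ne'
      rw [this, smul_eq_mul, mul_inv_cancel_left₀ hc.ne',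
        intervalIntegral.integral_add_adjacent_intervals (hint _ hcT)
          (hint' _ _ hcT (hcT.trans hcx))]
    have e2 : B x = B T + ∫ u in T..x, b u :=
      (intervalIntegral.integral_add_adjacent_intervals (hint _ hTx)
          (hint' _ _ hTx (hTx.trans hx))).symm
    have i1 : IntervalIntegrable (fun u => b (c * u)) volume T x := by
      have := (hint' (c * T) (c * x) hcT (hcT.trans hcx)).comp_mul_left (c := c)
      simpa [mul_div_cancel_left₀ _ hc.ne'] using this
    have i2 := hint' T x hTx (hTx.trans hx)
    have e3 : |(∫ u in T..x, b (c * u)) - c ^ (-σ) * ∫ u in T..x, b u| ≤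
        ε * ∫ u in T..x, b u := by
      rw [← intervalIntegral.integral_const_mul, ← intervalIntegral.integral_sub i1
        (i2.const_mul _), ← intervalIntegral.integral_const_mul]
      refine (intervalIntegral.abs_integral_le_integral_abs hx).trans ?_
      exact intervalIntegral.integral_mono_on hx (i1.sub (i2.const_mul _)).abs (i2.const_mul _)
        fun u hu => hT₁ u (hT1.trans hu.1)
    have e4 : c ^ (1 - σ) = c * c ^ (-σ) := by
      rw [sub_eq_add_neg, Real.rpow_add hc, Real.rpow_one]
    have e5 : B (c * x) - c ^ (1 - σ) * B x = (B (c * T) - c ^ (1 - σ) * B T) +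
        c * ((∫ u in T..x, b (c * u)) - c ^ (-σ) * ∫ u in T..x, b u) := by
      rw [e1, e2, e4]; ring
    rw [e5]
    refine (abs_add_le _ _).trans ?_
    rw [abs_mul, abs_of_pos hc]
    have e6 := mul_le_mul_of_nonneg_left e3 hc.le
    have e7 : ∫ u in T..x, b u = B x - B T := by rw [e2]; ring
    rw [e7] at e6
    have e8 := mul_le_mul_of_nonneg_left (neg_abs_le (B T)) (mul_pos hc hε0).le
    rw [e7] at *
    rw [hK]
    nlinarith
  filter_upwards [eventually_ge_atTop T, hB.eventually_gt_atTop (4 * K / η),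
    hB.eventually_gt_atTop 0] with x hx hxK hx0
  have h1 := hmain x hx
  rw [div_lt_iff₀ hη] at hxK
  change 0 < B x at hx0
  change 4 * K < B x * η at hxK
  rw [Real.dist_eq]
  have e : B (c * x) / B x - c ^ (1 - σ) = (B (c * x) - c ^ (1 - σ) * B x) / B x := by
    field_simp
  change |B (c * x) / B x - c ^ (1 - σ)| < η
  rw [e, abs_div, abs_of_pos hx0, div_lt_iff₀ hx0]
  have e9 : c * ε = η / 4 := by rw [hε]; field_simp
  rw [e9] at h1
  nlinarith

section convolution

variable {a b : ℝ → ℝ} {ρ : ℝ}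

/-- Since b has index -1, its divergent integral is slowly varying, so the quotient has index 1 - ρ
< 0. Checking the ratio under doubling is enough. -/
lemma tendsto_tail_convolution (ha : RegVar a ρ) (hρ : 1 < ρ) (hb : RegVar b 1)
    (hbint : ∀ t, 0 ≤ t → IntervalIntegrable b volume 0 t) (hb0 : ∀ t, 0 < t → 0 ≤ b t)
    (hB : Tendsto (fun t => ∫ u in (0 : ℝ)..t, b u) atTop atTop) :
    Tendsto (fun t => a t * (∫ u in (0 : ℝ)..t, b u) / b t) atTop (𝓝 0) := by
  set B : ℝ → ℝ := fun x => ∫ u in (0 : ℝ)..x, b u with hBdef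
  have hBm : ∀ x y, 0 ≤ x → x ≤ y → B x ≤ B y := by
    intro x y hx hxy
    have h1 : B y = B x + ∫ u in x..y, b u :=
      (intervalIntegral.integral_add_adjacent_intervals (hbint _ hx)
          ((hbint _ hx).symm.trans (hbint y (hx.trans hxy)))).symm
    have h2 : 0 ≤ ∫ u in x..y, b u := by
      rw [intervalIntegral.integral_of_le hxy]
      exact setIntegral_nonneg measurableSet_Ioc fun u hu => hb0 u (hx.trans_lt hu.1)
    linarith
  refine tendsto_zero_of_doubling (lam := 2 ^ (1 - ρ)) ?_ ?_ ?_
    (Real.rpow_lt_one_of_one_lt_of_neg (by norm_num) (by linarith))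
  · filter_upwards [ha.pos, hb.pos, hB.eventually_gt_atTop 0] with t h1 h2 h3
    exact div_pos (mul_pos h1 h3) h2
  · filter_upwards [ha.eventually_bdd, hb.eventually_bdd, hB.eventually_gt_atTop 0,
      eventually_ge_atTop 0] with T ⟨c, C, hc, hC⟩ ⟨c', C', hc', hC'⟩ hT hT0
    refine ⟨C * B (2 * T) / c', fun t ht => ?_⟩
    have h1 := hC t ht
    have h2 := hC' t ht
    have h3 := hBm t (2 * T) (hT0.trans ht.1) ht.2
    have h4 := hBm T t hT0 ht.1
    change 0 < B T at hT
    exact div_le_div₀ (mul_nonneg (by linarith) (by linarith))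
      (mul_le_mul h1.2 h3 (by linarith) (by linarith)) hc' h2.1
  · have h1 := ha.tendsto_mul two_pos
    have h2 := hb.tendsto_mul two_pos
    have h3 := tendsto_integral_ratio two_pos hbint hb.pos h2 hB
    have h4 := (h1.mul h3).div h2 (Real.rpow_pos_of_pos two_pos _).ne'
    have e : (2 : ℝ) ^ (-ρ) * 2 ^ ((1 : ℝ) - 1) / 2 ^ (-(1 : ℝ)) = 2 ^ (1 - ρ) := by
      rw [← Real.rpow_add two_pos, ← Real.rpow_sub two_pos]; ring_nf
    rw [e] at h4
    refine h4.congr fun t => ?_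
    simp only [Pi.div_apply]
    rw [div_mul_div_comm, div_div_div_eq, div_div_div_eq, mul_comm (b (2 * t))]

/-- The asymptotics of a convolution of two regularly varying functions, one of which has an
integrable tail while the integral of the other diverges slowly. -/
lemma tendsto_convolution (ha : RegVar a ρ) (hρ : 1 < ρ) (hb : RegVar b 1)
    (haint : ∀ t, 0 ≤ t → IntervalIntegrable a volume 0 t) (ha0 : ∀ t, 0 < t → 0 ≤ a t)
    (hbint : ∀ t, 0 ≤ t → IntervalIntegrable b volume 0 t) (hb0 : ∀ t, 0 < t → 0 ≤ b t)
    (hB : Tendsto (fun t => ∫ u in (0 : ℝ)..t, b u) atTop atTop)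
    (hab : ∀ t, 0 ≤ t → IntervalIntegrable (fun u => a u * b (t - u)) volume 0 t) :
    Tendsto (fun t => (∫ u in (0 : ℝ)..t, a u * b (t - u)) / b t) atTop
      (𝓝 (∫ u in Ioi 0, a u)) := by
  obtain ⟨Cb, hCb, hevb⟩ := hb.exists_bound
  obtain ⟨Ca, hCa, heva⟩ := ha.exists_bound
  have hI := ha.integrableOn hρ haint
  have hab' : ∀ t, 0 < t → IntervalIntegrable (fun u => a u * b (t - u)) volume 0 (t / 2) ∧
      IntervalIntegrable (fun u => a u * b (t - u)) volume (t / 2) t := by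
    intro t ht
    have h2 : t / 2 ∈ uIcc 0 t := by rw [uIcc_of_le ht.le]; constructor <;> linarith
    exact ⟨(hab t ht.le).mono_set (uIcc_subset_uIcc left_mem_uIcc h2),
      (hab t ht.le).mono_set (uIcc_subset_uIcc h2 right_mem_uIcc)⟩
  -- The main part u ≤ t/2: b(t - u)/b(t) is bounded there and tends to 1 for each fixed u, so
  -- dominated convergence applies.
  have hmain : Tendsto (fun t => ∫ u in Ioi 0,
      (Ioc 0 (t / 2)).indicator (fun u => a u * b (t - u) / b t) u) atTop
      (𝓝 (∫ u in Ioi 0, a u)) := by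
    refine tendsto_integral_filter_of_dominated_convergence (fun u => a u * Cb) ?_ ?_
      (hI.mul_const _) ?_
    · filter_upwards [eventually_gt_atTop 0] with t ht
      refine (aestronglyMeasurable_indicator_iff measurableSet_Ioc).2 ?_
      refine AEStronglyMeasurable.mono_measure ?_
        (Measure.restrict_mono le_rfl Measure.restrict_le_self)
      exact (((intervalIntegrable_iff_integrableOn_Ioc_of_le (by linarith)).1
        (hab' t ht).1).div_const _).aestronglyMeasurable
    · filter_upwards [hevb, eventually_gt_atTop 0] with t ht ht0
      refine (ae_restrict_iff' measurableSet_Ioi).2 (ae_of_all _ fun u hu => ?_)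
      have hu0 : 0 < u := hu
      by_cases hmem : u ∈ Ioc 0 (t / 2)
      · rw [indicator_of_mem hmem]
        have h1 := ht t ⟨by linarith, le_rfl⟩
        have h2 := ht (t - u) ⟨by linarith [hmem.2], by linarith⟩
        rw [Real.norm_of_nonneg (div_nonneg (mul_nonneg (ha0 u hu0) h2.1.le) h1.1.le),
          mul_div_assoc]
        refine mul_le_mul_of_nonneg_left ?_ (ha0 u hu0)
        rw [div_le_iff₀ h1.1]
        exact h2.2.1
      · rw [indicator_of_notMem hmem, norm_zero]
        exact mul_nonneg (ha0 u hu0) hCb.le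
    · refine (ae_restrict_iff' measurableSet_Ioi).2 (ae_of_all _ fun u hu => ?_)
      have h1 : Tendsto (fun t : ℝ => (t - u) / t) atTop (𝓝 1) := by
        have : Tendsto (fun t : ℝ => 1 - u / t) atTop (𝓝 (1 - 0)) :=
          (tendsto_const_nhds.div_atTop tendsto_id).const_sub 1
        rw [sub_zero] at this
        refine this.congr' ?_
        filter_upwards [eventually_gt_atTop 0] with t ht
        field_simp
      have h2 := (hb.tendsto_ratio one_pos tendsto_id h1).const_mul (a u)
      rw [Real.one_rpow, mul_one] at h2
      refine h2.congr' ?_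
      filter_upwards [eventually_ge_atTop (2 * u)] with t ht
      have hu0 : 0 < u := hu
      have hmem : u ∈ Ioc 0 (t / 2) := ⟨hu0, by linarith⟩
      rw [indicator_of_mem hmem, mul_div_assoc]
      rfl
  -- The part u ≥ t/2: a(u) is at most a constant times a(t), and the remaining integral of b is at
  -- most the one over [0, t].
  have htail : Tendsto (fun t => (∫ u in (t / 2)..t, a u * b (t - u)) / b t) atTop (𝓝 0) := by
    have h0 := (tendsto_tail_convolution ha hρ hb hbint hb0 hB).const_mul Ca
    rw [mul_zero] at h0
    refine tendsto_of_tendsto_of_tendsto_of_le_of_le' tendsto_const_nhds h0 ?_ ?_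
    · filter_upwards [hb.pos, eventually_gt_atTop 0] with t ht ht0
      refine div_nonneg ?_ ht.le
      rw [intervalIntegral.integral_of_le (by linarith), integral_Ioc_eq_integral_Ioo]
      exact setIntegral_nonneg measurableSet_Ioo fun u hu =>
        mul_nonneg (ha0 u (by linarith [hu.1])) (hb0 _ (by linarith [hu.2]))
    · filter_upwards [hb.pos, heva, eventually_gt_atTop 0] with t ht hat ht0
      rw [← mul_div_assoc]
      refine div_le_div_of_nonneg_right ?_ ht.le
      have hat0 := (hat t ⟨by linarith, le_rfl⟩).1
      have i1 : IntervalIntegrable (fun u => b (t - u)) volume 0 t := by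
        have := ((hbint t ht0.le).comp_sub_left t)
        simpa using this.symm
      have i2 : IntervalIntegrable (fun u => b (t - u)) volume (t / 2) t :=
        i1.mono_set (uIcc_subset_uIcc (by rw [uIcc_of_le ht0.le]; constructor <;> linarith)
          right_mem_uIcc)
      have e1 : ∫ u in (0 : ℝ)..t, b (t - u) = ∫ u in (0 : ℝ)..t, b u := by
        rw [intervalIntegral.integral_comp_sub_left]; simp
      have e2 : ∫ u in (t / 2)..t, b (t - u) ≤ ∫ u in (0 : ℝ)..t, b (t - u) := by
        have i3 : IntervalIntegrable (fun u => b (t - u)) volume 0 (t / 2) :=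
          i1.mono_set (uIcc_subset_uIcc left_mem_uIcc
            (by rw [uIcc_of_le ht0.le]; constructor <;> linarith))
        rw [← intervalIntegral.integral_add_adjacent_intervals i3 i2]
        have : 0 ≤ ∫ u in (0 : ℝ)..(t / 2), b (t - u) :=
          intervalIntegral.integral_nonneg (by linarith) fun u hu => hb0 _ (by linarith [hu.2])
        linarith
      have hCa' : 0 ≤ Ca * a t := by positivity
      rw [e1] at e2
      calc ∫ u in (t / 2)..t, a u * b (t - u)
          ≤ ∫ u in (t / 2)..t, (Ca * a t) * b (t - u) := by
            refine intervalIntegral.integral_mono_on_of_le_Ioo (by linarith) (hab' t ht0).2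
              (i2.const_mul _) fun u hu => ?_
            exact mul_le_mul_of_nonneg_right (hat u ⟨hu.1.le, hu.2.le⟩).2.1
              (hb0 _ (by linarith [hu.2]))
        _ = Ca * a t * ∫ u in (t / 2)..t, b (t - u) := intervalIntegral.integral_const_mul _ _
        _ ≤ Ca * a t * ∫ u in (0 : ℝ)..t, b u := mul_le_mul_of_nonneg_left e2 hCa'
        _ = _ := by ring
  have hsum := hmain.add htail
  rw [add_zero] at hsum
  refine hsum.congr' ?_
  filter_upwards [eventually_gt_atTop 0] with t ht
  rw [setIntegral_indicator measurableSet_Ioc, inter_eq_right.2 Ioc_subset_Ioi_self,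
    ← intervalIntegral.integral_of_le (by linarith), intervalIntegral.integral_div, ← add_div,
    intervalIntegral.integral_add_adjacent_intervals (hab' t ht).1 (hab' t ht).2]

end convolution

/-! ### Moments on the unit interval and Laplace transforms -/

/-- Polynomials are uniformly dense in the continuous functions on [0, 1], and these determine a
finite measure. The exponent n = 0 compares the total masses. -/
lemma measure_ext_of_moments {μ ν : Measure (Icc (0 : ℝ) 1)} [IsFiniteMeasure μ]
    [IsFiniteMeasure ν] (h : ∀ n : ℕ, ∫ y, (y : ℝ) ^ n ∂μ = ∫ y, (y : ℝ) ^ n ∂ν) : μ = ν := by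
  have hint : ∀ (κ : Measure (Icc (0 : ℝ) 1)) [IsFiniteMeasure κ] (f : C(Icc (0 : ℝ) 1, ℝ)),
      Integrable f κ := fun κ _ f => (BoundedContinuousFunction.mkOfCompact f).integrable κ
  have hpoly : ∀ P : Polynomial ℝ, ∫ y : Icc (0 : ℝ) 1, P.eval (y : ℝ) ∂μ =
      ∫ y : Icc (0 : ℝ) 1, P.eval (y : ℝ) ∂ν := by
    intro P
    simp only [Polynomial.eval_eq_sum_range]
    rw [integral_finsetSum, integral_finsetSum]
    · simp only [integral_const_mul, h]
    · exact fun i _ => (hint ν ⟨fun y => (y : ℝ) ^ i, by fun_prop⟩).const_mul _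
    · exact fun i _ => (hint μ ⟨fun y => (y : ℝ) ^ i, by fun_prop⟩).const_mul _
  refine ext_of_forall_integral_eq_of_IsFiniteMeasure fun f => ?_
  have key : ∀ ε > 0, |∫ y, f y ∂μ - ∫ y, f y ∂ν| ≤ ε * (μ.real univ + ν.real univ) := by
    intro ε hε
    obtain ⟨P, hP⟩ := exists_polynomial_near_continuousMap 0 1 f.toContinuousMap ε hε
    have hPf : ∀ y : Icc (0 : ℝ) 1, |P.eval (y : ℝ) - f y| ≤ ε := fun y =>
      ((P.toContinuousMapOn _ - f.toContinuousMap).norm_coe_le_norm y).trans hP.le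
    have hb : ∀ (κ : Measure (Icc (0 : ℝ) 1)) [IsFiniteMeasure κ],
        |∫ y, P.eval (y : ℝ) ∂κ - ∫ y, f y ∂κ| ≤ ε * κ.real univ := by
      intro κ _
      have e : ∫ y : Icc (0 : ℝ) 1, (P.eval (y : ℝ) - f y) ∂κ =
          ∫ y : Icc (0 : ℝ) 1, P.eval (y : ℝ) ∂κ - ∫ y, f y ∂κ :=
        integral_sub (hint κ (P.toContinuousMapOn _)) (f.integrable κ)
      rw [← e]
      exact norm_integral_le_of_norm_le_const
        (f := fun y : Icc (0 : ℝ) 1 => P.eval (y : ℝ) - f y) (ae_of_all _ hPf)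
    have h1 := abs_le.1 (hb μ)
    have h2 := abs_le.1 (hb ν)
    rw [hpoly P] at h1
    rw [abs_le]
    constructor <;> linarith [h1.1, h1.2, h2.1, h2.2]
  have h0 : |∫ y, f y ∂μ - ∫ y, f y ∂ν| ≤ 0 := by
    have hlim : Tendsto (fun ε : ℝ => ε * (μ.real univ + ν.real univ)) (𝓝[>] 0)
        (𝓝 (0 * (μ.real univ + ν.real univ))) :=
      tendsto_nhdsWithin_of_tendsto_nhds ((continuous_id.mul continuous_const).tendsto 0)
    rw [zero_mul] at hlim
    exact ge_of_tendsto hlim (eventually_nhdsWithin_of_forall fun ε hε => key ε hε)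
  linarith [abs_nonpos_iff.1 h0]

lemma continuous_coe_rpow {lam : ℝ} (hlam : 0 ≤ lam) :
    Continuous fun y : Icc (0 : ℝ) 1 => (y : ℝ) ^ lam :=
  continuous_subtype_val.rpow_const fun _ => Or.inr hlam

lemma integrable_coe_rpow (κ : Measure (Icc (0 : ℝ) 1)) [IsFiniteMeasure κ] {lam : ℝ}
    (hlam : 0 ≤ lam) : Integrable (fun y : Icc (0 : ℝ) 1 => (y : ℝ) ^ lam) κ :=
  (BoundedContinuousFunction.mkOfCompact ⟨_, continuous_coe_rpow hlam⟩).integrable κ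

/-- Convergence of all positive moments of probability laws on `[0, 1]` implies weak
convergence. -/
lemma exists_tendsto_of_moments {ι : Type*} {f : Filter ι} [NeBot f]
    (ν : ι → ProbabilityMeasure (Icc (0 : ℝ) 1)) {Φ : ℝ → ℝ}
    (h : ∀ lam : ℝ, 0 < lam →
      Tendsto (fun i => ∫ y, (y : ℝ) ^ lam ∂(ν i : Measure (Icc (0 : ℝ) 1))) f (𝓝 (Φ lam))) :
    ∃ ν₀ : ProbabilityMeasure (Icc (0 : ℝ) 1), Tendsto ν f (𝓝 ν₀) ∧
      ∀ lam : ℝ, 0 < lam → ∫ y, (y : ℝ) ^ lam ∂(ν₀ : Measure (Icc (0 : ℝ) 1)) = Φ lam := by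
  -- Probability measures on [0, 1] form a compact space, so every ultrafilter has a limit; the
  -- moments show that all these limits coincide.
  have hU : ∀ U : Ultrafilter ι, ↑U ≤ f → ∃ κ : ProbabilityMeasure (Icc (0 : ℝ) 1),
      Tendsto ν U (𝓝 κ) ∧
      ∀ lam : ℝ, 0 < lam → ∫ y, (y : ℝ) ^ lam ∂(κ : Measure (Icc (0 : ℝ) 1)) = Φ lam := by
    intro U hUf
    obtain ⟨κ, -, hκ⟩ := isCompact_univ.ultrafilter_le_nhds (U.map ν) (by simp)
    refine ⟨κ, hκ, fun lam hlam => ?_⟩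
    have h1 := (ProbabilityMeasure.tendsto_iff_forall_integral_tendsto.1
      (show Tendsto ν U (𝓝 κ) from hκ))
      (BoundedContinuousFunction.mkOfCompact ⟨_, continuous_coe_rpow hlam.le⟩)
    exact tendsto_nhds_unique h1 ((h lam hlam).mono_left hUf)
  obtain ⟨ν₀, -, hν₀⟩ := hU (Ultrafilter.of f) (Ultrafilter.of_le f)
  refine ⟨ν₀, (tendsto_iff_ultrafilter _ _ _).2 fun U hUf => ?_, hν₀⟩
  obtain ⟨κ, hκ, hκm⟩ := hU U hUf
  have : κ = ν₀ := by
    apply ProbabilityMeasure.toMeasure_injective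
    refine measure_ext_of_moments fun n => ?_
    rcases Nat.eq_zero_or_pos n with rfl | hn
    · simp
    · have h1 := hκm n (by exact_mod_cast hn)
      have h2 := hν₀ n (by exact_mod_cast hn)
      simp only [Real.rpow_natCast] at h1 h2
      rw [h1, h2]
  rwa [← this]

/-! ### The law with Laplace transform 1 / (1 + λ^γ) -/

section linnik

variable {γ : ℝ} {ν : Measure (Icc (0 : ℝ) 1)} [IsProbabilityMeasure ν]

/-- Self-decomposability of the law with Laplace transform `1 / (1 + lam ^ γ)`, in multiplicative
notation. -/
lemma eq_mixture (hγ : 0 < γ)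
    (hν : ∀ lam : ℝ, 0 < lam → ∫ y, (y : ℝ) ^ lam ∂ν = 1 / (1 + lam ^ γ)) {c : ℝ}
    (hc : c ∈ Ioo (0 : ℝ) 1) {φ : Icc (0 : ℝ) 1 → Icc (0 : ℝ) 1} (hφc : Measurable φ)
    (hφ : ∀ y, (φ y : ℝ) = (y : ℝ) ^ c) :
    ν = ENNReal.ofReal (c ^ γ) • ν.map φ +
      ENNReal.ofReal (1 - c ^ γ) • (ν.prod ν).map (fun z => φ z.1 * z.2) := by
  have hcγ0 : 0 < c ^ γ := Real.rpow_pos_of_pos hc.1 _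
  have hcγ1 : c ^ γ < 1 := Real.rpow_lt_one hc.1.le hc.2 hγ
  have hm : Measurable fun z : Icc (0 : ℝ) 1 × Icc (0 : ℝ) 1 => φ z.1 * z.2 :=
    (hφc.comp measurable_fst).mul measurable_snd
  have := Measure.isProbabilityMeasure_map (μ := ν) hφc.aemeasurable
  have := Measure.isProbabilityMeasure_map (μ := ν.prod ν) hm.aemeasurable
  have hf1 : IsFiniteMeasure (ENNReal.ofReal (c ^ γ) • ν.map φ) :=
    Measure.smul_finite _ ENNReal.ofReal_ne_top
  have hf2 : IsFiniteMeasure (ENNReal.ofReal (1 - c ^ γ) •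
      (ν.prod ν).map (fun z => φ z.1 * z.2)) :=
    Measure.smul_finite _ ENNReal.ofReal_ne_top
  refine measure_ext_of_moments fun n => ?_
  have hi : ∀ (κ : Measure (Icc (0 : ℝ) 1)) [IsFiniteMeasure κ],
      Integrable (fun y : Icc (0 : ℝ) 1 => (y : ℝ) ^ n) κ := fun κ _ => by
    simpa using integrable_coe_rpow κ (lam := n) n.cast_nonneg
  have hmeas : Measurable fun y : Icc (0 : ℝ) 1 => (y : ℝ) ^ n := by fun_prop
  rw [integral_add_measure (hi _) (hi _), integral_smul_measure, integral_smul_measure,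
    integral_map hφc.aemeasurable hmeas.aestronglyMeasurable,
    integral_map hm.aemeasurable hmeas.aestronglyMeasurable,
    ENNReal.toReal_ofReal hcγ0.le, ENNReal.toReal_ofReal (by linarith)]
  rcases Nat.eq_zero_or_pos n with rfl | hn
  · simp
  · have hn' : (0 : ℝ) < n := by exact_mod_cast hn
    have h1 : ∫ y, (φ y : ℝ) ^ n ∂ν = 1 / (1 + (c * n) ^ γ) := by
      rw [← hν (c * n) (mul_pos hc.1 hn')]
      refine integral_congr_ae (ae_of_all _ fun y => ?_)
      simp only [hφ]
      rw [Real.rpow_mul y.2.1, Real.rpow_natCast]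
    have h2 : ∫ y : Icc (0 : ℝ) 1, (y : ℝ) ^ n ∂ν = 1 / (1 + (n : ℝ) ^ γ) := by
      rw [← hν n hn']; simp
    have h3 : ∫ z : Icc (0 : ℝ) 1 × Icc (0 : ℝ) 1, ((φ z.1 * z.2 : Icc (0 : ℝ) 1) : ℝ) ^ n
        ∂(ν.prod ν) = 1 / (1 + (c * n) ^ γ) * (1 / (1 + (n : ℝ) ^ γ)) := by
      rw [← h1, ← h2, ← integral_prod_mul]
      refine integral_congr_ae (ae_of_all _ fun z => ?_)
      simp [mul_pow]
    -- With x = n^γ and d = c^γ the identity is 1/(1+x) = d/(1+dx) + (1-d)/((1+dx)(1+x)).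
    rw [h1, h2, h3, Real.mul_rpow hc.1.le hn'.le, smul_eq_mul, smul_eq_mul]
    have := Real.rpow_pos_of_pos hn' γ
    have h4 : 0 < 1 + c ^ γ * (n : ℝ) ^ γ := by positivity
    field_simp
    ring

/-- An atom at 1 would keep the moments away from 0 as λ → ∞, and one at 0 would keep them away from
1 as λ → 0. For y in between, the mixture gives ν{y} ≤ c^γ ν{y^(1/c)} + 1 - c^γ. If ν{y} > 0, then
for all c in an interval below 1 the point y^(1/c) is an atom, and a finite measure has only
countably many. -/
lemma measure_singleton_eq_zero (hγ : 0 < γ)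
    (hν : ∀ lam : ℝ, 0 < lam → ∫ y, (y : ℝ) ^ lam ∂ν = 1 / (1 + lam ^ γ)) (y : Icc (0 : ℝ) 1) :
    ν {y} = 0 := by
  have hreal : ∀ (z : Icc (0 : ℝ) 1) (lam : ℝ), 0 < lam →
      ν.real {z} * (z : ℝ) ^ lam ≤ 1 / (1 + lam ^ γ) := by
    intro z lam hlam
    rw [← hν lam hlam]
    have h1 : ∫ y in {z}, (y : ℝ) ^ lam ∂ν = ν.real {z} * (z : ℝ) ^ lam := by
      rw [integral_singleton, smul_eq_mul]
    rw [← h1]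
    exact setIntegral_le_integral (integrable_coe_rpow ν hlam.le)
      (ae_of_all _ fun y => Real.rpow_nonneg y.2.1 _)
  have hrpow : Tendsto (fun lam : ℝ => 1 / (1 + lam ^ γ)) atTop (𝓝 0) := by
    have : Tendsto (fun lam : ℝ => 1 + lam ^ γ) atTop atTop :=
      tendsto_atTop_add_const_left _ _ (tendsto_rpow_atTop hγ)
    exact this.inv_tendsto_atTop.congr fun x => by simp
  have hone : ν {1} = 0 := by
    have : ν.real {1} ≤ 0 := by
      refine ge_of_tendsto hrpow ?_
      filter_upwards [eventually_gt_atTop 0] with lam hlam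
      simpa using hreal 1 lam hlam
    exact (measureReal_eq_zero_iff).1 (le_antisymm this measureReal_nonneg)
  have hzero : ν {0} = 0 := by
    have h1 : ∀ lam : ℝ, 0 < lam → ν.real {0} ≤ 1 - 1 / (1 + lam ^ γ) := by
      intro lam hlam
      have h2 : ∫ y, ((1 : ℝ) - (y : ℝ) ^ lam) ∂ν = 1 - 1 / (1 + lam ^ γ) := by
        rw [integral_sub (integrable_const _) (integrable_coe_rpow ν hlam.le), hν lam hlam]
        simp
      rw [← h2]
      have h3 : ∫ y in {(0 : Icc (0 : ℝ) 1)}, ((1 : ℝ) - (y : ℝ) ^ lam) ∂ν = ν.real {0} := by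
        rw [integral_singleton, smul_eq_mul]
        simp [Real.zero_rpow hlam.ne']
      rw [← h3]
      exact setIntegral_le_integral ((integrable_const _).sub (integrable_coe_rpow ν hlam.le))
        (ae_of_all _ fun y => sub_nonneg.2 (Real.rpow_le_one y.2.1 y.2.2 hlam.le))
    have h4 : Tendsto (fun lam : ℝ => 1 - 1 / (1 + lam ^ γ)) (𝓝[>] 0) (𝓝 0) := by
      have h5 : ContinuousAt (fun lam : ℝ => 1 - 1 / (1 + lam ^ γ)) 0 := by
        have h6 : ContinuousAt (fun lam : ℝ => lam ^ γ) 0 :=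
          Real.continuousAt_rpow_const _ _ (Or.inr hγ.le)
        refine continuousAt_const.sub (continuousAt_const.div (continuousAt_const.add h6) ?_)
        simp [Real.zero_rpow hγ.ne']
      have := h5.tendsto
      simp only [Real.zero_rpow hγ.ne', add_zero, div_one, sub_self] at this
      exact tendsto_nhdsWithin_of_tendsto_nhds this
    have : ν.real {0} ≤ 0 := ge_of_tendsto h4 (eventually_nhdsWithin_of_forall fun l hl => h1 l hl)
    exact (measureReal_eq_zero_iff).1 (le_antisymm this measureReal_nonneg)
  by_cases hy0 : y = 0
  · rwa [hy0]
  by_cases hy1 : y = 1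
  · rwa [hy1]
  have hyp : (0 : ℝ) < y := lt_of_le_of_ne y.2.1 fun h => hy0 (Subtype.ext h.symm)
  have hyl : (y : ℝ) < 1 := lt_of_le_of_ne y.2.2 fun h => hy1 (Subtype.ext h)
  by_contra hne
  have hm : 0 < ν.real {y} := lt_of_le_of_ne measureReal_nonneg fun h =>
    hne ((measureReal_eq_zero_iff).1 h.symm)
  set ψ : ℝ → Icc (0 : ℝ) 1 := fun d => projIcc 0 1 zero_le_one ((y : ℝ) ^ d) with hψ
  have hψv : ∀ d, 0 ≤ d → (ψ d : ℝ) = (y : ℝ) ^ d := fun d hd => by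
    simp only [hψ]
    rw [projIcc_of_mem zero_le_one ⟨Real.rpow_nonneg y.2.1 _, Real.rpow_le_one y.2.1 y.2.2 hd⟩]
  -- The atom at `y` propagates to the points `y ^ (1 / c)`.
  have hstep : ∀ c ∈ Ioo (0 : ℝ) 1, ν.real {y} ≤ c ^ γ * ν.real {ψ (1 / c)} + (1 - c ^ γ) := by
    intro c hc
    set φ : Icc (0 : ℝ) 1 → Icc (0 : ℝ) 1 := fun z =>
      ⟨(z : ℝ) ^ c, Real.rpow_nonneg z.2.1 _, Real.rpow_le_one z.2.1 z.2.2 hc.1.le⟩ with hφ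
    have hφm : Measurable φ := ((continuous_coe_rpow hc.1.le).subtype_mk _).measurable
    have hmix := eq_mixture hγ hν hc hφm fun z => rfl
    have hcγ1 : c ^ γ < 1 := Real.rpow_lt_one hc.1.le hc.2 hγ
    have hpm : Measurable fun z : Icc (0 : ℝ) 1 × Icc (0 : ℝ) 1 => φ z.1 * z.2 :=
      (hφm.comp measurable_fst).mul measurable_snd
    have := Measure.isProbabilityMeasure_map (μ := ν.prod ν) hpm.aemeasurable
    have h1 : ν {y} = ENNReal.ofReal (c ^ γ) * ν.map φ {y} + ENNReal.ofReal (1 - c ^ γ) *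
        (ν.prod ν).map (fun z => φ z.1 * z.2) {y} := by
      conv_lhs => rw [hmix]
      simp
    have hpre : φ ⁻¹' {y} = {ψ (1 / c)} := by
      ext z
      simp only [mem_preimage, mem_singleton_iff, hφ, Subtype.ext_iff]
      rw [hψv _ (by have := hc.1; positivity)]
      constructor
      · intro h
        rw [← h, ← Real.rpow_mul z.2.1, mul_one_div_cancel hc.1.ne', Real.rpow_one]
      · intro h
        rw [h, ← Real.rpow_mul y.2.1, one_div_mul_cancel hc.1.ne', Real.rpow_one]
    rw [Measure.map_apply hφm (measurableSet_singleton _), hpre] at h1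
    have h2 : ν {y} ≤ ENNReal.ofReal (c ^ γ) * ν {ψ (1 / c)} + ENNReal.ofReal (1 - c ^ γ) := by
      rw [h1]
      gcongr
      exact mul_le_of_le_one_right' prob_le_one
    have h3 := ENNReal.toReal_mono (by finiteness) h2
    rw [ENNReal.toReal_add (by finiteness) (by finiteness), ENNReal.toReal_mul,
      ENNReal.toReal_ofReal (Real.rpow_nonneg hc.1.le _),
      ENNReal.toReal_ofReal (by linarith)] at h3
    exact h3
  have hcont : Tendsto (fun c : ℝ => 1 - c ^ γ) (𝓝 1) (𝓝 0) := by
    have : ContinuousAt (fun c : ℝ => 1 - c ^ γ) 1 :=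
      continuousAt_const.sub (Real.continuousAt_rpow_const _ _ (Or.inl one_ne_zero))
    simpa using this.tendsto
  obtain ⟨l, u, ⟨hl, hu⟩, hlu⟩ := mem_nhds_iff_exists_Ioo_subset.1
    (hcont.eventually (gt_mem_nhds hm))
  set c₀ := max l (1 / 2) with hc₀
  have hc₀1 : c₀ < 1 := max_lt hl (by norm_num)
  have hpos : ∀ c ∈ Ioo c₀ 1, 0 < ν {ψ (1 / c)} := by
    intro c hc
    have hc0 : 0 < c := lt_trans (by norm_num) ((le_max_right l (1 / 2)).trans_lt hc.1)
    have h1 := hstep c ⟨hc0, hc.2⟩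
    have h2 : 1 - c ^ γ < ν.real {y} :=
      hlu ⟨(le_max_left _ _).trans_lt hc.1, hc.2.trans hu⟩
    have h3 : 0 < c ^ γ * ν.real {ψ (1 / c)} := by linarith
    have h4 : 0 < ν.real {ψ (1 / c)} := pos_of_mul_pos_right h3 (Real.rpow_nonneg hc0.le _)
    exact pos_iff_ne_zero.2 fun h => h4.ne' (by rw [measureReal_def, h, ENNReal.toReal_zero])
  have hcount : {z : Icc (0 : ℝ) 1 | 0 < ν {z}}.Countable :=
    Measure.countable_meas_pos_of_disjoint_iUnion (μ := ν)
      (As := fun z : Icc (0 : ℝ) 1 => {z}) (fun z => measurableSet_singleton z)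
      fun z w hzw => by simpa [Function.onFun] using hzw
  have hinj : InjOn (fun c : ℝ => ψ (1 / c)) (Ioo c₀ 1) := by
    intro c hc d hd hcd
    have hc0 : 0 < c := lt_trans (by norm_num) ((le_max_right l (1 / 2)).trans_lt hc.1)
    have hd0 : 0 < d := lt_trans (by norm_num) ((le_max_right l (1 / 2)).trans_lt hd.1)
    have h1 := congrArg Subtype.val hcd
    simp only at h1
    rw [hψv _ (by positivity), hψv _ (by positivity)] at h1
    have h2 := (Real.strictAnti_rpow_of_base_lt_one hyp hyl).injective h1
    simpa using h2
  have := MapsTo.countable_of_injOn (t := {z | 0 < ν {z}}) hpos hinj hcount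
  exact Cardinal.Real.Ioo_countable_iff.not.2 (not_le.2 hc₀1) this

end linnik

lemma limit_laplace_eq {γ lam : ℝ} (hγ : 0 < γ) (hlam : 0 < lam) :
    1 - lam ^ γ / (1 + lam ^ γ) ^ (γ / γ) = 1 / (1 + lam ^ γ) := by
  have := Real.rpow_pos_of_pos hlam γ
  rw [div_self hγ.ne', Real.rpow_one]
  field_simp
  ring

/-- The law on `[0, ∞)` whose image under `x ↦ exp (-x)` has given moments. -/
lemma isLimitLaw_map_neg_log {γ : ℝ} (hγ : 0 < γ) {ν : Measure (Icc (0 : ℝ) 1)}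
    [IsProbabilityMeasure ν]
    (hν : ∀ lam : ℝ, 0 < lam → ∫ y, (y : ℝ) ^ lam ∂ν = 1 / (1 + lam ^ γ)) :
    IsLimitLaw γ γ (ν.map fun y : Icc (0 : ℝ) 1 => -Real.log (y : ℝ)) := by
  have hm : Measurable fun y : Icc (0 : ℝ) 1 => -Real.log y :=
    (Real.measurable_log.comp measurable_subtype_coe).neg
  refine ⟨Measure.isProbabilityMeasure_map hm.aemeasurable, ?_, fun lam hlam => ?_⟩
  · rw [Measure.map_apply hm measurableSet_Iio]
    convert measure_empty (μ := ν)
    ext y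
    simp only [mem_preimage, mem_Iio, mem_empty_iff_false, iff_false, not_lt]
    linarith [Real.log_nonpos y.2.1 y.2.2]
  · rw [integral_map hm.aemeasurable
      (by fun_prop : Measurable fun x : ℝ => Real.exp (-lam * x)).aestronglyMeasurable, limit_laplace_eq hγ hlam, ← hν lam hlam]
    refine integral_congr_ae ?_
    -- The convention log 0 = 0 sends the point 0, which stands for infinity, to 0; it has to carry
    -- no mass.
    have h0 : ∀ᵐ y ∂ν, y ≠ 0 := by
      rw [ae_iff]
      simpa using measure_singleton_eq_zero hγ hν 0
    filter_upwards [h0] with y hy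
    have hyp : (0 : ℝ) < y := lt_of_le_of_ne y.2.1 fun h => hy (Subtype.ext h.symm)
    rw [Real.rpow_def_of_pos hyp]
    congr 1
    ring

/-- Continuity theorem for the law with Laplace transform `1 / (1 + lam ^ γ)`. -/
lemma exists_isLimitLaw_of_laplace {Ω : Type*} [MeasurableSpace Ω] {γ : ℝ} (hγ : 0 < γ)
    {Pt : ℝ → Measure Ω} (hPt : ∀ᶠ t in atTop, IsProbabilityMeasure (Pt t)) {Z : ℝ → Ω → ℝ}
    (hZm : ∀ t, Measurable (Z t)) (hZ0 : ∀ᶠ t in atTop, ∀ ω, 0 ≤ Z t ω)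
    (h : ∀ lam : ℝ, 0 < lam → Tendsto (fun t => ∫ ω, Real.exp (-lam * Z t ω) ∂Pt t) atTop
      (𝓝 (1 - lam ^ γ / (1 + lam ^ γ) ^ (γ / γ)))) :
    ∃ D : Measure ℝ, IsLimitLaw γ γ D ∧ ∀ x : ℝ, 0 ≤ x →
      Tendsto (fun t => (Pt t).real {ω | Z t ω ≤ x}) atTop (𝓝 (D.real (Iic x))) := by
  classical
  set g : ℝ → Ω → Icc (0 : ℝ) 1 := fun t ω => projIcc 0 1 zero_le_one (Real.exp (-Z t ω)) with hg
  have hgm : ∀ t, Measurable (g t) := fun t =>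
    continuous_projIcc.measurable.comp (Real.measurable_exp.comp (hZm t).neg)
  -- The Dirac mass is a default for the values of t, absent for large t, at which `Pt t` is not a
  -- probability measure.
  set ν : ℝ → ProbabilityMeasure (Icc (0 : ℝ) 1) := fun t =>
    if ht : IsProbabilityMeasure (Pt t) then
      ⟨(Pt t).map (g t), Measure.isProbabilityMeasure_map (hgm t).aemeasurable⟩
    else ⟨Measure.dirac 0, inferInstance⟩ with hν
  have hνt : ∀ t, IsProbabilityMeasure (Pt t) →
      (ν t : Measure (Icc (0 : ℝ) 1)) = (Pt t).map (g t) := fun t ht => by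
    have : ν t = ⟨(Pt t).map (g t), Measure.isProbabilityMeasure_map (hgm t).aemeasurable⟩ :=
      dif_pos ht
    rw [this]
    rfl
  have hgv : ∀ t ω, 0 ≤ Z t ω → (g t ω : ℝ) = Real.exp (-Z t ω) := fun t ω h0 => by
    simp only [hg]
    rw [projIcc_of_mem zero_le_one ⟨(Real.exp_pos _).le, Real.exp_le_one_iff.2 (by linarith)⟩]
  obtain ⟨ν₀, hlim, hmom⟩ := exists_tendsto_of_moments (f := atTop) ν
    (Φ := fun lam => 1 / (1 + lam ^ γ)) (by
      intro lam hlam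
      have h1 := h lam hlam
      rw [limit_laplace_eq hγ hlam] at h1
      refine h1.congr' ?_
      filter_upwards [hPt, hZ0] with t ht h0
      rw [hνt t ht, integral_map (hgm t).aemeasurable
        (continuous_coe_rpow hlam.le).aestronglyMeasurable]
      refine integral_congr_ae (ae_of_all _ fun ω => ?_)
      simp only
      rw [hgv t ω (h0 ω), ← Real.exp_mul]
      congr 1
      ring)
  refine ⟨_, isLimitLaw_map_neg_log hγ hmom, fun x hx => ?_⟩
  have hm : Measurable fun y : Icc (0 : ℝ) 1 => -Real.log y :=
    (Real.measurable_log.comp measurable_subtype_coe).neg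
  set E : Set (Icc (0 : ℝ) 1) := {y | Real.exp (-x) ≤ y} with hE
  have hEm : MeasurableSet E := measurableSet_le measurable_const measurable_subtype_coe
  -- The frontier is at most the single point exp(-x), so the absence of atoms makes every x ≥ 0 a
  -- continuity point.
  have hfr : (ν₀ : Measure (Icc (0 : ℝ) 1)) (frontier E) = 0 := by
    have hxm : Real.exp (-x) ∈ Icc (0 : ℝ) 1 :=
      ⟨(Real.exp_pos _).le, Real.exp_le_one_iff.2 (by linarith)⟩
    refine measure_mono_null ?_ (measure_singleton_eq_zero hγ hmom ⟨Real.exp (-x), hxm⟩)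
    refine (frontier_le_subset_eq continuous_const continuous_subtype_val).trans fun y hy => ?_
    exact Subtype.ext (Eq.symm hy)
  have hconv := (ENNReal.tendsto_toReal (measure_ne_top _ _)).comp
    (ProbabilityMeasure.tendsto_measure_of_null_frontier_of_tendsto' hlim hfr)
  have hD : ((ν₀ : Measure (Icc (0 : ℝ) 1)).map
      fun y : Icc (0 : ℝ) 1 => -Real.log (y : ℝ)).real (Iic x) =
      ((ν₀ : Measure (Icc (0 : ℝ) 1)) E).toReal := by
    rw [measureReal_def, Measure.map_apply hm measurableSet_Iic]
    congr 1
    refine measure_congr ?_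
    have h0 : ∀ᵐ y ∂(ν₀ : Measure (Icc (0 : ℝ) 1)), y ≠ 0 := by
      rw [ae_iff]
      simpa using measure_singleton_eq_zero hγ hmom 0
    filter_upwards [h0] with y hy
    have hyp : (0 : ℝ) < y := lt_of_le_of_ne y.2.1 fun h => hy (Subtype.ext h.symm)
    refine propext ?_
    change -Real.log y ≤ x ↔ Real.exp (-x) ≤ y
    rw [neg_le, Real.le_log_iff_exp_le hyp]
  rw [hD]
  refine hconv.congr' ?_
  filter_upwards [hPt, hZ0] with t ht h0
  simp only [Function.comp]
  rw [hνt t ht, Measure.map_apply (hgm t) hEm, measureReal_def]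
  congr 2
  ext ω
  simp only [mem_preimage, hE, mem_ofPred_eq, hgv t ω (h0 ω), Real.exp_le_exp, neg_le_neg_iff]

/-! ### Composition of regularly varying functions -/

namespace RegVar

variable {b w : ℝ → ℝ} {ρ κ : ℝ}

lemma of_tendsto_ratio (hpos : ∀ᶠ x in atTop, 0 < b x)
    (h : ∀ (x y : ℝ × ℝ → ℝ) (f : Filter (ℝ × ℝ)) (k : ℝ), 0 < k → Tendsto y f atTop →
      Tendsto (fun i => x i / y i) f (𝓝 k) →
      Tendsto (fun i => b (x i) / b (y i)) f (𝓝 (k ^ (-ρ)))) : RegVar b ρ := by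
  refine ⟨hpos, fun k hk => h (fun z => z.1 * z.2) Prod.snd _ k hk tendsto_snd ?_⟩
  refine (tendsto_fst (f := 𝓝 k) (g := atTop)).congr' ?_
  filter_upwards [tendsto_snd.eventually_gt_atTop 0] with z hz
  exact (mul_div_cancel_right₀ _ hz.ne').symm

/-- In the sign convention of `RegVar` the inner function grows with index κ, and the indices
multiply. -/
lemma comp (h : RegVar b ρ) (hw : RegVar w (-κ)) (hlim : Tendsto w atTop atTop) :
    RegVar (fun x => b (w x)) (ρ * κ) := by
  refine of_tendsto_ratio (hlim.eventually h.pos) fun x y f k hk hy hxy => ?_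
  have h1 := hw.tendsto_ratio hk hy hxy
  rw [neg_neg] at h1
  have h2 := h.tendsto_ratio (Real.rpow_pos_of_pos hk κ) (hlim.comp hy) h1
  rwa [← Real.rpow_mul hk.le, mul_neg, mul_comm κ] at h2

lemma affine {m : ℝ} (hm : 0 < m) (v : ℝ) : RegVar (fun x => m * x + v) (-1) := by
  have hlim : Tendsto (fun x => m * x + v) atTop atTop :=
    tendsto_atTop_add_const_right _ _ (tendsto_id.const_mul_atTop hm)
  refine of_tendsto_ratio (hlim.eventually_gt_atTop 0) fun x y f k hk hy hxy => ?_
  rw [neg_neg, Real.rpow_one]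
  have h0 : Tendsto (fun i => v / y i) f (𝓝 0) := hy.const_div_atTop v
  have h1 := ((hxy.const_mul m).add h0).div ((h0.const_add m)) (by simpa using hm.ne')
  rw [add_zero, add_zero, mul_div_cancel_left₀ _ hm.ne'] at h1
  refine h1.congr' ?_
  filter_upwards [hy.eventually_gt_atTop 0] with i hi
  simp only [Pi.div_apply]
  have : m * x i + v = (m * (x i / y i) + v / y i) * y i := by field_simp
  rw [this, show m * y i + v = (m + v / y i) * y i by field_simp, mul_div_mul_right _ _ hi.ne']

end RegVar

/-! ### Regular variation of V, W and q -/

section asymptotics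

variable {p im : PMF ℕ} {α γ : ℝ} {L l : ℝ → ℝ}

/-- L is positive only near infinity, which gives f(s) > s near s = 1; convexity extends this to all
of [0, 1). -/
lemma lt_pgf_of_slowlyVarying (hL : IsSlowlyVarying L) (hf : ∀ s ∈ Ico (0 : ℝ) 1,
    pgf p s = s + (1 - s) ^ (γ + 1) * L (1 / (1 - s))) : ∀ s ∈ Ico (0 : ℝ) 1, s < pgf p s := by
  obtain ⟨⟨X, -, hX⟩, -⟩ := hL
  intro s hs
  have hX1 : 0 < max X 1 := lt_of_lt_of_le one_pos (le_max_right _ _)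
  refine lt_pgf p (s₀ := 1 - 1 / max X 1) (fun s hs => ?_) (by
    have := one_div_pos.2 hX1; linarith) hs
  have hs0 := (one_sub_inv_mem (le_max_right X 1)).1.trans hs.1
  rw [hf s ⟨hs0, hs.2⟩]
  have h1 : 0 < 1 - s := by linarith [hs.2]
  have h2 : X ≤ 1 / (1 - s) := by
    refine (le_max_left X 1).trans ?_
    rw [le_one_div hX1 h1]
    linarith [hs.1]
  have := mul_pos (Real.rpow_pos_of_pos h1 (γ + 1)) (hX _ h2)
  linarith

lemma kern_eq_rpow_div (hf : ∀ s ∈ Ico (0 : ℝ) 1,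
    pgf p s = s + (1 - s) ^ (γ + 1) * L (1 / (1 - s))) {y : ℝ} (hy : 1 ≤ y) :
    kern p y = y ^ (γ - 1) / L y := by
  have hy0 : 0 < y := by linarith
  rw [kern_of_le hy, hf _ (one_sub_inv_mem hy), add_sub_cancel_left, sub_sub_cancel,
    one_div_one_div, one_div y, Real.inv_rpow hy0.le, ← mul_assoc, ← div_div]
  congr 1
  rw [← Real.rpow_natCast, ← Real.rpow_neg hy0.le, ← Real.rpow_add hy0, one_div,
    ← Real.rpow_neg hy0.le]
  congr 1
  push_cast
  ring

/-- The integrand of V is y^(γ-1)/L(y), of index γ - 1, and V tends to infinity, so Karamata's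
theorem raises the index by 1. -/
lemma tendsto_V_ratio (hL : IsSlowlyVarying L) (hf : ∀ s ∈ Ico (0 : ℝ) 1,
    pgf p s = s + (1 - s) ^ (γ + 1) * L (1 / (1 - s))) {c : ℝ} (hc : 0 < c) :
    Tendsto (fun x => V p (c * x) / V p x) atTop (𝓝 (c ^ γ)) := by
  have hp := lt_pgf_of_slowlyVarying hL hf
  have hcx : ∀ᶠ x in atTop, 1 ≤ c * x :=
    (tendsto_id.const_mul_atTop hc).eventually_ge_atTop 1
  have h := tendsto_integral_ratio (b := kern p) (x₀ := 1) (σ := 1 - γ) hc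
    (fun x _ => (continuous_kern hp).intervalIntegrable _ _)
    (Eventually.of_forall (kern_pos hp)) ?_ ?_
  · rw [sub_sub_cancel] at h
    refine h.congr' ?_
    filter_upwards [eventually_ge_atTop 1, hcx] with x h1 h2
    rw [V_eq hp h1, V_eq hp h2]
  · have h1 := ((hL.2 c hc).inv₀ one_ne_zero).const_mul (c ^ (γ - 1))
    rw [inv_one, mul_one, ← neg_sub 1 γ] at h1
    refine h1.congr' ?_
    filter_upwards [eventually_ge_atTop 1, hcx] with x h1 h2
    have hx0 : 0 < x := by linarith
    have := (Real.rpow_pos_of_pos hx0 (γ - 1)).ne'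
    rw [kern_eq_rpow_div hf h1, kern_eq_rpow_div hf h2, Real.mul_rpow hc.le hx0.le, neg_sub, inv_div]
    field_simp
  · refine (tendsto_V hp).congr' ?_
    filter_upwards [eventually_ge_atTop 1] with x h1 using V_eq hp h1

/-- Inversion of V: for c below or above k^(1/γ), V(c W(y))/y tends to c^γ, which lies below or
above k, and `W_lt_iff` turns this comparison into one between W(x) and c W(y). -/
lemma regVar_W (hγ : 0 < γ) (hL : IsSlowlyVarying L) (hf : ∀ s ∈ Ico (0 : ℝ) 1,
    pgf p s = s + (1 - s) ^ (γ + 1) * L (1 / (1 - s))) : RegVar (W p) (-γ⁻¹) := by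
  have hp := lt_pgf_of_slowlyVarying hL hf
  have hW := tendsto_W hp
  refine RegVar.of_tendsto_ratio (hW.eventually_gt_atTop 0) fun x y f k hk hy hxy => ?_
  rw [neg_neg]
  have hx : Tendsto x f atTop := by
    refine (hxy.pos_mul_atTop hk hy).congr' ?_
    filter_upwards [hy.eventually_gt_atTop 0] with i hi using div_mul_cancel₀ _ hi.ne'
  have hWy := hW.comp hy
  have hV : ∀ c : ℝ, 0 < c → Tendsto (fun i => V p (c * W p (y i)) / y i) f (𝓝 (c ^ γ)) :=
    fun c hc => by
      refine ((tendsto_V_ratio hL hf hc).comp hWy).congr' ?_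
      filter_upwards [hy.eventually_ge_atTop 0] with i hi
      simp only [Function.comp, V_W hp hi]
  have hk' : 0 < k ^ γ⁻¹ := Real.rpow_pos_of_pos hk _
  have hkk : (k ^ γ⁻¹) ^ γ = k := Real.rpow_inv_rpow hk.le hγ.ne'
  refine tendsto_order.2 ⟨fun a ha => ?_, fun a ha => ?_⟩
  · obtain ⟨c, hc, hck⟩ := exists_between (max_lt ha hk')
    have hc0 : 0 < c := (le_max_right _ _).trans_lt hc
    have hlt : c ^ γ < k := by
      rw [← hkk]; exact Real.rpow_lt_rpow hc0.le hck hγ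
    filter_upwards [(hV c hc0).eventually_lt hxy hlt, hy.eventually_gt_atTop 0,
      hx.eventually_ge_atTop 0, (hWy.const_mul_atTop hc0).eventually_ge_atTop 1,
      hWy.eventually_gt_atTop 0] with i h1 h2 h3 h4 h5
    simp only [Function.comp] at h4 h5
    refine ((le_max_left _ _).trans_lt hc).trans_le ?_
    rw [le_div_iff₀ h5, ← not_lt, W_lt_iff hp h4 h3, not_lt]
    exact ((div_lt_div_iff_of_pos_right h2).1 h1).le
  · have hc0 : 0 < a := hk'.trans ha
    have hlt : k < a ^ γ := by
      rw [← hkk]; exact Real.rpow_lt_rpow hk'.le ha hγ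
    filter_upwards [hxy.eventually_lt (hV a hc0) hlt, hy.eventually_gt_atTop 0,
      hx.eventually_ge_atTop 0, (hWy.const_mul_atTop hc0).eventually_ge_atTop 1,
      hWy.eventually_gt_atTop 0] with i h1 h2 h3 h4 h5
    simp only [Function.comp] at h4 h5
    rw [div_lt_iff₀ h5, W_lt_iff hp h4 h3]
    exact (div_lt_div_iff_of_pos_right h2).1 h1

/-- `1 - g (1 - 1 / W)`, so that `q mu p im u s = qAux p im (mu * u + V p (1 / (1 - s)))`. -/
noncomputable def qAux (p im : PMF ℕ) (y : ℝ) : ℝ := 1 - pgf im (1 - 1 / W p y)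

lemma regVar_qAux (hγ : 0 < γ) (hL : IsSlowlyVarying L) (hl : IsSlowlyVarying l)
    (hf : ∀ s ∈ Ico (0 : ℝ) 1, pgf p s = s + (1 - s) ^ (γ + 1) * L (1 / (1 - s)))
    (hg : ∀ s ∈ Ico (0 : ℝ) 1, pgf im s = 1 - (1 - s) ^ α * l (1 / (1 - s))) :
    RegVar (qAux p im) (α / γ) := by
  have h1 : RegVar (fun x => 1 - pgf im (1 - 1 / x)) α := by
    have := (RegVar.rpow_neg α).mul hl.regVar
    rw [add_zero] at this
    refine this.congr (x₀ := 1) fun x hx => ?_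
    rw [hg _ (one_sub_inv_mem hx.le), sub_sub_cancel, sub_sub_cancel, one_div_one_div, one_div,
      Real.inv_rpow (by linarith), Real.rpow_neg (by linarith)]
  exact h1.comp (regVar_W hγ hL hf) (tendsto_W (lt_pgf_of_slowlyVarying hL hf))

lemma antitoneOn_qAux (hp : ∀ s ∈ Ico (0 : ℝ) 1, s < pgf p s) :
    AntitoneOn (qAux p im) (Ici 0) := by
  intro x hx y hy hxy
  have h1 := one_le_W hp hx
  have h2 := one_le_W hp hy
  have h3 := (strictMonoOn_W hp).monotoneOn hx hy hxy
  refine sub_le_sub_left (pgf_mono im (Ico_subset_Icc_self (one_sub_inv_mem h1))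
    (Ico_subset_Icc_self (one_sub_inv_mem h2)) ?_) _
  have := one_div_le_one_div_of_le (by linarith) h3
  linarith

variable (mu : ℝ) [Fact (0 < mu)]

lemma q_eq_qAux (hp : ∀ s ∈ Ico (0 : ℝ) 1, s < pgf p s) {s u : ℝ} (hs : s ∈ Ico (0 : ℝ) 1)
    (hu : 0 ≤ u) : q mu p im u s = qAux p im (mu * u + V p (1 / (1 - s))) := by
  rw [q, branchingPgf_eq mu hp hs hu, qAux]

lemma regVar_q (hγ : 0 < γ) (hL : IsSlowlyVarying L) (hl : IsSlowlyVarying l)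
    (hf : ∀ s ∈ Ico (0 : ℝ) 1, pgf p s = s + (1 - s) ^ (γ + 1) * L (1 / (1 - s)))
    (hg : ∀ s ∈ Ico (0 : ℝ) 1, pgf im s = 1 - (1 - s) ^ α * l (1 / (1 - s)))
    {s : ℝ} (hs : s ∈ Ico (0 : ℝ) 1) : RegVar (fun u => q mu p im u s) (α / γ) := by
  have hmu : 0 < mu := Fact.out
  have := (regVar_qAux hγ hL hl hf hg).comp (RegVar.affine hmu (V p (1 / (1 - s))))
    (tendsto_atTop_add_const_right _ _ (tendsto_id.const_mul_atTop hmu))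
  rw [mul_one] at this
  exact this.congr (x₀ := 0) fun u hu =>
    q_eq_qAux mu (lt_pgf_of_slowlyVarying hL hf) hs hu.le

lemma q_nonneg {s : ℝ} (hs : s ∈ Icc (0 : ℝ) 1) (u : ℝ) : 0 ≤ q mu p im u s := by
  linarith [(one_sub_q_mem (mu := mu) (p := p) (im := im) hs u).2]

lemma q_le_one {s : ℝ} (hs : s ∈ Icc (0 : ℝ) 1) (u : ℝ) : q mu p im u s ≤ 1 := by
  linarith [(one_sub_q_mem (mu := mu) (p := p) (im := im) hs u).1]

lemma q_one (u : ℝ) : q mu p im u 1 = 0 := by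
  rw [q, branchingPgf_one, pgf_one, sub_self]

lemma intervalIntegrable_mul_q {r : ℝ → ℝ} {s t : ℝ} (hs : s ∈ Icc (0 : ℝ) 1)
    (hr : IntervalIntegrable r volume 0 t) {φ : ℝ → ℝ} (hφ : Measurable φ) :
    IntervalIntegrable (fun v => r v * q mu p im (φ v) s) volume 0 t := by
  have hm : AEStronglyMeasurable (fun v => q mu p im (φ v) s) volume :=
    ((measurable_q hs).comp hφ).aestronglyMeasurable
  have hb : ∀ v, ‖q mu p im (φ v) s‖ ≤ 1 := fun v => by
    rw [Real.norm_of_nonneg (q_nonneg mu hs _)]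
    exact q_le_one mu hs _
  exact ⟨hr.1.mul_bdd hm.restrict (ae_of_all _ hb), hr.2.mul_bdd hm.restrict (ae_of_all _ hb)⟩

lemma intervalIntegrable_q {s : ℝ} (hs : s ∈ Icc (0 : ℝ) 1) (t : ℝ) :
    IntervalIntegrable (fun u => q mu p im u s) volume 0 t := by
  simpa using intervalIntegrable_mul_q mu (p := p) (im := im) (r := fun _ => 1) (t := t) hs
    intervalIntegrable_const measurable_id

end asymptotics

/-! ### Conditioning on a positive population -/

section conditioning

variable {Ω : Type*} [MeasurableSpace Ω] {P : Measure Ω} [IsProbabilityMeasure P]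

lemma measureReal_pos_eq {N : Ω → ℕ} (hN : Measurable N) :
    P.real {ω | 0 < N ω} = 1 - ∫ ω, (0 : ℝ) ^ N ω ∂P := by
  have hA : MeasurableSet {ω | 0 < N ω} := measurableSet_lt measurable_const hN
  have h : ∫ ω, (0 : ℝ) ^ N ω ∂P = P.real {ω | 0 < N ω}ᶜ := by
    rw [← integral_indicator_one hA.compl]
    refine integral_congr_ae (ae_of_all _ fun ω => ?_)
    rcases Nat.eq_zero_or_pos (N ω) with h | h
    · simp [h]
    · simp [h, h.ne']
  rw [h, probReal_compl_eq_one_sub hA, sub_sub_cancel]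

lemma integral_cond_pos {N : Ω → ℕ} (hN : Measurable N) {φ : Ω → ℝ} (hφ : Integrable φ P)
    (hφ1 : ∀ ω, N ω = 0 → φ ω = 1) (hpos : 0 < 1 - ∫ ω, (0 : ℝ) ^ N ω ∂P) :
    ∫ ω, φ ω ∂(cond P {ω | 0 < N ω}) =
      1 - (1 - ∫ ω, φ ω ∂P) / (1 - ∫ ω, (0 : ℝ) ^ N ω ∂P) := by
  have hA : MeasurableSet {ω | 0 < N ω} := measurableSet_lt measurable_const hN
  have h1 := integral_add_compl hA hφ
  have h2 : ∫ ω in {ω | 0 < N ω}ᶜ, φ ω ∂P = ∫ ω, (0 : ℝ) ^ N ω ∂P := by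
    rw [setIntegral_congr_fun (g := fun _ => (1 : ℝ)) hA.compl fun ω hω =>
      hφ1 ω (by simpa using hω)]
    rw [setIntegral_const, smul_eq_mul, mul_one, probReal_compl_eq_one_sub hA,
      measureReal_pos_eq hN, sub_sub_cancel]
  rw [ProbabilityTheory.cond, integral_smul_measure, ENNReal.toReal_inv, ← measureReal_def,
    measureReal_pos_eq hN, smul_eq_mul]
  have h3 : ∫ ω in {ω | 0 < N ω}, φ ω ∂P = ∫ ω, φ ω ∂P - ∫ ω, (0 : ℝ) ^ N ω ∂P := by linarith
  rw [h3]
  field_simp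
  ring

end conditioning

/-- 1 - e^(-x) is x times a function continuous at 0 with value 1 there. Writing it through `dslope`
avoids a case distinction where J or K vanishes. -/
lemma tendsto_one_sub_exp_ratio {ι : Type*} {f : Filter ι} {J K : ι → ℝ} {c : ℝ}
    (hJ : Tendsto J f (𝓝 0)) (hK : Tendsto K f (𝓝 0))
    (hJK : Tendsto (fun i => J i / K i) f (𝓝 c)) :
    Tendsto (fun i => (1 - Real.exp (-J i)) / (1 - Real.exp (-K i))) f (𝓝 c) := by
  set e : ℝ → ℝ := fun x => 1 - Real.exp (-x) with he
  have hd : HasDerivAt e 1 0 := by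
    have := ((hasDerivAt_neg (0 : ℝ)).exp).const_sub 1
    simpa [he] using this
  have hcont : Tendsto (dslope e 0) (𝓝 0) (𝓝 1) := by
    have := continuousAt_dslope_same.2 hd.differentiableAt
    rw [ContinuousAt, dslope_same, hd.deriv] at this
    exact this
  have hs : ∀ x, e x = x * dslope e 0 x := fun x => by
    have := sub_smul_dslope e 0 x
    simp only [sub_zero, smul_eq_mul] at this
    rw [this]
    simp [he]
  have h := hJK.mul ((hcont.comp hJ).div (hcont.comp hK) one_ne_zero)
  rw [div_one, mul_one] at h
  refine h.congr fun i => ?_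
  change _ = e (J i) / e (K i)
  rw [hs, hs, mul_div_mul_comm]
  rfl

lemma setIntegral_Ioi_pos {a : ℝ → ℝ} (hi : IntegrableOn a (Ioi 0)) (h0 : ∀ t : ℝ, 0 < t → 0 ≤ a t)
    (hpos : ∀ᶠ t in atTop, 0 < a t) : 0 < ∫ t in Ioi 0, a t := by
  obtain ⟨T, hT⟩ := eventually_atTop.1 hpos
  rw [setIntegral_pos_iff_support_of_nonneg_ae _ hi]
  · have : Ioi (max T 0) ⊆ Function.support a ∩ Ioi 0 := fun u hu =>
      ⟨(hT u ((le_max_left _ _).trans (le_of_lt hu))).ne', (le_max_right T 0).trans_lt (mem_Ioi.1 hu)⟩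
    exact lt_of_lt_of_le (by simp) (measure_mono this)
  · filter_upwards [ae_restrict_mem measurableSet_Ioi] with u hu using h0 u hu

/-! ### Asymptotics of the exponent in the two regimes -/

section limits

variable {p im : PMF ℕ} {α γ θ : ℝ} {L l LR r : ℝ → ℝ} (mu : ℝ) [Fact (0 < mu)]

lemma regVar_rate (hLR : IsSlowlyVarying LR) (hr : ∀ t : ℝ, 0 < t → r t = t ^ (-θ) * LR t) :
    RegVar r θ := by
  have := (RegVar.rpow_neg θ).mul hLR.regVar
  rw [add_zero] at this
  exact this.congr (x₀ := 0) hr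

/-- Case (i): after reversing time, q is the factor with integrable tail and r the one of index -1.
-/
lemma tendsto_exponent_div_rate (hr : RegVar r 1) (hr0 : ∀ t : ℝ, 0 < t → 0 ≤ r t)
    (hri : ∀ t : ℝ, 0 ≤ t → IntervalIntegrable r volume 0 t)
    (hR : Tendsto (fun t : ℝ => ∫ u in (0 : ℝ)..t, r u) atTop atTop) {ρ s : ℝ} (hρ : 1 < ρ)
    (hs : s ∈ Icc (0 : ℝ) 1) (hq : RegVar (fun u => q mu p im u s) ρ) :
    Tendsto (fun t => (∫ v in (0 : ℝ)..t, r v * q mu p im (t - v) s) / r t) atTop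
      (𝓝 (Delta mu p im s)) := by
  have he : ∀ t, ∫ v in (0 : ℝ)..t, r v * q mu p im (t - v) s =
      ∫ u in (0 : ℝ)..t, q mu p im u s * r (t - u) := fun t => by
    have := intervalIntegral.integral_comp_sub_left (a := 0) (b := t)
      (fun v => r v * q mu p im (t - v) s) t
    simp only [sub_sub_cancel, sub_self, sub_zero] at this
    rw [← this]
    exact intervalIntegral.integral_congr fun u _ => mul_comm _ _
  simp only [he]
  refine tendsto_convolution hq hρ hr (fun t _ => intervalIntegrable_q mu hs t)
    (fun t _ => q_nonneg mu hs t) hri hr0 hR fun t ht => ?_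
  have := ((intervalIntegrable_mul_q mu (p := p) (im := im) hs (hri t ht)
    (φ := fun v => t - v) (by fun_prop)).comp_sub_left t).symm
  simpa [mul_comm] using this

lemma Delta_one : Delta mu p im 1 = 0 := by simp [Delta, q_one]


/-- Case (ii) with s = σ(t). As `qAux` is decreasing, q(t-v;σ(t)) is at most its value at
V(1/(1-σ(t))) ~ κμt, which is comparable with the normalisation uniformly in v. So dominated
convergence covers all of [0, t]; for s = 0 the shift vanishes and this bound is lost near v = t. -/
lemma tendsto_exponent_div_qAux (hp : ∀ s ∈ Ico (0 : ℝ) 1, s < pgf p s)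
    (hr0 : ∀ t : ℝ, 0 < t → 0 ≤ r t) (hri : IntegrableOn r (Ioi 0)) {ρ κ : ℝ}
    (hH : RegVar (qAux p im) ρ) {σ : ℝ → ℝ} (hσ : ∀ᶠ t in atTop, σ t ∈ Ico (0 : ℝ) 1)
    (hκ : 0 < κ) (hv : Tendsto (fun t => V p (1 / (1 - σ t)) / (mu * t)) atTop (𝓝 κ)) :
    Tendsto (fun t => (∫ v in (0 : ℝ)..t, r v * q mu p im (t - v) (σ t)) / qAux p im (mu * t)) atTop
      (𝓝 ((∫ v in Ioi 0, r v) * (1 + κ) ^ (-ρ))) := by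
  have hmu : 0 < mu := Fact.out
  have hmt : Tendsto (fun t => mu * t) atTop atTop := tendsto_id.const_mul_atTop hmu
  have hbd := (hH.tendsto_ratio hκ hmt hv).eventually_le_const (lt_add_one _)
  have hpos := hmt.eventually hH.pos
  set C := κ ^ (-ρ) + 1
  have h := tendsto_integral_filter_of_dominated_convergence (μ := volume.restrict (Ioi (0 : ℝ)))
    (l := atTop) (F := fun t v => (Iic t).indicator
      (fun v => r v * q mu p im (t - v) (σ t) / qAux p im (mu * t)) v)
    (f := fun v => r v * (1 + κ) ^ (-ρ)) (fun v => r v * C) ?_ ?_ (hri.mul_const C) ?_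
  · rw [integral_mul_const] at h
    refine h.congr' ?_
    filter_upwards [eventually_ge_atTop 0] with t ht
    rw [integral_indicator measurableSet_Iic, Measure.restrict_restrict measurableSet_Iic,
      Iic_inter_Ioi, ← intervalIntegral.integral_of_le ht, intervalIntegral.integral_div]
  · filter_upwards [hσ] with t ht
    refine AEStronglyMeasurable.indicator ?_ measurableSet_Iic
    have : Measurable fun v => q mu p im (t - v) (σ t) :=
      (measurable_q (Ico_subset_Icc_self ht)).comp (measurable_const.sub measurable_id)
    exact ((hri.aestronglyMeasurable.aemeasurable.mul this.aemeasurable).div_const _).aestronglyMeasurable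
  · filter_upwards [hσ, hbd, hpos] with t ht hb hp0
    filter_upwards [ae_restrict_mem measurableSet_Ioi] with v hv0
    have hrv := hr0 v hv0
    have hC : 0 ≤ C := by positivity
    by_cases hvt : v ≤ t
    · rw [indicator_of_mem (show v ∈ Iic t from hvt)]
      have hq := q_nonneg mu (p := p) (im := im) (Ico_subset_Icc_self ht) (t - v)
      rw [Real.norm_of_nonneg (div_nonneg (mul_nonneg hrv hq) hp0.le), mul_div_assoc]
      refine mul_le_mul_of_nonneg_left (le_trans ?_ hb) hrv
      have hV := V_nonneg hp (one_le_one_div_one_sub ht)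
      have h1 : 0 ≤ mu * (t - v) := mul_nonneg hmu.le (sub_nonneg.2 hvt)
      rw [q_eq_qAux mu hp ht (sub_nonneg.2 hvt)]
      exact div_le_div_of_nonneg_right (antitoneOn_qAux hp hV (add_nonneg h1 hV) (by linarith))
        hp0.le
    · rw [indicator_of_notMem (show v ∉ Iic t from hvt), norm_zero]
      exact mul_nonneg hrv hC
  · refine ae_of_all _ fun v => ?_
    have h1 : Tendsto (fun t => (mu * (t - v) + V p (1 / (1 - σ t))) / (mu * t)) atTop
        (𝓝 (1 + κ)) := by
      have h0 : Tendsto (fun t : ℝ => 1 - v / t) atTop (𝓝 (1 - 0)) :=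
        (tendsto_id.const_div_atTop v).const_sub 1
      rw [sub_zero] at h0
      refine (h0.add hv).congr' ?_
      filter_upwards [eventually_gt_atTop 0] with t ht
      field_simp
    refine ((hH.tendsto_ratio (by linarith) hmt h1).const_mul (r v)).congr' ?_
    filter_upwards [eventually_ge_atTop v, hσ] with t ht hs
    rw [indicator_of_mem (show v ∈ Iic t from ht), q_eq_qAux mu hp hs (sub_nonneg.2 ht),
      mul_div_assoc]

/-- Pointwise ratios suffice because 1/V is decreasing. The half-line starts at 2 to stay away from
V(1) = 0. -/
lemma regVar_inv_V (hL : IsSlowlyVarying L) (hf : ∀ s ∈ Ico (0 : ℝ) 1,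
    pgf p s = s + (1 - s) ^ (γ + 1) * L (1 / (1 - s))) : RegVar (fun x => (V p x)⁻¹) γ := by
  have hp := lt_pgf_of_slowlyVarying hL hf
  have hpos : ∀ x : ℝ, 2 ≤ x → 0 < V p x := fun x hx => by
    have := strictMonoOn_V hp (mem_Ici.2 le_rfl) (show (1 : ℝ) ≤ x by linarith)
      (show (1 : ℝ) < x by linarith)
    rwa [V_one] at this
  refine RegVar.of_antitone (x₀ := 2) (fun x hx y hy hxy => ?_) ?_ fun c hc => ?_
  · exact inv_anti₀ (hpos x hx) ((strictMonoOn_V hp).monotoneOn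
      (mem_Ici.2 (one_le_two.trans hx))
      (mem_Ici.2 (one_le_two.trans hy)) hxy)
  · filter_upwards [eventually_ge_atTop 2] with x hx using inv_pos.2 (hpos x hx)
  · rw [Real.rpow_neg hc.le]
    refine ((tendsto_V_ratio hL hf hc).inv₀ (Real.rpow_pos_of_pos hc _).ne').congr fun x => ?_
    rw [inv_div_inv, inv_div]

/-- 1 - exp(-λ/W) ~ λ/W, so the argument of V is asymptotic to W/λ, and V(W/λ) ~ λ^(-γ) V(W) with
V(W(μt)) = μt. -/
lemma tendsto_V_exp (hL : IsSlowlyVarying L) (hf : ∀ s ∈ Ico (0 : ℝ) 1,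
    pgf p s = s + (1 - s) ^ (γ + 1) * L (1 / (1 - s))) {lam : ℝ} (hlam : 0 < lam) :
    Tendsto (fun t => V p (1 / (1 - Real.exp (-lam / W p (mu * t)))) / (mu * t)) atTop
      (𝓝 (lam ^ (-γ))) := by
  have hmu : 0 < mu := Fact.out
  have hp := lt_pgf_of_slowlyVarying hL hf
  have hmt : Tendsto (fun t => mu * t) atTop atTop := tendsto_id.const_mul_atTop hmu
  have hW := (tendsto_W hp).comp hmt
  have hd : HasDerivAt (fun x => 1 - Real.exp (-lam * x)) lam 0 := by
    have := (((hasDerivAt_id (0 : ℝ)).const_mul (-lam)).exp).const_sub 1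
    simpa using this
  have hε : Tendsto (fun t => (W p (mu * t))⁻¹) atTop (𝓝[≠] 0) := by
    refine tendsto_nhdsWithin_iff.2 ⟨tendsto_inv_atTop_zero.comp hW, ?_⟩
    filter_upwards [hW.eventually_gt_atTop 0] with t ht using inv_ne_zero (ne_of_gt ht)
  have h1 : Tendsto (fun t => 1 / (1 - Real.exp (-lam / W p (mu * t))) / W p (mu * t)) atTop
      (𝓝 lam⁻¹) := by
    refine ((hd.tendsto_slope.comp hε).inv₀ hlam.ne').congr fun t => ?_
    simp only [Function.comp, slope_def_field, mul_zero, Real.exp_zero, sub_self, sub_zero,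
      inv_div, ← div_eq_mul_inv]
    rw [div_right_comm, one_div]
  have h2 := ((regVar_inv_V hL hf).tendsto_ratio (inv_pos.2 hlam) hW h1).inv₀
    (Real.rpow_pos_of_pos (inv_pos.2 hlam) _).ne'
  rw [← Real.rpow_neg (inv_pos.2 hlam).le, neg_neg, Real.inv_rpow hlam.le,
    ← Real.rpow_neg hlam.le] at h2
  refine h2.congr' ?_
  filter_upwards [hmt.eventually_ge_atTop 0] with t ht
  simp only [Function.comp, V_W hp ht]
  rw [inv_div_inv, inv_div]

end limits

/-! ### The conditional generating function -/

section immigration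

variable {Ω : Type*} [MeasurableSpace Ω] {P : Measure Ω} [IsProbabilityMeasure P]
  {r : ℝ → ℝ} {mu : ℝ} [Fact (0 < mu)] {p im : PMF ℕ} {S : ℕ → Ω → ℝ≥0∞} {I : ℕ → Ω → ℕ}
  {X : ℕ → ℕ → Ω → Tree}

/-- The common end of both cases: b is a normalisation tending to 0, and s may depend on t. The
condition d > 0 makes the conditioning event have positive probability for large t. -/
lemma IsImmigrationModel.tendsto_integral_cond_pow (h : IsImmigrationModel P r mu p im S I X)
    (hr : ∀ t : ℝ, 0 < t → 0 ≤ r t) (hri : ∀ t : ℝ, 0 ≤ t → IntervalIntegrable r volume 0 t)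
    (hp : ∀ s ∈ Ico (0 : ℝ) 1, s < pgf p s) {σ : ℝ → ℝ} (hσ : ∀ᶠ t in atTop, σ t ∈ Icc (0 : ℝ) 1)
    {b : ℝ → ℝ} {c d : ℝ} (hb : ∀ᶠ t in atTop, 0 < b t) (hb0 : Tendsto b atTop (𝓝 0))
    (hc : Tendsto (fun t => (∫ v in (0 : ℝ)..t, r v * q mu p im (t - v) (σ t)) / b t) atTop (𝓝 c))
    (hd : Tendsto (fun t => (∫ v in (0 : ℝ)..t, r v * q mu p im (t - v) 0) / b t) atTop (𝓝 d))
    (hd0 : 0 < d) :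
    (∀ᶠ t in atTop, IsProbabilityMeasure (cond P {ω | 0 < Y S I X t ω})) ∧
      Tendsto (fun t => ∫ ω, σ t ^ Y S I X t ω ∂(cond P {ω | 0 < Y S I X t ω})) atTop
        (𝓝 (1 - c / d)) := by
  have h0 : (0 : ℝ) ∈ Icc (0 : ℝ) 1 := by simp
  set J := fun t => ∫ v in (0 : ℝ)..t, r v * q mu p im (t - v) (σ t) with hJ
  set K := fun t => ∫ v in (0 : ℝ)..t, r v * q mu p im (t - v) 0 with hK
  have hzero : ∀ (A : ℝ → ℝ) (a : ℝ), Tendsto (fun t => A t / b t) atTop (𝓝 a) →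
      Tendsto A atTop (𝓝 0) := fun A a hA => by
    have := hA.mul hb0
    rw [mul_zero] at this
    refine this.congr' ?_
    filter_upwards [hb] with t ht using div_mul_cancel₀ _ ht.ne'
  have hJK : Tendsto (fun t => J t / K t) atTop (𝓝 (c / d)) := by
    refine (hc.div hd hd0.ne').congr' ?_
    filter_upwards [hb] with t ht
    exact div_div_div_cancel_right₀ ht.ne' _ _
  have hlim := (tendsto_one_sub_exp_ratio (hzero J c hc) (hzero K d hd) hJK).const_sub 1
  have hpos : ∀ᶠ t in atTop, 0 < 1 - ∫ ω, (0 : ℝ) ^ Y S I X t ω ∂P := by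
    filter_upwards [hb, hd.eventually_const_lt hd0, eventually_ge_atTop 0] with t h1 h2 ht
    rw [h.integral_pow_Y hr hri hp h0 ht, sub_pos, Real.exp_lt_one_iff, neg_lt_zero]
    exact (div_pos_iff_of_pos_right h1).1 h2
  refine ⟨?_, hlim.congr' ?_⟩
  · filter_upwards [hpos] with t ht
    rw [← measureReal_pos_eq (h.measurable_Y t)] at ht
    exact cond_isProbabilityMeasure fun h0 => by simp [measureReal_def, h0] at ht
  · filter_upwards [hpos, hσ, eventually_ge_atTop 0] with t h1 h2 ht
    rw [integral_cond_pos (φ := fun ω => σ t ^ Y S I X t ω) (h.measurable_Y t) ?_ (by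
      intro ω hω; simp [hω]) h1, h.integral_pow_Y hr hri hp h0 ht, h.integral_pow_Y hr hri hp h2 ht]
    refine Integrable.of_bound (C := 1)
      ((measurable_of_countable _).comp (h.measurable_Y t)).aestronglyMeasurable
      (ae_of_all _ fun ω => ?_)
    rw [Real.norm_of_nonneg (pow_nonneg h2.1 _)]
    exact pow_le_one₀ h2.1 h2.2

end immigration

end MBPNPI

/-! ### The two limit theorems -/

open MBPNPI

theorem theorem5p2
    {Ω : Type*} [MeasurableSpace Ω] (P : Measure Ω) [IsProbabilityMeasure P]
    (mu : ℝ) [Fact (0 < mu)] (offspring immigrants : PMF ℕ) (r : ℝ → ℝ)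
    (S : ℕ → Ω → ℝ≥0∞) (I : ℕ → Ω → ℕ) (X : ℕ → ℕ → Ω → MBPNPI.Tree)
    (hY : MBPNPI.IsImmigrationModel P r mu offspring immigrants S I X)
    (hr_nonneg : ∀ t : ℝ, 0 < t → 0 ≤ r t)
    (hr_int : ∀ t : ℝ, 0 ≤ t → IntervalIntegrable r volume 0 t)
    (θ α γ : ℝ) (hα : α ∈ Ioc (0 : ℝ) 1) (hγ : γ ∈ Ioc (0 : ℝ) 1)
    (LR L l : ℝ → ℝ) (hLR : MBPNPI.IsSlowlyVarying LR)
    (hL : MBPNPI.IsSlowlyVarying L) (hl : MBPNPI.IsSlowlyVarying l)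
    (hr : ∀ t : ℝ, 0 < t → r t = t ^ (-θ) * LR t)
    (hf : ∀ s ∈ Ico (0 : ℝ) 1,
      MBPNPI.pgf offspring s = s + (1 - s) ^ (γ + 1) * L (1 / (1 - s)))
    (hg : ∀ s ∈ Ico (0 : ℝ) 1,
      MBPNPI.pgf immigrants s = 1 - (1 - s) ^ α * l (1 / (1 - s))) :
    (θ = 1 → Tendsto (fun t : ℝ => ∫ u in (0 : ℝ)..t, r u) atTop atTop → 1 < α / γ →
      ∀ s ∈ Icc (0 : ℝ) 1,
        IntegrableOn (fun u => MBPNPI.q mu offspring immigrants u s) (Ioi 0) ∧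
        Tendsto
          (fun t : ℝ => ∫ ω, s ^ MBPNPI.Y S I X t ω ∂(cond P {ω | 0 < MBPNPI.Y S I X t ω}))
          atTop
          (𝓝 (1 - MBPNPI.Delta mu offspring immigrants s /
            MBPNPI.Delta mu offspring immigrants 0))) ∧
    (1 < θ → α / γ = 1 →
      Tendsto (fun t : ℝ => ∫ u in (0 : ℝ)..t, MBPNPI.q mu offspring immigrants u 0)
        atTop atTop →
      ∃ D : Measure ℝ, MBPNPI.IsLimitLaw α γ D ∧
        ∀ x : ℝ, 0 ≤ x →
          Tendsto
            (fun t : ℝ => (cond P {ω | 0 < MBPNPI.Y S I X t ω}).real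
              {ω | (MBPNPI.Y S I X t ω : ℝ) / MBPNPI.W offspring (mu * t) ≤ x})
            atTop (𝓝 (D.real (Iic x)))) := by

  have hmu : 0 < mu := Fact.out
  have hp := lt_pgf_of_slowlyVarying hL hf
  have hrv := regVar_rate hLR hr
  have h0 : (0 : ℝ) ∈ Ico (0 : ℝ) 1 := by simp
  have h0' : (0 : ℝ) ∈ Icc (0 : ℝ) 1 := by simp
  refine ⟨fun hθ hR hαγ s hs => ?_, fun hθ hαγ hQ => ?_⟩
  · subst hθ
    have hq := fun s (hs : s ∈ Ico (0 : ℝ) 1) => regVar_q mu hγ.1 hL hl hf hg hs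
    have hint := fun s (hs : s ∈ Ico (0 : ℝ) 1) => (hq s hs).integrableOn hαγ fun t _ =>
      intervalIntegrable_q mu (Ico_subset_Icc_self hs) t
    have hΔ := setIntegral_Ioi_pos (hint 0 h0) (fun t _ => q_nonneg mu h0' t) (hq 0 h0).pos
    have hlim := fun s (hs : s ∈ Ico (0 : ℝ) 1) => tendsto_exponent_div_rate mu hrv hr_nonneg
      hr_int hR hαγ (Ico_subset_Icc_self hs) (hq s hs)
    have key : Tendsto (fun t => (∫ v in (0 : ℝ)..t, r v * q mu offspring immigrants (t - v) s) /
        r t) atTop (𝓝 (Delta mu offspring immigrants s)) := by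
      -- At s = 1 the function q vanishes identically and is not regularly varying, so this value is
      -- treated apart.
      rcases hs.2.lt_or_eq with h1 | rfl
      · exact hlim s ⟨hs.1, h1⟩
      · simp [q_one, Delta_one]
    refine ⟨?_, (hY.tendsto_integral_cond_pow hr_nonneg hr_int hp (σ := fun _ => s)
      (Eventually.of_forall fun _ => hs) hrv.pos (hrv.tendsto_zero one_pos) key
      (hlim 0 h0) hΔ).2⟩
    rcases hs.2.lt_or_eq with h1 | rfl
    · exact hint s ⟨hs.1, h1⟩
    · simp [q_one]
  · have hαe : α = γ := (div_eq_one_iff_eq hγ.1.ne').1 hαγ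
    subst hαe
    have hH := regVar_qAux hγ.1 hL hl hf hg
    have hq := regVar_q mu hγ.1 hL hl hf hg h0
    rw [hαγ] at hH hq
    have hmt : Tendsto (fun t => mu * t) atTop atTop := tendsto_id.const_mul_atTop hmu
    have hri := hrv.integrableOn hθ hr_int
    have hR0 := setIntegral_Ioi_pos hri hr_nonneg hrv.pos
    have hb : ∀ᶠ t in atTop, 0 < qAux offspring immigrants (mu * t) := hmt.eventually hH.pos
    have hb0 : Tendsto (fun t => qAux offspring immigrants (mu * t)) atTop (𝓝 0) :=
      (hH.tendsto_zero one_pos).comp hmt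
    -- For s = 0 the general convolution estimate is used, now with r integrable and q(·;0) of index
    -- -1 with divergent integral.
    have hd := tendsto_convolution hrv hθ hq hr_int hr_nonneg
      (fun t _ => intervalIntegrable_q mu h0' t) (fun t _ => q_nonneg mu h0' t) hQ
      fun t ht => intervalIntegrable_mul_q mu h0' (hr_int t ht) (by fun_prop)
    -- Both exponents must be divided by the same function; q(t;0) equals `qAux` at μt because V(1)
    -- = 0.
    have hd' : Tendsto (fun t => (∫ v in (0 : ℝ)..t, r v * q mu offspring immigrants (t - v) 0) /
        qAux offspring immigrants (mu * t)) atTop (𝓝 (∫ v in Ioi 0, r v)) := by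
      refine hd.congr' ?_
      filter_upwards [eventually_ge_atTop 0] with t ht
      rw [q_eq_qAux (im := immigrants) mu hp h0 ht]
      simp [V_one]
    have hσ : ∀ lam : ℝ, 0 < lam → ∀ᶠ t in atTop,
        Real.exp (-lam / W offspring (mu * t)) ∈ Ico (0 : ℝ) 1 := fun lam hlam => by
      filter_upwards [hmt.eventually_ge_atTop 0] with t ht
      refine ⟨(Real.exp_pos _).le, Real.exp_lt_one_iff.2 ?_⟩
      exact div_neg_of_neg_of_pos (by linarith) (one_pos.trans_le (one_le_W hp ht))
    have key := fun lam (hlam : 0 < lam) => hY.tendsto_integral_cond_pow hr_nonneg hr_int hp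
      (σ := fun t => Real.exp (-lam / W offspring (mu * t)))
      ((hσ lam hlam).mono fun t ht => Ico_subset_Icc_self ht) hb hb0
      (tendsto_exponent_div_qAux mu hp hr_nonneg hri hH (hσ lam hlam)
        (Real.rpow_pos_of_pos hlam _) (tendsto_V_exp mu hL hf hlam)) hd' hR0
    refine exists_isLimitLaw_of_laplace hγ.1 (key 1 one_pos).1
      (Z := fun t ω => (Y S I X t ω : ℝ) / W offspring (mu * t)) (fun t => ?_) ?_ fun lam hlam => ?_
    · exact ((measurable_of_countable fun n : ℕ => (n : ℝ)).comp (hY.measurable_Y t)).div_const _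
    · filter_upwards [hmt.eventually_ge_atTop 0] with t ht ω
      exact div_nonneg (Nat.cast_nonneg _) (zero_le_one.trans (one_le_W hp ht))
    · convert (key lam hlam).2 using 2
      · refine integral_congr_ae (ae_of_all _ fun ω => ?_)
        simp only
        rw [← Real.exp_nat_mul]
        congr 1
        ring
      -- The factor ∫ r cancels from the quotient, leaving (1 + λ^(-α))^(-1) = λ^α / (1 + λ^α).
      · have h1 := Real.rpow_pos_of_pos hlam α
        rw [mul_div_cancel_left₀ _ hR0.ne', Real.rpow_neg hlam.le, Real.rpow_neg_one, hαγ,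
          Real.rpow_one]
        field_simp
        ring
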